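/- Let $G$ be a connected (finite or infinite) cubic graph, that is, a connected simple graph in which every vertex has valence 3. The distinguishing number $D(G)$ is the least number of colors in a vertex coloring of $G$ for which the identity is the only color-preserving automorphism. A vertex $v$ of $G$ is of type 2 if its stabilizer $\mathrm{Aut}_v(G)$ fixes one of the three edges incident to $v$ and interchanges the other two; it is of type 3 if $\mathrm{Aut}_v(G)$ fixes none of these edges, but does not induce the full symmetric group $S_3$ on them. For $n\ge 2$ let $T_n$ be the tree in which every vertex has valence 1 or 3 and the vertices of valence 1 (the leaves) are exactly those at distance $n$ from a fixed root vertex. Two leaves form a sibling pair if they have a common neighbor. The graph $R^2_n$ arises from $T_n$ by adding, for every sibling pair of leaves $u,v$, two new vertices $x,y$ and the edges of the 4-cycle $uxvy$ together with the edge $xy$. The graph $R^3_n$ arises from $T_n$ by adding, for every sibling pair of leaves $u,v$, four new vertices $x,y,z,w$ and the edges of the hexagon $uxzvyw$ together with the edges $xy$ and $zw$. **Theorem.** (i) If $G$ has a vertex of type 2, then $D(G)=2$, or $G$ is isomorphic to $R^2_n$ or to $R^3_n$ for some $n\ge 2$. (ii) If $G$ has a vertex of type 3, then $D(G)=2$.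 -/

import Mathlib

universe u

namespace CubicGraph

section Distinguishing

variable {V : Type u} (G : SimpleGraph V)

/-- A vertex coloring is distinguishing if the only automorphism of `G` that preserves all the
colors is the identity. -/
def IsDistinguishing {C : Type*} (c : V → C) : Prop :=
  ∀ φ : G ≃g G, (∀ v, c (φ v) = c v) → ∀ v, φ v = v

/-- The distinguishing number `D(G)`: the least number of colors in a distinguishing coloring
of the vertices (`⊤` if finitely many colors never suffice). -/
noncomputable def distinguishingNumber : ℕ∞ :=
  ⨅ (k : ℕ) (_ : ∃ c : V → Fin k, IsDistinguishing G c), (k : ℕ∞)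

/-- The permutation group that the stabilizer of `v` in `Aut(G)` induces on the neighbors of `v`
(equivalently, on the edges incident to `v`). -/
def localAction (v : V) : Subgroup (Equiv.Perm (G.neighborSet v)) where
  carrier := {σ | ∃ φ : G ≃g G, φ v = v ∧ ∀ a : G.neighborSet v, (σ a : V) = φ a}
  one_mem' := ⟨RelIso.refl _, rfl, fun _ => rfl⟩
  mul_mem' := by
    rintro σ τ ⟨φ, hφ, h⟩ ⟨ψ, hψ, h'⟩
    refine ⟨ψ.trans φ, by simp [hψ, hφ], fun a => ?_⟩
    rw [Equiv.Perm.mul_apply, h, h']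
    rfl
  inv_mem' := by
    rintro σ ⟨φ, hφ, h⟩
    refine ⟨φ.symm, by rw [RelIso.symm_apply_eq, hφ], fun a => ?_⟩
    rw [eq_comm, RelIso.symm_apply_eq, ← h]
    exact congrArg Subtype.val (σ.apply_symm_apply a).symm

/-- A vertex of valence 3 is of type 2 if its stabilizer fixes one incident edge and interchanges
the other two. -/
def IsTypeTwo (v : V) : Prop :=
  (G.neighborSet v).ncard = 3 ∧
    ∃ a b c : G.neighborSet v, a ≠ b ∧ a ≠ c ∧ b ≠ c ∧
      (∀ σ ∈ localAction G v, σ a = a) ∧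
      ∃ σ ∈ localAction G v, σ b = c ∧ σ c = b

/-- A vertex of valence 3 is of type 3 if its stabilizer leaves no incident edge fixed, but does
not induce the full symmetric group on the incident edges. -/
def IsTypeThree (v : V) : Prop :=
  (G.neighborSet v).ncard = 3 ∧
    (¬ ∃ a : G.neighborSet v, ∀ σ ∈ localAction G v, σ a = a) ∧
    localAction G v ≠ ⊤

end Distinguishing

section Families

/-- Vertices of the infinite rooted tree in which the root has three children and every other
vertex has two. The children of the root are `node i []`, and the children of `node i l` are
`node i (false :: l)` and `node i (true :: l)`. -/
inductive TreeNode : Type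
  | root : TreeNode
  | node (i : Fin 3) (l : List Bool) : TreeNode

namespace TreeNode

/-- The distance from the root. -/
def depth : TreeNode → ℕ
  | root => 0
  | node _ l => l.length + 1

/-- `IsChild s t` means that `t` is a child of `s`. -/
inductive IsChild : TreeNode → TreeNode → Prop
  | root (i : Fin 3) : IsChild root (node i [])
  | node (i : Fin 3) (l : List Bool) (b : Bool) : IsChild (node i l) (node i (b :: l))

end TreeNode

/-- The vertices of `T_n`. -/
abbrev TVertex (n : ℕ) : Type := {t : TreeNode // t.depth ≤ n}

/-- The tree `T_n`: all vertices have valence 1 or 3, and the vertices of valence 1 are those at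
distance `n` from the root. -/
def treeT (n : ℕ) : SimpleGraph (TVertex n) :=
  SimpleGraph.fromRel fun s t => TreeNode.IsChild s.1 t.1

/-- The sibling pairs of leaves of `T_n`, for `n ≥ 2`. The pair given by `(i, l)` consists of the
two children of the vertex `node i l`, which has depth `n - 1`. -/
abbrev LeafPair (n : ℕ) : Type := Fin 3 × {l : List Bool // l.length + 2 = n}

/-- The first leaf (`u`) of a sibling pair. -/
def LeafPair.u {n : ℕ} (p : LeafPair n) : TVertex n :=
  ⟨.node p.1 (false :: p.2.1), by have := p.2.2; simp [TreeNode.depth]; omega⟩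

/-- The second leaf (`v`) of a sibling pair. -/
def LeafPair.v {n : ℕ} (p : LeafPair n) : TVertex n :=
  ⟨.node p.1 (true :: p.2.1), by have := p.2.2; simp [TreeNode.depth]; omega⟩

/-- Add to `T_n` one copy of a gadget between the leaves `u`, `v` of every sibling pair of leaves.
The gadget is given by the graph `H` on its vertices other than `u` and `v`, by the set `Nu` of
those that are joined to `u` and the set `Nv` of those that are joined to `v`. -/
def addGadgets (n : ℕ) {I : Type} (H : SimpleGraph I) (Nu Nv : Set I) :
    SimpleGraph (TVertex n ⊕ (LeafPair n × I)) :=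
  SimpleGraph.fromRel fun s t =>
    match s, t with
    | .inl s, .inl t => (treeT n).Adj s t
    | .inl s, .inr (p, a) => (s = p.u ∧ a ∈ Nu) ∨ (s = p.v ∧ a ∈ Nv)
    | .inr (p, a), .inr (q, b) => p = q ∧ H.Adj a b
    | .inr _, .inl _ => False

/-- The vertices of a gadget of type 2 other than `u`, `v`. -/
inductive GadgetTwo : Type
  | x | y

/-- The vertices of a gadget of type 3 other than `u`, `v`. -/
inductive GadgetThree : Type
  | x | y | z | w

/-- The graph `R^2_n`: the gadgets are 4-cycles `u x v y` with the edge `xy`. -/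
def graphRTwo (n : ℕ) : SimpleGraph (TVertex n ⊕ (LeafPair n × GadgetTwo)) :=
  addGadgets n (SimpleGraph.fromEdgeSet {s(.x, .y)}) {.x, .y} {.x, .y}

/-- The graph `R^3_n`: the gadgets are hexagons `u x z v y w` with the edges `xy` and `zw`. -/
def graphRThree (n : ℕ) : SimpleGraph (TVertex n ⊕ (LeafPair n × GadgetThree)) :=
  addGadgets n (SimpleGraph.fromEdgeSet {s(.x, .z), s(.y, .w), s(.x, .y), s(.z, .w)})
    {.x, .w} {.z, .y}

end Families

end CubicGraph

namespace CubicGraph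

/-! A coloring in black and white is grown from a small colored set, the marker. Colored vertices
are added one neighbor at a time. A new vertex fixed by every automorphism that fixes the colored
part becomes white. Otherwise it has exactly one other possible image, because its predecessor
already has a colored neighbor, and the two get different colors. Zorn's lemma reaches the whole
graph (`exists_extension`), so only color-preserving automorphisms that move the marker have to be
excluded. The black vertices added on the way are sparse: in a finite black set not contained in the
black part of the marker, some vertex can be carried to a white one while the others stay fixed
(`Traced`). Hence a black vertex with three black neighbors comes from the marker, up to twins
(`Traced.core`), and suitable markers can be recognized.

Suppose that no such coloring works. `K₄` and `K_{3,3}` are excluded by the rigidity at the given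
vertex (`Stubborn.of_rigid`). Markers on diamonds, on `K_{3,3}` minus an edge, on nonadjacent twins
and on triangles then show that twins and triangles occur only inside pieces, which hang on the rest
of the graph by a single root (`Stubborn.int_of_twins`, `Stubborn.int_of_triangle`). From a vertex
`v` of type 2 or 3 one follows a path along which the stabilizer of each initial part interchanges
the two continuations. If the path never enters the root of a piece, its closed neighborhood, with
one more black vertex if the path stops, is a recognizable marker, a contradiction. So it enters a
root, and the interchanges, read backwards, multiply this piece into a full binary tree of pieces
behind the first edge (`Start.exists_branch`).

For type 3, an automorphism rotating the neighbors of `v` puts such a branch behind all three edges,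
so `v` is a center. But the branches at a center can be transposed, against type 3.

For type 2, the branch shows that a piece exists, and one enlarges branches upwards
(`Stubborn.exists_center`). If this never ends, a ray gives a marker. If it ends, the vertex above
the last branch is either rigid and gives a marker, or starts new paths, which produce a branch
facing the first one; then the edge between the two is a marker. So there is a center, and unfolding
from it gives an isomorphism with `graphRTwo` or `graphRThree` (`Center.exists_iso`). -/

variable {V : Type u} {G : SimpleGraph V}

/-! ### Cubic graphs through neighbor triples -/

/-- The neighbors of `p` are exactly the three distinct vertices `a`, `b`, `c`. -/
def Nb (G : SimpleGraph V) (p a b c : V) : Prop :=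
  a ≠ b ∧ a ≠ c ∧ b ≠ c ∧ ∀ x, G.Adj p x ↔ (x = a ∨ x = b ∨ x = c)

/-- Every vertex has exactly three neighbors. -/
def Cubic (G : SimpleGraph V) : Prop := ∀ p, ∃ a b c, Nb G p a b c

/-- Some set of vertices is preserved by the identity automorphism only. -/
def TwoDist (G : SimpleGraph V) : Prop :=
  ∃ Q : Set V, ∀ φ : G ≃g G, (∀ v, φ v ∈ Q ↔ v ∈ Q) → ∀ v, φ v = v

namespace Nb

theorem adj₁ {p a b c : V} (h : Nb G p a b c) : G.Adj p a := (h.2.2.2 a).2 (by simp)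
theorem adj₂ {p a b c : V} (h : Nb G p a b c) : G.Adj p b := (h.2.2.2 b).2 (by simp)
theorem adj₃ {p a b c : V} (h : Nb G p a b c) : G.Adj p c := (h.2.2.2 c).2 (by simp)

theorem rot {p a b c : V} (h : Nb G p a b c) : Nb G p b c a := by
  obtain ⟨h1, h2, h3, h4⟩ := h
  exact ⟨h3, h1.symm, h2.symm, fun x => by rw [h4]; tauto⟩

theorem swap {p a b c : V} (h : Nb G p a b c) : Nb G p a c b := by
  obtain ⟨h1, h2, h3, h4⟩ := h
  exact ⟨h2, h1, h3.symm, fun x => by rw [h4]; tauto⟩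

theorem mem {p a b c x : V} (h : Nb G p a b c) (hx : G.Adj p x) : x = a ∨ x = b ∨ x = c :=
  (h.2.2.2 x).1 hx

theorem map {p a b c : V} (h : Nb G p a b c) (φ : G ≃g G) : Nb G (φ p) (φ a) (φ b) (φ c) := by
  obtain ⟨h1, h2, h3, h4⟩ := h
  refine ⟨φ.injective.ne h1, φ.injective.ne h2, φ.injective.ne h3, fun x => ?_⟩
  obtain ⟨y, rfl⟩ := φ.surjective x
  rw [φ.map_adj_iff, h4]
  simp [φ.injective.eq_iff]

end Nb

theorem Cubic.nb₁ (hc : Cubic G) {p a : V} (h : G.Adj p a) : ∃ b c, Nb G p a b c := by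
  obtain ⟨x, y, z, hn⟩ := hc p
  rcases hn.mem h with rfl | rfl | rfl
  exacts [⟨_, _, hn⟩, ⟨_, _, hn.rot⟩, ⟨_, _, hn.rot.rot⟩]

theorem Cubic.nb₂ (hc : Cubic G) {p a b : V} (h : G.Adj p a) (h' : G.Adj p b) (hab : a ≠ b) :
    ∃ c, Nb G p a b c := by
  obtain ⟨x, y, hn⟩ := hc.nb₁ h
  rcases hn.mem h' with rfl | rfl | rfl
  exacts [absurd rfl hab, ⟨_, hn⟩, ⟨_, hn.swap⟩]

/-! ### Growing a symmetry-breaking coloring -/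

/-- A coloring (`Q` is the set of black vertices) of a part `F` of the graph extending the
coloring `Q₀` of `F₀` such that automorphisms fixing `F₀` and respecting the colors fix `F`, and
in which black vertices arise only by breaking symmetries. -/
structure IsPartial (G : SimpleGraph V) (F₀ Q₀ F Q : Set V) : Prop where
  base : F₀ ⊆ F
  sub : Q ⊆ F
  agree : ∀ v ∈ F₀, v ∈ Q ↔ v ∈ Q₀
  nbr : ∀ u ∈ F, ∃ w ∈ F, G.Adj u w
  rigid : ∀ φ : G ≃g G, (∀ z ∈ F₀, φ z = z) → (∀ z ∈ F, φ z ∈ F → (φ z ∈ Q ↔ z ∈ Q)) →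
    ∀ z ∈ F, φ z = z
  trace : ∀ A : Set V, A.Finite → A ⊆ Q → ¬ A ⊆ Q₀ →
    ∃ x ∈ A, ∃ φ : G ≃g G, (∀ z ∈ A, z ≠ x → φ z = z) ∧ φ x ∈ F ∧ φ x ∉ Q

/-- Since `u` has a neighbor `w` in `F`, an automorphism fixing `F` can only permute the other two
neighbors of `u`. If some `φ` moves `x`, these are `x` and `φ x`; coloring `x` black and `φ x` white
kills the exchange, and `φ` itself is the witness for `trace` whenever `x ∈ A`. -/
theorem IsPartial.extend (hc : Cubic G) {F₀ Q₀ F Q : Set V} (h : IsPartial G F₀ Q₀ F Q)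
    {u x : V} (hu : u ∈ F) (hux : G.Adj u x) (hx : x ∉ F) :
    ∃ F' Q', IsPartial G F₀ Q₀ F' Q' ∧ F ⊆ F' ∧ Q = Q' ∩ F ∧ x ∈ F' := by
  by_cases hfix : ∀ φ : G ≃g G, (∀ z ∈ F, φ z = z) → φ x = x
  · refine ⟨insert x F, Q, ⟨h.base.trans (Set.subset_insert _ _),
      h.sub.trans (Set.subset_insert _ _), h.agree, ?_, ?_, ?_⟩, Set.subset_insert _ _,
      (Set.inter_eq_left.2 h.sub).symm, Set.mem_insert _ _⟩
    · rintro w (rfl | hw)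
      · exact ⟨u, Set.mem_insert_of_mem _ hu, hux.symm⟩
      · obtain ⟨y, hy, hwy⟩ := h.nbr w hw
        exact ⟨y, Set.mem_insert_of_mem _ hy, hwy⟩
    · intro φ h0 hφ
      have hF := h.rigid φ h0 fun z hz hz' =>
        hφ z (Set.mem_insert_of_mem _ hz) (Set.mem_insert_of_mem _ hz')
      rintro z (rfl | hz)
      · exact hfix φ hF
      · exact hF z hz
    · intro A hA hAQ hAQ0
      obtain ⟨y, hy, φ, h1, h2, h3⟩ := h.trace A hA hAQ hAQ0
      exact ⟨y, hy, φ, h1, Set.mem_insert_of_mem _ h2, h3⟩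
  · push Not at hfix
    obtain ⟨φ, hφF, hφx⟩ := hfix
    obtain ⟨w, hw, huw⟩ := h.nbr u hu
    have hφu := hφF u hu
    have hxw : w ≠ x := fun e => hx (e ▸ hw)
    have hux' : G.Adj u (φ x) := by
      have := φ.map_adj_iff.2 hux
      rwa [hφu] at this
    have hyF : φ x ∉ F := by
      intro hy
      have := hφF _ hy
      exact hφx (φ.injective this)
    have hyw : w ≠ φ x := fun e => hyF (e ▸ hw)
    obtain ⟨y, hyn⟩ := hc.nb₂ huw hux hxw
    have hy : y = φ x := by
      rcases hyn.mem hux' with e | e | e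
      · exact absurd e.symm hyw
      · exact absurd e hφx
      · exact e.symm
    rw [hy] at hyn
    clear hy y
    set y := φ x with hydef
    have hxQ : x ∉ Q := fun hq => hx (h.sub hq)
    have hyQ : y ∉ Q := fun hq => hyF (h.sub hq)
    refine ⟨insert x (insert y F), insert x Q, ⟨?_, ?_, ?_, ?_, ?_, ?_⟩, ?_, ?_, ?_⟩
    · exact h.base.trans ((Set.subset_insert _ _).trans (Set.subset_insert _ _))
    · exact Set.insert_subset_insert (h.sub.trans (Set.subset_insert _ _))
    · intro v hv
      have : v ≠ x := fun e => hx (e ▸ h.base hv)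
      rw [Set.mem_insert_iff, ← h.agree v hv]
      simp [this]
    · rintro z (rfl | rfl | hz)
      · exact ⟨u, by simp [hu], hux.symm⟩
      · exact ⟨u, by simp [hu], hux'.symm⟩
      · obtain ⟨z', hz', hzz⟩ := h.nbr z hz
        exact ⟨z', by simp [hz'], hzz⟩
    · intro ψ h0 hψ
      have hF := h.rigid ψ h0 fun z hz hz' => by
        have := hψ z (by simp [hz]) (by simp [hz'])
        have h1 : z ≠ x := fun e => hx (e ▸ hz)
        have h2 : ψ z ≠ x := fun e => hx (e ▸ hz')
        simpa [h1, h2] using this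
      have hψn := hyn.map ψ
      rw [hF u hu, hF w hw] at hψn
      have hψx : ψ x = x := by
        have := hψn.adj₂
        rcases hyn.mem this with e | e | e
        · exact absurd e.symm hψn.1
        · exact e
        · have h3 := (hψ x (by simp) (by simp [e])).2 (by simp)
          rw [e] at h3
          rcases h3 with h3 | h3
          · exact absurd h3 hφx
          · exact absurd h3 hyQ
      rintro z (rfl | rfl | hz)
      · exact hψx
      · have := hψn.adj₃
        rcases hyn.mem this with e | e | e
        · exact absurd e.symm hψn.2.1
        · rw [← hψx] at e
          exact absurd (ψ.injective e) hφx
        · exact e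
      · exact hF z hz
    · intro A hA hAQ hAQ0
      by_cases hxA : x ∈ A
      · refine ⟨x, hxA, φ, fun z hz hzx => hφF z ?_, by simp [y], ?_⟩
        · rcases hAQ hz with e | e
          · exact absurd e hzx
          · exact h.sub e
        · rintro (e | e)
          · exact hφx e
          · exact hyQ e
      · have hAQ' : A ⊆ Q := fun z hz => by
          rcases hAQ hz with e | e
          · exact absurd (e ▸ hz) hxA
          · exact e
        obtain ⟨z, hz, ψ, h1, h2, h3⟩ := h.trace A hA hAQ' hAQ0
        refine ⟨z, hz, ψ, h1, by simp [h2], ?_⟩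
        rintro (e | e)
        · exact hx (e ▸ h2)
        · exact h3 e
    · exact (Set.subset_insert _ _).trans (Set.subset_insert _ _)
    · ext z
      simp only [Set.mem_inter_iff, Set.mem_insert_iff]
      constructor
      · exact fun hz => ⟨Or.inr hz, h.sub hz⟩
      · rintro ⟨rfl | hz, hz'⟩
        · exact absurd hz' hx
        · exact hz
    · simp

/-- The process lemma: a partial coloring extends to the whole graph. -/
theorem exists_extension (hconn : G.Connected) (hc : Cubic G) {F₀ Q₀ : Set V}
    (hne : F₀.Nonempty) (hsub : Q₀ ⊆ F₀) (hnb : ∀ u ∈ F₀, ∃ w ∈ F₀, G.Adj u w) :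
    ∃ Q : Set V, (∀ v ∈ F₀, v ∈ Q ↔ v ∈ Q₀) ∧
      (∀ φ : G ≃g G, (∀ z ∈ F₀, φ z = z) → (∀ z, φ z ∈ Q ↔ z ∈ Q) → ∀ z, φ z = z) ∧
      (∀ A : Set V, A.Finite → A ⊆ Q → ¬ A ⊆ Q₀ →
        ∃ x ∈ A, ∃ φ : G ≃g G, (∀ z ∈ A, z ≠ x → φ z = z) ∧ φ x ∉ Q) := by
  have h0 : IsPartial G F₀ Q₀ F₀ Q₀ :=
    ⟨subset_rfl, hsub, fun _ _ => Iff.rfl, hnb, fun φ h _ => h, fun A _ h h' => absurd h h'⟩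
  let T := {p : Set V × Set V // IsPartial G F₀ Q₀ p.1 p.2}
  let r : T → T → Prop := fun p q => p.1.1 ⊆ q.1.1 ∧ p.1.2 = q.1.2 ∩ p.1.1
  have hrefl : ∀ p : T, r p p := fun p => ⟨subset_rfl, (Set.inter_eq_left.2 p.2.sub).symm⟩
  have key : ∃ m : T, ∀ a, r m a → r a m := by
    refine exists_maximal_of_chains_bounded (r := r) ?_ ?_
    · intro c hch
      rcases c.eq_empty_or_nonempty with rfl | ⟨p0, hp0⟩
      · exact ⟨⟨(F₀, Q₀), h0⟩, by simp⟩
      have hdir : ∀ p ∈ c, ∀ q ∈ c, ∃ s ∈ c, r p s ∧ r q s := by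
        intro p hp q hq
        by_cases e : p = q
        · exact ⟨p, hp, hrefl p, e ▸ hrefl p⟩
        · rcases hch hp hq e with h | h
          · exact ⟨q, hq, h, hrefl q⟩
          · exact ⟨p, hp, hrefl p, h⟩
      let F : Set V := ⋃ p ∈ c, p.1.1
      let Q : Set V := ⋃ p ∈ c, p.1.2
      have hF : ∀ {z}, z ∈ F ↔ ∃ p ∈ c, z ∈ p.1.1 := by simp [F]
      have hQ : ∀ {z}, z ∈ Q ↔ ∃ p ∈ c, z ∈ p.1.2 := by simp [Q]
      have hQF : ∀ p ∈ c, ∀ z ∈ p.1.1, z ∈ Q ↔ z ∈ p.1.2 := by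
        intro p hp z hz
        refine ⟨fun h => ?_, fun h => hQ.2 ⟨p, hp, h⟩⟩
        obtain ⟨q, hq, hzq⟩ := hQ.1 h
        obtain ⟨s, hs, h1, h2⟩ := hdir p hp q hq
        rw [h1.2]
        rw [h2.2] at hzq
        exact ⟨hzq.1, hz⟩
      have hbig : IsPartial G F₀ Q₀ F Q := by
        refine ⟨fun z hz => hF.2 ⟨p0, hp0, p0.2.base hz⟩, ?_, ?_, ?_, ?_, ?_⟩
        · intro z hz
          obtain ⟨p, hp, h⟩ := hQ.1 hz
          exact hF.2 ⟨p, hp, p.2.sub h⟩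
        · intro v hv
          rw [hQF p0 hp0 v (p0.2.base hv), p0.2.agree v hv]
        · intro u hu
          obtain ⟨p, hp, h⟩ := hF.1 hu
          obtain ⟨w, hw, h'⟩ := p.2.nbr u h
          exact ⟨w, hF.2 ⟨p, hp, hw⟩, h'⟩
        · intro φ hφ0 hφ z hz
          obtain ⟨p, hp, h⟩ := hF.1 hz
          refine p.2.rigid φ hφ0 (fun y hy hy' => ?_) z h
          rw [← hQF p hp _ hy, ← hQF p hp _ hy']
          exact hφ y (hF.2 ⟨p, hp, hy⟩) (hF.2 ⟨p, hp, hy'⟩)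
        · intro A hA hAQ hAQ0
          -- Finiteness of `A` is what lets `trace` pass to unions of chains: `A` is already black
          -- in a single member.
          have : ∃ p ∈ c, A ⊆ p.1.2 := by
            clear hAQ0
            induction A, hA using Set.Finite.induction_on with
            | empty => exact ⟨p0, hp0, Set.empty_subset _⟩
            | @insert a S ha hS ih =>
              obtain ⟨p, hp, h1⟩ := ih ((Set.subset_insert _ _).trans hAQ)
              obtain ⟨q, hq, h2⟩ := hQ.1 (hAQ (Set.mem_insert _ _))
              obtain ⟨s, hs, h3, h4⟩ := hdir p hp q hq
              refine ⟨s, hs, Set.insert_subset ?_ (h1.trans ?_)⟩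
              · rw [h4.2] at h2
                exact h2.1
              · rw [h3.2]
                exact Set.inter_subset_left
          obtain ⟨p, hp, hAp⟩ := this
          obtain ⟨x, hx, φ, h1, h2, h3⟩ := p.2.trace A hA hAp hAQ0
          exact ⟨x, hx, φ, h1, hF.2 ⟨p, hp, h2⟩, fun h => h3 ((hQF p hp _ h2).1 h)⟩
      refine ⟨⟨(F, Q), hbig⟩, fun p hp => ⟨fun z hz => hF.2 ⟨p, hp, hz⟩, ?_⟩⟩
      ext z
      constructor
      · exact fun hz => ⟨hQ.2 ⟨p, hp, hz⟩, p.2.sub hz⟩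
      · exact fun hz => (hQF p hp z hz.2).1 hz.1
    · intro a b c hab hbc
      refine ⟨hab.1.trans hbc.1, ?_⟩
      rw [hab.2, hbc.2, Set.inter_assoc, Set.inter_eq_right.2 hab.1]
  obtain ⟨⟨⟨F, Q⟩, hm⟩, hmax⟩ := key
  have hall : ∀ z, z ∈ F := by
    obtain ⟨f, hf⟩ := hne
    have hcl : ∀ u x, u ∈ F → G.Adj u x → x ∈ F := by
      intro u x hu hux
      by_contra hx
      obtain ⟨F', Q', h1, h2, h3, h4⟩ := hm.extend hc hu hux hx
      exact hx ((hmax ⟨(F', Q'), h1⟩ ⟨h2, h3⟩).1 h4)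
    intro z
    obtain ⟨w⟩ := hconn.preconnected f z
    have : ∀ {a b : V} (_ : G.Walk a b), a ∈ F → b ∈ F := by
      intro a b w
      induction w with
      | nil => exact id
      | cons h _ ih => exact fun ha => ih (hcl _ _ ha h)
    exact this w (hm.base hf)
  refine ⟨Q, hm.agree, fun φ h1 h2 z => hm.rigid φ h1 (fun z _ _ => h2 z) z (hall z), ?_⟩
  intro A h1 h2 h3
  obtain ⟨x, hx, φ, h4, _, h5⟩ := hm.trace A h1 h2 h3
  exact ⟨x, hx, φ, h4, h5⟩


/-! ### Markers and the sparsity of the other black vertices -/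

/-- Black vertices outside `Q₀` arise only by breaking symmetries: in every finite set of black
vertices not contained in `Q₀`, some vertex is moved to a white one by an automorphism that fixes
the others. -/
def Traced (G : SimpleGraph V) (Q₀ Q : Set V) : Prop :=
  ∀ A : Set V, A.Finite → A ⊆ Q → ¬ A ⊆ Q₀ →
    ∃ x ∈ A, ∃ φ : G ≃g G, (∀ z ∈ A, z ≠ x → φ z = z) ∧ φ x ∉ Q

theorem TwoDist.of_marker (hconn : G.Connected) (hc : Cubic G) (F₀ Q₀ : Set V)
    (hne : F₀.Nonempty) (hsub : Q₀ ⊆ F₀) (hnb : ∀ u ∈ F₀, ∃ w ∈ F₀, G.Adj u w)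
    (h : ∀ Q : Set V, (∀ v ∈ F₀, v ∈ Q ↔ v ∈ Q₀) → Traced G Q₀ Q →
      ∀ φ : G ≃g G, (∀ z, φ z ∈ Q ↔ z ∈ Q) → ∀ z ∈ F₀, φ z = z) : TwoDist G := by
  obtain ⟨Q, h1, h2, h3⟩ := exists_extension hconn hc hne hsub hnb
  exact ⟨Q, fun φ hφ => h2 φ (h Q h1 h3 φ hφ) hφ⟩

/-- A black vertex with black neighbors comes from the initial coloring, except possibly if it has
a twin. -/
theorem Traced.core (hc : Cubic G) {Q₀ Q : Set V} (hT : Traced G Q₀ Q) {w a b c : V}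
    (hn : Nb G w a b c) (hw : w ∈ Q) (ha : a ∈ Q) (hb : b ∈ Q) (hcQ : c ∈ Q) :
    (a ∈ Q₀ ∧ b ∈ Q₀ ∧ c ∈ Q₀) ∧ (w ∈ Q₀ ∨ ∃ w', w' ≠ w ∧ Nb G w' a b c) := by
  have twin : ∀ w', w' ≠ w → Nb G w' a b c → a ∈ Q₀ ∧ b ∈ Q₀ ∧ c ∈ Q₀ := by
    intro w' hne hn'
    by_contra hcon
    obtain ⟨x, hx, φ, h1, h2⟩ := hT {a, b, c} (by simp) (by
      rintro z (rfl | rfl | rfl) <;> assumption) (by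
      intro hs
      exact hcon ⟨hs (by simp), hs (by simp), hs (by simp)⟩)
    -- The fixed vertex `q` has only three neighbors, two of them `w` and `w'`. So `φ w` and `φ w'`,
    -- which are distinct neighbors of `q`, cannot both avoid `{w, w'}`, and `φ p` is adjacent to
    -- one of the twins, hence to both. It is then black, against the choice of `φ`.
    have key : ∀ p q r : V, Nb G w p q r → Nb G w' p q r → φ q = q → G.Adj w (φ p) := by
      intro p q r hp hp' hq
      have e1 : G.Adj q (φ w) := by
        have := φ.map_adj_iff.2 hp.adj₂.symm
        rwa [hq] at this
      have e2 : G.Adj q (φ w') := by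
        have := φ.map_adj_iff.2 hp'.adj₂.symm
        rwa [hq] at this
      have e3 := φ.map_adj_iff.2 hp.adj₁
      have e4 := φ.map_adj_iff.2 hp'.adj₁
      have e5 : φ w ≠ φ w' := fun e => hne (φ.injective e).symm
      by_cases hA : φ w = w ∨ φ w' = w
      · rcases hA with e | e
        · rwa [e] at e3
        · rwa [e] at e4
      by_cases hB : φ w = w' ∨ φ w' = w'
      · have : G.Adj w' (φ p) := by
          rcases hB with e | e
          · rwa [e] at e3
          · rwa [e] at e4
        rcases hp'.mem this with e | e | e <;> rw [e]
        exacts [hp.adj₁, hp.adj₂, hp.adj₃]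
      · push Not at hA hB
        obtain ⟨r', hr'⟩ := hc.nb₂ hp.adj₂.symm hp'.adj₂.symm hne.symm
        have f1 := hr'.mem e1
        have f2 := hr'.mem e2
        exact absurd ((f1.resolve_left hA.1).resolve_left hB.1)
          (fun e => e5 (e.trans ((f2.resolve_left hA.2).resolve_left hB.2).symm))
    rcases hx with rfl | rfl | rfl
    · have := key _ _ _ hn hn' (h1 _ (by simp) hn.1.symm)
      rcases hn.mem this with e | e | e <;> exact h2 (by rw [e]; assumption)
    · have := key _ _ _ hn.rot hn'.rot (h1 _ (by simp) hn.2.2.1.symm)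
      rcases hn.mem this with e | e | e <;> exact h2 (by rw [e]; assumption)
    · have := key _ _ _ hn.rot.rot hn'.rot.rot (h1 _ (by simp) hn.2.1)
      rcases hn.mem this with e | e | e <;> exact h2 (by rw [e]; assumption)
  by_cases hs : w ∈ Q₀ ∧ a ∈ Q₀ ∧ b ∈ Q₀ ∧ c ∈ Q₀
  · exact ⟨hs.2, Or.inl hs.1⟩
  obtain ⟨x, hx, φ, h1, h2⟩ := hT {w, a, b, c} (by simp) (by
    rintro z (rfl | rfl | rfl | rfl) <;> assumption) (by
    intro h
    exact hs ⟨h (by simp), h (by simp), h (by simp), h (by simp)⟩)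
  -- If `w` were fixed, a moved neighbor would go to another neighbor of `w`, which is black. So `w`
  -- is the moved vertex, and its image is a twin.
  have hwx : w = x := by
    by_contra hwx
    have e1 := h1 w (by simp) hwx
    have hadj : G.Adj w x := by
      rcases hx with rfl | rfl | rfl | rfl
      exacts [absurd rfl hwx, hn.adj₁, hn.adj₂, hn.adj₃]
    have := φ.map_adj_iff.2 hadj
    rw [e1] at this
    rcases hn.mem this with e | e | e <;> exact h2 (by rw [e]; assumption)
  subst hwx
  have hn2 := hn.map φ
  rw [h1 a (by simp) hn.adj₁.ne', h1 b (by simp) hn.adj₂.ne', h1 c (by simp) hn.adj₃.ne'] at hn2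
  have hne : φ w ≠ w := fun e => h2 (e.symm ▸ hw)
  exact ⟨twin _ hne hn2, Or.inr ⟨_, hne, hn2⟩⟩

/-! ### Recognizable pairs and triples -/

/-- If there is an invariant family of disjoint pairs `{u, u'}` whose outer neighbors are distinct,
then two colors suffice. -/
theorem twoDist_of_pairs (hconn : G.Connected) (hc : Cubic G) (P : V → V → V → V → Prop)
    (inv : ∀ (φ : G ≃g G) u u' a t, P u u' a t → P (φ u) (φ u') (φ a) (φ t))
    (uniq : ∀ u u' a t x y z, P u u' a t → P u x y z → x = u' ∧ y = a ∧ z = t)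
    (symm : ∀ u u' a t, P u u' a t → P u' u t a)
    (prop : ∀ u u' a t, P u u' a t →
      u ≠ u' ∧ G.Adj u a ∧ G.Adj u' t ∧ a ≠ t ∧ a ≠ u' ∧ t ≠ u)
    {u u' a t : V} (h : P u u' a t) : TwoDist G := by
  obtain ⟨h1, h2, h3, h4, h5, h6⟩ := prop _ _ _ _ h
  refine TwoDist.of_marker hconn hc {u, u', a, t} {u, u', a} ⟨u, by simp⟩ ?_ ?_ ?_
  · intro z; simp; tauto
  · rintro z (e | e | e | e) <;> rw [e]
    exacts [⟨a, by simp, h2⟩, ⟨t, by simp, h3⟩, ⟨u, by simp, h2.symm⟩, ⟨u', by simp, h3.symm⟩]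
  intro Q hQ hT φ hφ
  have hu : u ∈ Q := (hQ u (by simp)).2 (by simp)
  have hu' : u' ∈ Q := (hQ u' (by simp)).2 (by simp)
  have ha : a ∈ Q := (hQ a (by simp)).2 (by simp)
  have ht : t ∉ Q := fun e => by
    have := (hQ t (by simp)).1 e
    rcases this with e | e | e
    exacts [h6 e, h3.ne' e, h4 e.symm]
  have hP := inv φ _ _ _ _ h
  -- One member of a pair determines the other, so no automorphism moves one and fixes its partner.
  -- By `Traced` the image pair therefore lies in the marker.
  have hsub : ({φ u, φ u'} : Set V) ⊆ {u, u', a} := by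
    by_contra hcon
    obtain ⟨x, hx, ψ, hψ, hxQ⟩ := hT {φ u, φ u'} (by simp) (by
      rintro z (rfl | rfl)
      exacts [(hφ _).2 hu, (hφ _).2 hu']) hcon
    have hP' := inv ψ _ _ _ _ hP
    have hne : φ u ≠ φ u' := φ.injective.ne h1
    rcases hx with rfl | rfl
    · rw [hψ (φ u') (by simp) hne.symm] at hP'
      have := (uniq _ _ _ _ _ _ _ (symm _ _ _ _ hP) (symm _ _ _ _ hP')).1
      exact hxQ (by rw [this]; exact (hφ _).2 hu)
    · rw [hψ (φ u) (by simp) hne] at hP'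
      have := (uniq _ _ _ _ _ _ _ hP hP').1
      exact hxQ (by rw [this]; exact (hφ _).2 hu')
  have c1 : φ u = u ∧ φ u' = u' ∧ φ a = a ∧ φ t = t ∨ φ u = u' ∧ φ a = t := by
    have hne : φ u ≠ φ u' := φ.injective.ne h1
    have m1 := hsub (Set.mem_insert _ _)
    have m2 := hsub (show φ u' ∈ _ by simp)
    rcases m1 with e | e | e
    · rw [e] at hP ⊢
      have := uniq _ _ _ _ _ _ _ h hP
      tauto
    · rw [e] at hP ⊢
      have := uniq _ _ _ _ _ _ _ (symm _ _ _ _ h) hP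
      tauto
    · rcases m2 with e' | e' | e'
      · rw [e'] at hP
        have := uniq _ _ _ _ _ _ _ h (symm _ _ _ _ hP)
        tauto
      · rw [e'] at hP ⊢
        have := uniq _ _ _ _ _ _ _ (symm _ _ _ _ h) (symm _ _ _ _ hP)
        tauto
      · exact absurd (e.trans e'.symm) hne
  rcases c1 with ⟨e1, e2, e3, e4⟩ | ⟨-, e⟩
  · rintro z (rfl | rfl | rfl | rfl) <;> assumption
  · exact absurd ((hφ a).2 ha) (e ▸ ht)

/-- If there is an invariant family of disjoint triples with distinct outer neighbors, then two
colors suffice. -/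
theorem twoDist_of_triples (hconn : G.Connected) (hc : Cubic G)
    (T : (Fin 3 → V) → (Fin 3 → V) → Prop)
    (inv : ∀ (φ : G ≃g G) t u, T t u → T (fun i => φ (t i)) (fun i => φ (u i)))
    (perm : ∀ (π : Equiv.Perm (Fin 3)) t u, T t u → T (t ∘ π) (u ∘ π))
    (share : ∀ t u s w i j, T t u → T s w → s j = t i →
      ∃ π : Equiv.Perm (Fin 3), s = t ∘ π ∧ w = u ∘ π)
    (prop : ∀ t u, T t u → Function.Injective t ∧ Function.Injective u ∧ (∀ i j, t i ≠ u j) ∧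
      ∀ i, G.Adj (t i) (u i))
    (outer : ∀ t u s w i j, T t u → T s w → w j = t i → s j = u i)
    (dual : ∀ t u s w, T t u → T u t → T s w → ∃ i j, s j = t i ∨ s j = u i)
    {t u : Fin 3 → V} (h : T t u) : TwoDist G := by
  obtain ⟨h1, h2, h3, h4⟩ := prop _ _ h
  have hnb : ∀ z ∈ Set.range t ∪ Set.range u, ∃ w ∈ Set.range t ∪ Set.range u, G.Adj z w := by
    rintro z (⟨i, rfl⟩ | ⟨i, rfl⟩)
    exacts [⟨u i, by simp, h4 i⟩, ⟨t i, by simp, (h4 i).symm⟩]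
  have perm_eq : ∀ π : Equiv.Perm (Fin 3), π 0 = 0 → π 1 = 1 → π = 1 := by decide
  have perm_eq' : ∀ π : Equiv.Perm (Fin 3), π 0 = 0 → π 2 = 2 → π = 1 := by decide
  have perm_eq'' : ∀ π : Equiv.Perm (Fin 3), π 1 = 1 → π 2 = 2 → π = 1 := by decide
  by_cases hd : T u t
  -- When `t` and `u` play symmetric roles, unequal numbers of black vertices (two against one)
  -- prevent their exchange, and `dual` guarantees that the image meets the marker.
  · refine TwoDist.of_marker hconn hc (Set.range t ∪ Set.range u) {t 0, t 1, u 0} ⟨t 0, by simp⟩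
      ?_ hnb ?_
    · rintro z (rfl | rfl | rfl) <;> simp
    intro Q hQ hT φ hφ
    have k1 : ∀ i, t i ∈ Q ↔ i ≠ 2 := by
      intro i
      rw [hQ _ (by simp)]
      simp only [Set.mem_insert_iff, Set.mem_singleton_iff, h1.eq_iff, h3, or_false]
      revert i; decide
    have k2 : ∀ i, u i ∈ Q ↔ i = 0 := by
      intro i
      rw [hQ _ (by simp)]
      simp only [Set.mem_insert_iff, Set.mem_singleton_iff, h2.eq_iff, (h3 _ _).symm, false_or]
    have hφT := inv φ _ _ h
    obtain ⟨i, j, e | e⟩ := dual _ _ _ _ h hd hφT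
    · obtain ⟨π, p1, p2⟩ := share _ _ _ _ i j h hφT e
      have q1 : ∀ i, φ (t i) = t (π i) := fun i => congrFun p1 i
      have q2 : ∀ i, φ (u i) = u (π i) := fun i => congrFun p2 i
      have m2 := hφ (t 2)
      have m0 := hφ (u 0)
      rw [q1, k1, k1] at m2
      rw [q2, k2, k2] at m0
      have := perm_eq' π (by tauto) (by tauto)
      subst this
      rintro z (⟨i, rfl⟩ | ⟨i, rfl⟩)
      exacts [q1 i, q2 i]
    · obtain ⟨π, p1, p2⟩ := share _ _ _ _ i j hd hφT e
      have q1 : ∀ i, φ (t i) = u (π i) := fun i => congrFun p1 i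
      have m0 := hφ (t 0)
      have m1 := hφ (t 1)
      rw [q1, k2, k1] at m0 m1
      have := π.injective ((m0.2 (by decide)).trans (m1.2 (by decide)).symm)
      exact absurd this (by decide)
  -- The indices of the black vertices are `0, 0, 1, 2`. Any three of them contain two different
  -- indices, so an automorphism fixing three of the four images fixes the triple; this makes
  -- `Traced` applicable. The white indices `2` and `1` differ, which pins down the permutation.
  · refine TwoDist.of_marker hconn hc (Set.range t ∪ Set.range u) {t 0, u 0, t 1, u 2}
      ⟨t 0, by simp⟩ ?_ hnb ?_
    · rintro z (rfl | rfl | rfl | rfl) <;> simp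
    intro Q hQ hT φ hφ
    have k1 : ∀ i, t i ∈ Q ↔ i ≠ 2 := by
      intro i
      rw [hQ _ (by simp)]
      simp only [Set.mem_insert_iff, Set.mem_singleton_iff, h1.eq_iff, h3, or_false, false_or]
      revert i; decide
    have k2 : ∀ i, u i ∈ Q ↔ i ≠ 1 := by
      intro i
      rw [hQ _ (by simp)]
      simp only [Set.mem_insert_iff, Set.mem_singleton_iff, h2.eq_iff, (h3 _ _).symm, false_or]
      revert i; decide
    have hφT := inv φ _ _ h
    have r1 : ∀ i, φ (t i) ∈ Q ↔ i ≠ 2 := fun i => (hφ _).trans (k1 i)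
    have r2 : ∀ i, φ (u i) ∈ Q ↔ i ≠ 1 := fun i => (hφ _).trans (k2 i)
    generalize hs : (fun i => φ (t i)) = s at hφT
    generalize hw : (fun i => φ (u i)) = w at hφT
    replace hs : ∀ i, φ (t i) = s i := fun i => congrFun hs i
    replace hw : ∀ i, φ (u i) = w i := fun i => congrFun hw i
    simp only [hs] at r1
    simp only [hw] at r2
    obtain ⟨g1, g2, g3, g4⟩ := prop _ _ hφT
    have hsub : ({s 0, w 0, s 1, w 2} : Set V) ⊆ {t 0, u 0, t 1, u 2} := by
      by_contra hcon
      obtain ⟨x, hx, ψ, hψ, hxQ⟩ := hT {s 0, w 0, s 1, w 2} (by simp) (by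
        rintro z (rfl | rfl | rfl | rfl)
        exacts [(r1 _).2 (by decide), (r2 _).2 (by decide), (r1 _).2 (by decide),
          (r2 _).2 (by decide)]) hcon
      have hψT := inv ψ _ _ hφT
      have fin : ∀ i j, ψ (s j) = s i → ∃ π : Equiv.Perm (Fin 3),
          (∀ k, ψ (s k) = s (π k)) ∧ (∀ k, ψ (w k) = w (π k)) := by
        intro i j e
        obtain ⟨π, p1, p2⟩ := share _ _ _ _ i j hφT hψT e
        exact ⟨π, fun k => congrFun p1 k, fun k => congrFun p2 k⟩
      have bad : ∀ π : Equiv.Perm (Fin 3), π = 1 → (∀ k, ψ (s k) = s (π k)) →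
          (∀ k, ψ (w k) = w (π k)) → False := by
        rintro π rfl q1 q2
        refine hxQ ?_
        rcases hx with rfl | rfl | rfl | rfl
        · rw [q1]; exact (r1 _).2 (by decide)
        · rw [q2]; exact (r2 _).2 (by decide)
        · rw [q1]; exact (r1 _).2 (by decide)
        · rw [q2]; exact (r2 _).2 (by decide)
      have n1 : s 0 ≠ s 1 := g1.ne (by decide)
      have n2 : w 0 ≠ w 2 := g2.ne (by decide)
      have hx' := hx
      rcases hx' with e | e | e | e
      · have e1 := hψ (s 1) (by simp) (by rw [e]; exact n1.symm)
        have e2 := hψ (w 2) (by simp) (by rw [e]; exact (g3 _ _).symm)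
        obtain ⟨π, q1, q2⟩ := fin _ _ e1
        rw [q1] at e1
        rw [q2] at e2
        exact bad π (perm_eq'' π (g1 e1) (g2 e2)) q1 q2
      · have e1 := hψ (s 0) (by simp) (by rw [e]; exact g3 _ _)
        have e2 := hψ (s 1) (by simp) (by rw [e]; exact g3 _ _)
        obtain ⟨π, q1, q2⟩ := fin _ _ e1
        rw [q1] at e1 e2
        exact bad π (perm_eq π (g1 e1) (g1 e2)) q1 q2
      · have e1 := hψ (s 0) (by simp) (by rw [e]; exact n1)
        have e2 := hψ (w 2) (by simp) (by rw [e]; exact (g3 _ _).symm)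
        obtain ⟨π, q1, q2⟩ := fin _ _ e1
        rw [q1] at e1
        rw [q2] at e2
        exact bad π (perm_eq' π (g1 e1) (g2 e2)) q1 q2
      · have e1 := hψ (s 0) (by simp) (by rw [e]; exact g3 _ _)
        have e2 := hψ (s 1) (by simp) (by rw [e]; exact g3 _ _)
        obtain ⟨π, q1, q2⟩ := fin _ _ e1
        rw [q1] at e1 e2
        exact bad π (perm_eq π (g1 e1) (g1 e2)) q1 q2
    by_cases hsh : ∃ i j, s j = t i
    · obtain ⟨i, j, e⟩ := hsh
      obtain ⟨π, rfl, rfl⟩ := share _ _ _ _ i j h hφT e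
      have m0 := r1 2
      have m1 := r2 1
      simp only [Function.comp, k1, k2] at m0 m1
      have := perm_eq'' π (by tauto) (by tauto)
      subst this
      rintro z (⟨i, rfl⟩ | ⟨i, rfl⟩)
      exacts [hs i, hw i]
    -- If the image triple `s` avoids `t`, the black positions force `s` and `w` to be `u` and `t`
    -- up to the transposition of `1` and `2`, against `¬ T u t`.
    · exfalso
      push Not at hsh
      have a0 := hsub (show s 0 ∈ _ by simp)
      have a1 := hsub (show s 1 ∈ _ by simp)
      have b0 := hsub (show w 0 ∈ _ by simp)
      have b2 := hsub (show w 2 ∈ _ by simp)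
      have n1 : s 0 ≠ s 1 := g1.ne (by decide)
      have n2 : w 0 ≠ w 2 := g2.ne (by decide)
      have n3 : u 0 ≠ u 2 := h2.ne (by decide)
      have n4 : u 0 ≠ u 1 := h2.ne (by decide)
      have n5 : u 1 ≠ u 2 := h2.ne (by decide)
      have n6 := g3 0 0
      have n7 := g3 1 0
      have n8 := g3 0 2
      have n9 := g3 1 2
      have c0 := hsh 0 0
      have c1 := hsh 1 0
      have c2 := hsh 0 1
      have c3 := hsh 1 1
      simp only [Set.mem_insert_iff, Set.mem_singleton_iff] at a0 a1 b0 b2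
      have o := fun i j => outer _ _ _ _ i j h hφT
      have o00 := o 0 0
      have o10 := o 1 0
      have o02 := o 0 2
      have o12 := o 1 2
      have f0 : s 0 = u 0 ∧ w 0 = t 0 := by grind
      have f1 : s 1 = u 2 ∧ w 2 = t 1 := by grind
      have f2 : s 2 = u 1 := by grind
      have f3 : w 1 = t 2 := (outer _ _ _ _ 1 2 hφT h f1.1.symm).symm
      have := perm (Equiv.swap 1 2) _ _ hφT
      apply hd
      convert this using 1
      · funext i
        fin_cases i
        · exact f0.1.symm
        · exact f2.symm
        · exact f1.1.symm
      · funext i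
        fin_cases i
        · exact f0.2.symm
        · exact f1.2.symm
        · exact f3.symm


/-! ### Diamonds, `K_{3,3}` minus an edge, nonadjacent twins, triangles -/

theorem _root_.SimpleGraph.Connected.induct_adj (hconn : G.Connected) {p : V → Prop} {v : V}
    (hv : p v) (h : ∀ a b, p a → G.Adj a b → p b) (w : V) : p w := by
  obtain ⟨q⟩ := hconn.preconnected v w
  induction q with
  | nil => exact hv
  | cons h' _ ih => exact ih (h _ _ hv h')

/-- Two vertices with the same neighbors (apart from each other) are interchangeable. -/
theorem exists_swap_of_twins {p q : V} (h : ∀ x, x ≠ p → x ≠ q → (G.Adj p x ↔ G.Adj q x)) :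
    ∃ φ : G ≃g G, φ p = q ∧ φ q = p ∧ ∀ x, x ≠ p → x ≠ q → φ x = x := by
  classical
  refine ⟨⟨Equiv.swap p q, ?_⟩, Equiv.swap_apply_left p q, Equiv.swap_apply_right p q, fun x h1 h2 => ?_⟩
  · intro x y
    change G.Adj (Equiv.swap p q x) (Equiv.swap p q y) ↔ G.Adj x y
    simp only [Equiv.swap_apply_def]
    have := G.adj_comm p q
    have l1 := G.loopless.irrefl p
    have l2 := G.loopless.irrefl q
    split_ifs with h1 h2 h2 h3 h4 h5 h6 <;> grind [SimpleGraph.adj_comm]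
  · exact Equiv.swap_apply_of_ne_of_ne h1 h2

theorem Nb.comm {p a b c : V} (h : Nb G p a b c) : Nb G p b a c := h.rot.swap

theorem Nb.mems {p a b c a' b' c' : V} (h : Nb G p a b c) (h' : Nb G p a' b' c') :
    (a' = a ∨ a' = b ∨ a' = c) ∧ (b' = a ∨ b' = b ∨ b' = c) ∧ (c' = a ∨ c' = b ∨ c' = c) :=
  ⟨h.mem h'.adj₁, h.mem h'.adj₂, h.mem h'.adj₃⟩

theorem Nb.third {p a b c d : V} (h : Nb G p a b c) (h' : Nb G p a b d) : d = c := by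
  rcases h.mem h'.adj₃ with e | e | e
  exacts [absurd e.symm h'.2.1, absurd e.symm h'.2.2.1, e]

/-- If two of the neighbors are listed, the third ones agree and the lists agree up to order. -/
theorem Nb.pair {p a b c a' b' : V} (h : Nb G p a b c) (h' : Nb G p a' b' c) :
    (a' = a ∧ b' = b) ∨ (a' = b ∧ b' = a) := by
  obtain ⟨h1, h2, -⟩ := h.mems h'
  have := h'.1
  have := h'.2.1
  have := h'.2.2.1
  grind

/-- `u` and `u'` are the ends of a diamond with distinct outer neighbors `a` and `t`. -/
def DiamondEnds (G : SimpleGraph V) (u u' a t : V) : Prop :=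
  a ≠ t ∧ a ≠ u' ∧ t ≠ u ∧ ∃ b c, Nb G b c u u' ∧ Nb G c b u u' ∧ Nb G u b c a ∧ Nb G u' b c t

/-- The end `u` determines its diamond: the outer neighbor `a` is adjacent to neither of the other
two neighbors `b`, `c`, whereas in any diamond with end `u` the two middle vertices are adjacent. -/
theorem twoDist_of_diamondEnds (hconn : G.Connected) (hc : Cubic G) {u u' a t : V}
    (h : DiamondEnds G u u' a t) : TwoDist G := by
  refine twoDist_of_pairs hconn hc (DiamondEnds G) ?_ ?_ ?_ ?_ h
  · rintro φ u u' a t ⟨h1, h2, h3, b, c, k1, k2, k3, k4⟩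
    exact ⟨φ.injective.ne h1, φ.injective.ne h2, φ.injective.ne h3, φ b, φ c, k1.map φ, k2.map φ,
      k3.map φ, k4.map φ⟩
  · rintro u u' a t x y z ⟨h1, h2, h3, b, c, k1, k2, k3, k4⟩ ⟨h1', h2', h3', b', c', m1, m2, m3, m4⟩
    have hb : ¬ G.Adj b a := fun hh => by
      rcases k1.mem hh with e | e | e
      exacts [k3.2.2.1 e.symm, k3.adj₃.ne' e, h2 e]
    have hc' : ¬ G.Adj c a := fun hh => by
      rcases k2.mem hh with e | e | e
      exacts [k3.2.1 e.symm, k3.adj₃.ne' e, h2 e]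
    have key : b' ≠ a ∧ c' ≠ a := by
      have hbc' := m1.adj₁
      have hbc := hbc'.symm
      constructor <;> rintro rfl <;> obtain ⟨e1, e2, -⟩ := k3.mems m3
      · rcases e2 with e | e | e <;> subst e
        exacts [hb hbc, hc' hbc, m3.1 rfl]
      · rcases e1 with e | e | e <;> subst e
        exacts [hb hbc', hc' hbc', m3.1 rfl]
    obtain ⟨e1, e2, e3⟩ := k3.mems m3
    have := m3.1
    have := m3.2.1
    have := m3.2.2.1
    have e4 : y = a := by grind
    subst e4
    rcases k3.pair m3 with ⟨rfl, rfl⟩ | ⟨rfl, rfl⟩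
    · obtain rfl := k1.third m1
      exact ⟨rfl, rfl, k4.third m4⟩
    · obtain rfl := k2.third m1
      exact ⟨rfl, rfl, k4.comm.third m4⟩
  · rintro u u' a t ⟨h1, h2, h3, b, c, k1, k2, k3, k4⟩
    exact ⟨h1.symm, h3, h2, b, c, k1.swap, k2.swap, k4, k3⟩
  · rintro u u' a t ⟨h1, h2, h3, b, c, k1, k2, k3, k4⟩
    exact ⟨k1.2.2.1, k3.adj₃, k4.adj₃, h1, h2, h3⟩

/-- `u` and `u'` are the ends of a `K_{3,3}` minus an edge with distinct outer neighbors `a` and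
`t`. -/
def BipartiteEnds (G : SimpleGraph V) (u u' a t : V) : Prop :=
  a ≠ t ∧ a ≠ u' ∧ t ≠ u ∧ ∃ x w z y, Nb G x u z y ∧ Nb G w u z y ∧ Nb G z u' x w ∧
    Nb G y u' x w ∧ Nb G u x w a ∧ Nb G u' z y t

theorem twoDist_of_bipartiteEnds (hconn : G.Connected) (hc : Cubic G) {u u' a t : V}
    (h : BipartiteEnds G u u' a t) : TwoDist G := by
  refine twoDist_of_pairs hconn hc (BipartiteEnds G) ?_ ?_ ?_ ?_ h
  · rintro φ u u' a t ⟨h1, h2, h3, x, w, z, y, k1, k2, k3, k4, k5, k6⟩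
    exact ⟨φ.injective.ne h1, φ.injective.ne h2, φ.injective.ne h3, φ x, φ w, φ z, φ y, k1.map φ,
      k2.map φ, k3.map φ, k4.map φ, k5.map φ, k6.map φ⟩
  · rintro u u' a t v1 v2 v3 ⟨h1, h2, h3, x, w, z, y, k1, k2, k3, k4, k5, k6⟩
      ⟨h1', h2', h3', x', w', z', y', m1, m2, m3, m4, m5, m6⟩
    have hz : ¬ G.Adj z a := by
      intro hh
      rcases k3.mem hh with e | e | e
      exacts [h2 e, k5.2.1 e.symm, k5.2.2.1 e.symm]
    have hy : ¬ G.Adj y a := by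
      intro hh
      rcases k4.mem hh with e | e | e
      exacts [h2 e, k5.2.1 e.symm, k5.2.2.1 e.symm]
    have hxz : ∀ r, r = x ∨ r = w → G.Adj r z := by
      rintro r (rfl | rfl)
      exacts [k1.adj₂, k2.adj₂]
    have htw : ∀ s, G.Adj x' s ↔ G.Adj w' s := fun s => by rw [m1.2.2.2, m2.2.2.2]
    obtain ⟨f1, f2, f3⟩ := k5.mems m5
    have g1 := m5.1
    have g2 := m5.2.1
    have g3 := m5.2.2.1
    have n1 : x' ≠ a := by
      intro e
      have : w' = x ∨ w' = w := by grind
      exact hz ((e ▸ (htw z).2 (hxz _ this)).symm)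
    have n2 : w' ≠ a := by
      intro e
      have : x' = x ∨ x' = w := by grind
      exact hz ((e ▸ (htw z).1 (hxz _ this)).symm)
    have hv2 : v2 = a := by grind
    subst hv2
    have hx : ∀ s, G.Adj x' s ↔ G.Adj x s := by
      intro s
      rcases k5.pair m5 with ⟨e, -⟩ | ⟨e, -⟩
      · rw [e]
      · rw [e, k2.2.2.2, k1.2.2.2]
    have m1' : Nb G x u z' y' := ⟨m1.1, m1.2.1, m1.2.2.1, fun s => by rw [← hx, m1.2.2.2]⟩
    have e1 : v1 = u' := by
      have : ∀ {z' : V}, Nb G z' v1 x' w' → (z' = z ∨ z' = y) → v1 = u' := by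
        intro z' m3 hz'
        have m3' : Nb G z' u' x w := by
          rcases hz' with rfl | rfl
          exacts [k3, k4]
        rcases k5.pair m5 with ⟨rfl, rfl⟩ | ⟨rfl, rfl⟩
        · exact m3'.rot.third m3.rot
        · exact m3'.rot.third m3.swap.rot
      exact this m3 (by
        obtain ⟨-, e, -⟩ := k1.mems m1'
        have := m1'.1
        grind)
    subst e1
    refine ⟨rfl, rfl, ?_⟩
    rcases k1.rot.pair m1'.rot with ⟨rfl, rfl⟩ | ⟨rfl, rfl⟩
    · exact k6.third m6
    · exact k6.comm.third m6
  · rintro u u' a t ⟨h1, h2, h3, x, w, z, y, k1, k2, k3, k4, k5, k6⟩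
    exact ⟨h1.symm, h3, h2, z, y, x, w, k3, k4, k1, k2, k6, k5⟩
  · rintro u u' a t ⟨h1, h2, h3, x, w, z, y, k1, k2, k3, k4, k5, k6⟩
    refine ⟨?_, k5.adj₃, k6.adj₃, h1, h2, h3⟩
    rintro rfl
    have := k3.adj₁
    rcases k5.mem this.symm with e | e | e
    · exact k1.adj₂.ne' e
    · exact k2.adj₂.ne' e
    · have := k6.adj₁
      rcases k5.mem k6.adj₂ with e' | e' | e'
      · exact k1.adj₃.ne' e'
      · exact k2.adj₃.ne' e'
      · exact k1.2.2.1 (e.trans e'.symm)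

theorem exists_perm_of_range_subset {α : Type*} {s t : Fin 3 → α} (hs : Function.Injective s)
    (h : ∀ i, ∃ j, s i = t j) : ∃ π : Equiv.Perm (Fin 3), s = t ∘ π := by
  choose f hf using h
  have hinj : Function.Injective f := fun i j e => hs (by rw [hf, hf, e])
  exact ⟨Equiv.ofBijective f (Finite.injective_iff_bijective.1 hinj), funext hf⟩

/-- The neighbors `t i` of a pair of nonadjacent twins, with distinct outer neighbors `u i`. -/
def TwinTriple (G : SimpleGraph V) (t u : Fin 3 → V) : Prop :=
  (Function.Injective t ∧ Function.Injective u ∧ ∀ i j, t i ≠ u j) ∧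
    ∃ b c, b ≠ c ∧ (∀ x, G.Adj b x ↔ ∃ i, x = t i) ∧ (∀ x, G.Adj c x ↔ ∃ i, x = t i) ∧
      (∀ i, u i ≠ b ∧ u i ≠ c) ∧ ∀ i x, G.Adj (t i) x ↔ (x = b ∨ x = c ∨ x = u i)

/-- If `s j` were `b`, the twin hubs of `s` would be two members `t m`, `t n` of `t`. As twins they
share the outer neighbor `u m`, against the injectivity of `u`. -/
theorem TwinTriple.ne_hub {s w t u : Fin 3 → V} {b : V} (hs : TwinTriple G s w)
    (ht : TwinTriple G t u) (hb : ∀ x, G.Adj b x ↔ ∃ i, x = t i) (j : Fin 3) : s j ≠ b := by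
  rintro rfl
  obtain ⟨⟨i1, i2, i3⟩, b', c', hne, h1, h2, h3, h4⟩ := ht
  obtain ⟨⟨j1, j2, j3⟩, p, q, hne', k1, k2, k3, k4⟩ := hs
  obtain ⟨m, rfl⟩ := (hb p).1 ((k4 j p).2 (by simp))
  obtain ⟨n, rfl⟩ := (hb q).1 ((k4 j q).2 (by simp))
  have e : G.Adj (t m) (u m) := (h4 m _).2 (by simp)
  have e' : G.Adj (t n) (u m) := (k2 _).2 ((k1 _).1 e)
  rcases (h4 n _).1 e' with e | e | e
  exacts [(h3 m).1 e, (h3 m).2 e, hne' (congrArg t (i2 e))]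

theorem twoDist_of_twinTriple (hconn : G.Connected) (hc : Cubic G) {t u : Fin 3 → V}
    (h : TwinTriple G t u) : TwoDist G := by
  refine twoDist_of_triples hconn hc (TwinTriple G) ?_ ?_ ?_ ?_ ?_ ?_ h
  · rintro φ t u ⟨⟨i1, i2, i3⟩, b, c, hne, h1, h2, h3, h4⟩
    refine ⟨⟨φ.injective.comp i1, φ.injective.comp i2, fun i j => φ.injective.ne (i3 i j)⟩, φ b,
      φ c, φ.injective.ne hne, ?_, ?_, fun i => ⟨φ.injective.ne (h3 i).1, φ.injective.ne (h3 i).2⟩,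
      ?_⟩
    · intro x; obtain ⟨y, rfl⟩ := φ.surjective x
      simp [φ.map_adj_iff, h1, φ.injective.eq_iff]
    · intro x; obtain ⟨y, rfl⟩ := φ.surjective x
      simp [φ.map_adj_iff, h2, φ.injective.eq_iff]
    · intro i x; obtain ⟨y, rfl⟩ := φ.surjective x
      simp [φ.map_adj_iff, h4, φ.injective.eq_iff]
  · rintro π t u ⟨⟨i1, i2, i3⟩, b, c, hne, h1, h2, h3, h4⟩
    have : ∀ x, (∃ i, x = t i) ↔ ∃ i, x = t (π i) := fun x =>
      ⟨fun ⟨i, e⟩ => ⟨π.symm i, by simpa using e⟩, fun ⟨i, e⟩ => ⟨_, e⟩⟩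
    exact ⟨⟨i1.comp π.injective, i2.comp π.injective, fun i j => i3 _ _⟩, b, c, hne,
      fun x => (h1 x).trans (this x), fun x => (h2 x).trans (this x), fun i => h3 _,
      fun i x => h4 _ _⟩
  · rintro t u s w i j ⟨⟨i1, i2, i3⟩, b, c, hne, h1, h2, h3, h4⟩
      ⟨⟨j1, j2, j3⟩, p, q, hne', k1, k2, k3, k4⟩ e
    have no : ∀ p q : V, (∀ x, G.Adj p x ↔ G.Adj q x) → p = u i → (q = b ∨ q = c) → False := by
      rintro p q hpq rfl hq
      have hex : ∃ k, k ≠ i := exists_ne i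
      obtain ⟨k, hk⟩ := hex
      have : G.Adj (u i) (t k) := (hpq _).2 (by
        rcases hq with rfl | rfl
        exacts [(h1 _).2 ⟨k, rfl⟩, (h2 _).2 ⟨k, rfl⟩])
      rcases (h4 k _).1 this.symm with e | e | e
      exacts [(h3 i).1 e, (h3 i).2 e, hk (i2 e).symm]
    have hpq : ∀ x, G.Adj p x ↔ G.Adj q x := fun x => (k1 x).trans (k2 x).symm
    have hN : ∀ x, (x = b ∨ x = c ∨ x = u i) ↔ (x = p ∨ x = q ∨ x = w j) := fun x => by
      rw [← h4, ← e, k4]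
    have hp := (hN p).2 (by simp)
    have hq := (hN q).2 (by simp)
    have hpb : p = b ∨ p = c := by
      rcases hp with e | e | e
      · exact Or.inl e
      · exact Or.inr e
      · rcases hq with e' | e' | e'
        · exact (no p q hpq e (Or.inl e')).elim
        · exact (no p q hpq e (Or.inr e')).elim
        · exact absurd (e.trans e'.symm) hne'
    have hqb : q = b ∨ q = c := by
      rcases hq with e | e | e
      · exact Or.inl e
      · exact Or.inr e
      · exact (no q p (fun x => (hpq x).symm) e hpb).elim
    have hr : ∀ x, (∃ i, x = s i) ↔ ∃ i, x = t i := fun x => by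
      rw [← k1]
      rcases hpb with rfl | rfl
      exacts [h1 x, h2 x]
    obtain ⟨π, rfl⟩ := exists_perm_of_range_subset j1 fun i => (hr (s i)).1 ⟨i, rfl⟩
    refine ⟨π, rfl, funext fun m => ?_⟩
    have hm := (h4 (π m) (w m)).1 ((k4 m _).2 (by simp))
    have := k3 m
    simp only [Function.comp]
    grind
  · rintro t u ⟨⟨i1, i2, i3⟩, b, c, hne, h1, h2, h3, h4⟩
    exact ⟨i1, i2, i3, fun i => (h4 i _).2 (by simp)⟩
  · intro t u s w i j ht hs e
    have ht' := ht
    obtain ⟨⟨i1, i2, i3⟩, b, c, hne, h1, h2, h3, h4⟩ := ht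
    have hs' := hs
    obtain ⟨⟨j1, j2, j3⟩, p, q, hne', k1, k2, k3, k4⟩ := hs
    have : G.Adj (s j) (t i) := e ▸ (k4 j _).2 (by simp)
    rcases (h4 i _).1 this.symm with e | e | e
    exacts [absurd e (hs'.ne_hub ht' h1 j), absurd e (hs'.ne_hub ht' h2 j), e]
  · intro t u s w ht hd hs
    have ht' := ht
    have hd' := hd
    obtain ⟨⟨i1, i2, i3⟩, b, c, hne, h1, h2, h3, h4⟩ := ht
    obtain ⟨⟨-, -, -⟩, p, q, hne', k1, k2, k3, k4⟩ := hd
    have hall := hconn.induct_adj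
      (p := fun x => x = b ∨ x = c ∨ x = p ∨ x = q ∨ (∃ i, x = t i) ∨ (∃ i, x = u i)) (v := b)
      (by simp) (by
        rintro x y (rfl | rfl | rfl | rfl | ⟨i, rfl⟩ | ⟨i, rfl⟩) hxy
        · exact Or.inr (Or.inr (Or.inr (Or.inr (Or.inl ((h1 y).1 hxy)))))
        · exact Or.inr (Or.inr (Or.inr (Or.inr (Or.inl ((h2 y).1 hxy)))))
        · exact Or.inr (Or.inr (Or.inr (Or.inr (Or.inr ((k1 y).1 hxy)))))
        · exact Or.inr (Or.inr (Or.inr (Or.inr (Or.inr ((k2 y).1 hxy)))))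
        · rcases (h4 i y).1 hxy with e | e | e
          · simp [e]
          · simp [e]
          · exact Or.inr (Or.inr (Or.inr (Or.inr (Or.inr ⟨_, e⟩))))
        · rcases (k4 i y).1 hxy with e | e | e
          · simp [e]
          · simp [e]
          · exact Or.inr (Or.inr (Or.inr (Or.inr (Or.inl ⟨_, e⟩)))))
      (s 0)
    rcases hall with e | e | e | e | ⟨i, e⟩ | ⟨i, e⟩
    · exact absurd e (hs.ne_hub ht' h1 0)
    · exact absurd e (hs.ne_hub ht' h2 0)
    · exact absurd e (hs.ne_hub hd' k1 0)
    · exact absurd e (hs.ne_hub hd' k2 0)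
    · exact ⟨i, 0, Or.inl e⟩
    · exact ⟨i, 0, Or.inr e⟩

/-- A triangle `t` with distinct outer neighbors `u`. -/
def TriangleTriple (G : SimpleGraph V) (t u : Fin 3 → V) : Prop :=
  (Function.Injective t ∧ Function.Injective u ∧ ∀ i j, t i ≠ u j) ∧
    ∀ i x, G.Adj (t i) x ↔ ((∃ j, j ≠ i ∧ x = t j) ∨ x = u i)

theorem twoDist_of_triangleTriple (hconn : G.Connected) (hc : Cubic G) {t u : Fin 3 → V}
    (h : TriangleTriple G t u) : TwoDist G := by
  have share : ∀ t u s w i j, TriangleTriple G t u → TriangleTriple G s w → s j = t i →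
      ∃ π : Equiv.Perm (Fin 3), s = t ∘ π ∧ w = u ∘ π := by
    rintro t u s w i j ⟨⟨i1, i2, i3⟩, h4⟩ ⟨⟨j1, j2, j3⟩, k4⟩ e
    have third : ∀ i j : Fin 3, ∃ k, k ≠ i ∧ k ≠ j := by decide
    have hadj : ∀ m n, m ≠ n → G.Adj (s m) (s n) := fun m n hmn => (k4 m _).2
      (Or.inl ⟨n, hmn.symm, rfl⟩)
    have hin : ∀ m, ∃ n, s m = t n := by
      intro m
      by_cases hm : m = j
      · exact ⟨i, hm ▸ e⟩
      have a1 := hadj j m (Ne.symm hm)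
      rw [e] at a1
      rcases (h4 i _).1 a1 with ⟨n, -, e1⟩ | e1
      · exact ⟨n, e1⟩
      obtain ⟨l, hl1, hl2⟩ := third j m
      have a2 := hadj j l hl1.symm
      rw [e] at a2
      rcases (h4 i _).1 a2 with ⟨n, hn, e2⟩ | e2
      · have a3 := hadj l m hl2
        rw [e2] at a3
        rcases (h4 n _).1 a3 with ⟨n', -, e3⟩ | e3
        · exact ⟨n', e3⟩
        · exact absurd (i2 (e1.symm.trans e3)) hn.symm
      · exact absurd (j1 (e1.trans e2.symm)) hl2.symm
    obtain ⟨π, rfl⟩ := exists_perm_of_range_subset j1 hin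
    refine ⟨π, rfl, funext fun m => ?_⟩
    rcases (h4 (π m) (w m)).1 ((k4 m _).2 (by simp)) with ⟨n, hn, e1⟩ | e1
    · exact absurd e1.symm (by simpa using j3 (π.symm n) m)
    · exact e1
  have prop : ∀ t u, TriangleTriple G t u → Function.Injective t ∧ Function.Injective u ∧
      (∀ i j, t i ≠ u j) ∧ ∀ i, G.Adj (t i) (u i) := by
    rintro t u ⟨⟨i1, i2, i3⟩, h4⟩
    exact ⟨i1, i2, i3, fun i => (h4 i _).2 (by simp)⟩
  refine twoDist_of_triples hconn hc (TriangleTriple G) ?_ ?_ share prop ?_ ?_ h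
  · rintro φ t u ⟨⟨i1, i2, i3⟩, h4⟩
    refine ⟨⟨φ.injective.comp i1, φ.injective.comp i2, fun i j => φ.injective.ne (i3 i j)⟩, ?_⟩
    intro i x; obtain ⟨y, rfl⟩ := φ.surjective x
    simp [φ.map_adj_iff, h4, φ.injective.eq_iff]
  · rintro π t u ⟨⟨i1, i2, i3⟩, h4⟩
    refine ⟨⟨i1.comp π.injective, i2.comp π.injective, fun i j => i3 _ _⟩, fun i x => ?_⟩
    simp only [Function.comp, h4]
    refine or_congr ⟨fun ⟨j, h1, h2⟩ => ⟨π.symm j, ?_, by simpa using h2⟩, fun ⟨j, h1, h2⟩ =>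
      ⟨π j, π.injective.ne h1, h2⟩⟩ Iff.rfl
    rintro rfl
    simp at h1
  · intro t u s w i j ht hs e
    have : G.Adj (s j) (t i) := e ▸ (hs.2 j _).2 (by simp)
    rcases (ht.2 i _).1 this.symm with ⟨k, -, e1⟩ | e1
    · obtain ⟨π, rfl, rfl⟩ := share _ _ _ _ _ _ ht hs e1
      exact absurd e.symm (ht.1.2.2 _ _)
    · exact e1
  · intro t u s w ht hd hs
    have hall := hconn.induct_adj (p := fun x => (∃ i, x = t i) ∨ (∃ i, x = u i)) (v := t 0)
      (by simp) (by
        rintro x y (⟨i, rfl⟩ | ⟨i, rfl⟩) hxy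
        · rcases (ht.2 i y).1 hxy with ⟨j, -, e⟩ | e
          exacts [Or.inl ⟨_, e⟩, Or.inr ⟨_, e⟩]
        · rcases (hd.2 i y).1 hxy with ⟨j, -, e⟩ | e
          exacts [Or.inr ⟨_, e⟩, Or.inl ⟨_, e⟩]) (s 0)
    rcases hall with ⟨i, e⟩ | ⟨i, e⟩
    · exact ⟨i, 0, Or.inl e⟩
    · exact ⟨i, 0, Or.inr e⟩


/-! ### Pieces, their roots and interiors -/

/-- The vertex `l`, with outer neighbor `o`, is the root of a diamond-like piece: the four
vertices `e₁, e₂, b, c` are joined to the rest of the graph through `l` only. -/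
structure Leaf2 (G : SimpleGraph V) (l o e₁ e₂ b c : V) : Prop where
  nl : Nb G l o e₁ e₂
  n₁ : Nb G e₁ l b c
  n₂ : Nb G e₂ l b c
  nb : Nb G b c e₁ e₂
  nc : Nb G c b e₁ e₂

/-- The analogue of `Leaf2` for `K_{3,3}` minus an edge. -/
structure Leaf3 (G : SimpleGraph V) (l o e₁ e₂ x w z y : V) : Prop where
  nl : Nb G l o e₁ e₂
  n₁ : Nb G e₁ l x w
  n₂ : Nb G e₂ l z y
  nx : Nb G x e₁ z y
  nw : Nb G w e₁ z y
  nz : Nb G z e₂ x w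
  ny : Nb G y e₂ x w

theorem Leaf2.map {l o e₁ e₂ b c : V} (h : Leaf2 G l o e₁ e₂ b c) (φ : G ≃g G) :
    Leaf2 G (φ l) (φ o) (φ e₁) (φ e₂) (φ b) (φ c) :=
  ⟨h.nl.map φ, h.n₁.map φ, h.n₂.map φ, h.nb.map φ, h.nc.map φ⟩

theorem Leaf2.symm_e {l o e₁ e₂ b c : V} (h : Leaf2 G l o e₁ e₂ b c) : Leaf2 G l o e₂ e₁ b c :=
  ⟨h.nl.swap, h.n₂, h.n₁, h.nb.swap, h.nc.swap⟩

theorem Leaf2.symm_b {l o e₁ e₂ b c : V} (h : Leaf2 G l o e₁ e₂ b c) : Leaf2 G l o e₁ e₂ c b :=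
  ⟨h.nl, h.n₁.swap, h.n₂.swap, h.nc, h.nb⟩

theorem Leaf3.map {l o e₁ e₂ x w z y : V} (h : Leaf3 G l o e₁ e₂ x w z y) (φ : G ≃g G) :
    Leaf3 G (φ l) (φ o) (φ e₁) (φ e₂) (φ x) (φ w) (φ z) (φ y) :=
  ⟨h.nl.map φ, h.n₁.map φ, h.n₂.map φ, h.nx.map φ, h.nw.map φ, h.nz.map φ, h.ny.map φ⟩

theorem Leaf3.symm_e {l o e₁ e₂ x w z y : V} (h : Leaf3 G l o e₁ e₂ x w z y) :
    Leaf3 G l o e₂ e₁ z y x w :=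
  ⟨h.nl.swap, h.n₂, h.n₁, h.nz, h.ny, h.nx, h.nw⟩

theorem Leaf3.symm_x {l o e₁ e₂ x w z y : V} (h : Leaf3 G l o e₁ e₂ x w z y) :
    Leaf3 G l o e₁ e₂ w x z y :=
  ⟨h.nl, h.n₁.swap, h.n₂, h.nw, h.nx, h.nz.swap, h.ny.swap⟩

/-- `l` is the root of a piece of one of the two kinds, and is joined to the rest through `o`. -/
def Leaf (G : SimpleGraph V) : Bool → V → V → Prop
  | false, l, o => ∃ e₁ e₂ b c, Leaf2 G l o e₁ e₂ b c
  | true, l, o => ∃ e₁ e₂ x w z y, Leaf3 G l o e₁ e₂ x w z y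

theorem Leaf.map {k : Bool} {l o : V} (h : Leaf G k l o) (φ : G ≃g G) : Leaf G k (φ l) (φ o) := by
  cases k
  · obtain ⟨e₁, e₂, b, c, h⟩ := h
    exact ⟨_, _, _, _, h.map φ⟩
  · obtain ⟨e₁, e₂, x, w, z, y, h⟩ := h
    exact ⟨_, _, _, _, _, _, h.map φ⟩

/-- The vertices in the interior of the pieces. -/
def Interior (G : SimpleGraph V) (v : V) : Prop :=
  (∃ l o e₁ e₂ b c, Leaf2 G l o e₁ e₂ b c ∧ (v = e₁ ∨ v = b)) ∨
    ∃ l o e₁ e₂ x w z y, Leaf3 G l o e₁ e₂ x w z y ∧ (v = e₁ ∨ v = x)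

section
variable {l o e₁ e₂ b c x w z y : V}

theorem Leaf2.int_e₁ (h : Leaf2 G l o e₁ e₂ b c) : Interior G e₁ :=
  Or.inl ⟨_, _, _, _, _, _, h, Or.inl rfl⟩
theorem Leaf2.int_e₂ (h : Leaf2 G l o e₁ e₂ b c) : Interior G e₂ := h.symm_e.int_e₁
theorem Leaf2.int_b (h : Leaf2 G l o e₁ e₂ b c) : Interior G b :=
  Or.inl ⟨_, _, _, _, _, _, h, Or.inr rfl⟩
theorem Leaf2.int_c (h : Leaf2 G l o e₁ e₂ b c) : Interior G c := h.symm_b.int_b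
theorem Leaf3.int_e₁ (h : Leaf3 G l o e₁ e₂ x w z y) : Interior G e₁ :=
  Or.inr ⟨_, _, _, _, _, _, _, _, h, Or.inl rfl⟩
theorem Leaf3.int_e₂ (h : Leaf3 G l o e₁ e₂ x w z y) : Interior G e₂ := h.symm_e.int_e₁
theorem Leaf3.int_x (h : Leaf3 G l o e₁ e₂ x w z y) : Interior G x :=
  Or.inr ⟨_, _, _, _, _, _, _, _, h, Or.inr rfl⟩
theorem Leaf3.int_w (h : Leaf3 G l o e₁ e₂ x w z y) : Interior G w := h.symm_x.int_x
theorem Leaf3.int_z (h : Leaf3 G l o e₁ e₂ x w z y) : Interior G z := h.symm_e.int_x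
theorem Leaf3.int_y (h : Leaf3 G l o e₁ e₂ x w z y) : Interior G y := h.symm_e.int_w

end

theorem Leaf.exists_nb {k : Bool} {l o : V} (h : Leaf G k l o) :
    ∃ e₁ e₂, Nb G l o e₁ e₂ ∧ Interior G e₁ ∧ Interior G e₂ := by
  cases k
  · obtain ⟨e₁, e₂, b, c, h⟩ := h
    exact ⟨_, _, h.nl, h.int_e₁, h.int_e₂⟩
  · obtain ⟨e₁, e₂, x, w, z, y, h⟩ := h
    exact ⟨_, _, h.nl, h.int_e₁, h.int_e₂⟩

theorem Leaf.int_nbr {k : Bool} {l o : V} (h : Leaf G k l o) {x : V} (hx : G.Adj l x)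
    (hne : x ≠ o) : Interior G x := by
  obtain ⟨e₁, e₂, hn, h1, h2⟩ := h.exists_nb
  rcases hn.mem hx with rfl | rfl | rfl
  exacts [absurd rfl hne, h1, h2]

theorem Interior.int_two {v : V} (h : Interior G v) :
    ∃ x y, x ≠ y ∧ G.Adj v x ∧ G.Adj v y ∧ Interior G x ∧ Interior G y := by
  obtain ⟨l, o, e₁, e₂, b, c, h, rfl | rfl⟩ | ⟨l, o, e₁, e₂, x, w, z, y, h, rfl | rfl⟩ := h
  · exact ⟨b, c, h.n₁.2.2.1, h.n₁.adj₂, h.n₁.adj₃, h.int_b, h.int_c⟩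
  · exact ⟨e₁, e₂, h.nb.2.2.1, h.nb.adj₂, h.nb.adj₃, h.int_e₁, h.int_e₂⟩
  · exact ⟨x, w, h.n₁.2.2.1, h.n₁.adj₂, h.n₁.adj₃, h.int_x, h.int_w⟩
  · exact ⟨z, y, h.nx.2.2.1, h.nx.adj₂, h.nx.adj₃, h.int_z, h.int_y⟩

theorem Interior.nbr {v u : V} (h : Interior G v) (hu : G.Adj v u) :
    Interior G u ∨ ∃ k o, Leaf G k u o ∧ v ≠ o := by
  obtain ⟨l, o, e₁, e₂, b, c, h, rfl | rfl⟩ | ⟨l, o, e₁, e₂, x, w, z, y, h, rfl | rfl⟩ := h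
  · rcases h.n₁.mem hu with rfl | rfl | rfl
    exacts [Or.inr ⟨false, o, ⟨_, _, _, _, h⟩, h.nl.1.symm⟩, Or.inl h.int_b, Or.inl h.int_c]
  · rcases h.nb.mem hu with rfl | rfl | rfl
    exacts [Or.inl h.int_c, Or.inl h.int_e₁, Or.inl h.int_e₂]
  · rcases h.n₁.mem hu with rfl | rfl | rfl
    exacts [Or.inr ⟨true, o, ⟨_, _, _, _, _, _, h⟩, h.nl.1.symm⟩, Or.inl h.int_x, Or.inl h.int_w]
  · rcases h.nx.mem hu with rfl | rfl | rfl
    exacts [Or.inl h.int_e₁, Or.inl h.int_z, Or.inl h.int_y]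

/-- Full twins can be swapped. -/
theorem exists_swap_of_nb {p q a b c : V} (h : Nb G p a b c) (h' : Nb G q a b c) :
    ∃ φ : G ≃g G, φ p = q ∧ φ q = p ∧ ∀ x, x ≠ p → x ≠ q → φ x = x :=
  exists_swap_of_twins fun x _ _ => by rw [h.2.2.2, h'.2.2.2]

theorem exists_swap_of_nb_adj {p q a b : V} (h : Nb G p q a b) (h' : Nb G q p a b) :
    ∃ φ : G ≃g G, φ p = q ∧ φ q = p ∧ ∀ x, x ≠ p → x ≠ q → φ x = x :=
  exists_swap_of_twins fun x h1 h2 => by rw [h.2.2.2, h'.2.2.2]; simp [h1, h2]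

/-- The exchanged neighbors are twins inside the piece, adjacent or not. Such a reflection is
incompatible with type 3. -/
theorem Interior.swap {v : V} (h : Interior G v) :
    ∃ a b c, Nb G v a b c ∧ ∃ φ : G ≃g G, φ v = v ∧ φ a = a ∧ φ b = c ∧ φ c = b := by
  obtain ⟨l, o, e₁, e₂, b, c, h, rfl | rfl⟩ | ⟨l, o, e₁, e₂, x, w, z, y, h, rfl | rfl⟩ := h
  · obtain ⟨φ, h1, h2, h3⟩ := exists_swap_of_nb_adj h.nb h.nc
    exact ⟨_, _, _, h.n₁, φ, h3 _ h.n₁.adj₂.ne h.n₁.adj₃.ne, h3 _ h.n₁.1 h.n₁.2.1, h1, h2⟩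
  · obtain ⟨φ, h1, h2, h3⟩ := exists_swap_of_nb h.n₁ h.n₂
    exact ⟨_, _, _, h.nb, φ, h3 _ h.nb.adj₂.ne h.nb.adj₃.ne, h3 _ h.nb.1 h.nb.2.1, h1, h2⟩
  · obtain ⟨φ, h1, h2, h3⟩ := exists_swap_of_nb h.nx h.nw
    exact ⟨_, _, _, h.n₁, φ, h3 _ h.n₁.adj₂.ne h.n₁.adj₃.ne, h3 _ h.n₁.1 h.n₁.2.1, h1, h2⟩
  · obtain ⟨φ, h1, h2, h3⟩ := exists_swap_of_nb h.nz h.ny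
    exact ⟨_, _, _, h.nx, φ, h3 _ h.nx.adj₂.ne h.nx.adj₃.ne, h3 _ h.nx.1 h.nx.2.1, h1, h2⟩

/-! ### Twins and triangles of a stubborn graph lie in pieces -/

/-- The standing assumptions: a connected cubic graph without a distinguishing 2-coloring that
contains neither `K₄` nor `K_{3,3}`. -/
structure Stubborn (G : SimpleGraph V) : Prop where
  conn : G.Connected
  cubic : Cubic G
  not_dist : ¬ TwoDist G
  no_K4 : ∀ p q r s, Nb G p q r s → Nb G q p r s → ¬ Nb G r p q s
  no_K33 : ∀ p q r a b c, Nb G p a b c → Nb G q a b c → Nb G r a b c → p = q ∨ p = r ∨ q = r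

/-- A connected cubic graph containing `K₄` or `K_{3,3}` is that graph. There `a` and `c` are twins,
and exchanging them fixes `v` and `b`, against `hr`. -/
theorem Stubborn.of_rigid (hconn : G.Connected) (hc : Cubic G) (hd : ¬ TwoDist G) {v a b c : V}
    (hn : Nb G v a b c) (hr : ∀ φ : G ≃g G, φ v = v → φ b = b → φ a = a) : Stubborn G := by
  have key : ¬ ∀ x, x ≠ a → x ≠ c → (G.Adj a x ↔ G.Adj c x) := fun h => by
    obtain ⟨φ, h1, -, h3⟩ := exists_swap_of_twins h
    have := hr φ (h3 _ hn.adj₁.ne hn.adj₃.ne) (h3 _ hn.1.symm hn.2.2.1)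
    exact hn.2.1 (this.symm.trans h1)
  refine ⟨hconn, hc, hd, fun p q r s h1 h2 h3 => key ?_, fun p q r x y z h1 h2 h3 => ?_⟩
  · have h4 : Nb G s p q r := by
      obtain ⟨d, h⟩ := hc.nb₂ h1.adj₃.symm h2.adj₃.symm h1.adj₁.ne
      have := h.mem h3.adj₃.symm
      have e : r = d := by
        rcases this with e | e | e
        exacts [absurd e h1.adj₂.ne', absurd e h2.adj₂.ne', e]
      rwa [← e] at h
    have hall := hconn.induct_adj (p := fun x => x = p ∨ x = q ∨ x = r ∨ x = s) (v := p) (by simp)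
      (by
        rintro d e (rfl | rfl | rfl | rfl) he
        · rcases h1.mem he with h | h | h <;> simp [h]
        · rcases h2.mem he with h | h | h <;> simp [h]
        · rcases h3.mem he with h | h | h <;> simp [h]
        · rcases h4.mem he with h | h | h <;> simp [h])
    have hadj : ∀ x y, x ≠ y → G.Adj x y := by
      intro x y hxy
      have := hall y
      rcases hall x with rfl | rfl | rfl | rfl
      · rw [h1.2.2.2]; grind
      · rw [h2.2.2.2]; grind
      · rw [h3.2.2.2]; grind
      · rw [h4.2.2.2]; grind
    exact fun x hx hx' => iff_of_true (hadj _ _ hx.symm) (hadj _ _ hx'.symm)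
  · by_contra! hne
    obtain ⟨n1, n2, n3⟩ := hne
    have hx : ∀ t, G.Adj p t → Nb G t p q r := by
      intro t ht
      have hq : G.Adj q t := by rwa [h2.2.2.2, ← h1.2.2.2]
      have hr' : G.Adj r t := by rwa [h3.2.2.2, ← h1.2.2.2]
      obtain ⟨d, h⟩ := hc.nb₂ ht.symm hq.symm n1
      rcases h.mem hr'.symm with e | e | e
      exacts [absurd e.symm n2, absurd e.symm n3, e ▸ h]
    have hN : ∀ t, (t = p ∨ t = q ∨ t = r) → ∀ m, G.Adj t m ↔ G.Adj p m := by
      rintro t (rfl | rfl | rfl) m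
      exacts [Iff.rfl, by rw [h2.2.2.2, h1.2.2.2], by rw [h3.2.2.2, h1.2.2.2]]
    have hall := hconn.induct_adj (p := fun v => (∀ m, G.Adj v m ↔ G.Adj p m) ∨ G.Adj p v) (v := p)
      (Or.inl fun _ => Iff.rfl) (by
        rintro d e (h | h) hde
        · exact Or.inr ((h e).1 hde)
        · exact Or.inl (hN e ((hx d h).mem hde)))
    refine key fun m _ _ => ?_
    rcases hall v with h | h
    · rw [(hx a ((h a).1 hn.adj₁)).2.2.2, (hx c ((h c).1 hn.adj₃)).2.2.2]
    · rw [hN a ((hx v h).mem hn.adj₁), hN c ((hx v h).mem hn.adj₃)]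


/-- The outer neighbors `a`, `t` of the two diamond ends coincide, since otherwise the diamond is a
marker. Their common value is the root of a piece. -/
theorem Stubborn.adj_twins (hG : Stubborn G) {p q v r : V} (hp : Nb G p q v r)
    (hq : Nb G q p v r) : ∃ l o, Leaf2 G l o v r p q := by
  obtain ⟨a, hv⟩ := hG.cubic.nb₂ hp.adj₂.symm hq.adj₂.symm hp.adj₁.ne
  obtain ⟨t, hr⟩ := hG.cubic.nb₂ hp.adj₃.symm hq.adj₃.symm hp.adj₁.ne
  have har : a ≠ r := by
    rintro rfl
    exact hG.no_K4 _ _ _ _ hp hq hv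
  have htv : t ≠ v := by
    rintro rfl
    exact hG.no_K4 _ _ _ _ hp.swap hq.swap hr
  by_cases hat : a = t
  · subst hat
    obtain ⟨o, ho⟩ := hG.cubic.nb₂ hv.adj₃.symm hr.adj₃.symm hp.2.2.1
    exact ⟨a, o, ho.rot.rot, hv.rot.rot, hr.rot.rot, hp, hq⟩
  · exact absurd (twoDist_of_diamondEnds hG.conn hG.cubic (u := v) (u' := r) (a := a) (t := t)
      ⟨hat, har, htv, p, q, hp, hq, hv, hr⟩) hG.not_dist

theorem Stubborn.int_of_twins_adj (hG : Stubborn G) {p q a b c : V} (hp : Nb G p a b c)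
    (hq : Nb G q a b c) (hpq : p ≠ q) (hab : G.Adj a b) : Interior G p := by
  obtain ⟨u, hu⟩ := hG.cubic.nb₂ hp.adj₁.symm hq.adj₁.symm hpq
  obtain ⟨v, hv⟩ := hG.cubic.nb₂ hp.adj₂.symm hq.adj₂.symm hpq
  have e1 : b = u := by
    rcases hu.mem hab with e | e | e
    exacts [absurd e hp.adj₂.ne', absurd e hq.adj₂.ne', e]
  have e2 : a = v := by
    rcases hv.mem hab.symm with e | e | e
    exacts [absurd e hp.adj₁.ne', absurd e hq.adj₁.ne', e]
  subst e1 e2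
  obtain ⟨l, o, h⟩ := hG.adj_twins hu.rot.rot hv.rot.rot
  exact h.int_e₁

theorem Stubborn.int_of_twins_pair (hG : Stubborn G) {p q a b c u h : V} (hp : Nb G p a b c)
    (hq : Nb G q a b c) (ha : Nb G a p q u) (hb : Nb G b p q h)
    (hc : Nb G c p q h) (hu : u ≠ h) (hah : h ≠ a) : Interior G p := by
  obtain ⟨h', hh⟩ := hG.cubic.nb₂ hb.adj₃.symm hc.adj₃.symm hp.2.2.1
  have h1 : h' ≠ a := by
    rintro rfl
    rcases ha.mem hh.adj₃.symm with e | e | e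
    exacts [hb.2.1 e.symm, hb.2.2.1 e.symm, hu e.symm]
  by_cases e : u = h'
  · subst e
    obtain ⟨o, ho⟩ := hG.cubic.nb₂ ha.adj₃.symm hh.adj₃.symm hah.symm
    have hL : Leaf3 G u o a h p q b c :=
      ⟨ho.rot.rot, ha.rot.rot, hh.rot.rot, hp, hq, hb.rot.rot, hc.rot.rot⟩
    exact hL.int_x
  · exact absurd (twoDist_of_bipartiteEnds hG.conn hG.cubic (u := a) (u' := h) (a := u) (t := h')
      ⟨e, hu, h1, p, q, b, c, hp, hq, hb.rot.rot, hc.rot.rot, ha, hh⟩) hG.not_dist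

/-- An edge among `a`, `b`, `c` leads to a diamond. Otherwise compare their outer neighbors: all
equal gives `K_{3,3}`, exactly two equal gives `K_{3,3}` minus an edge, and three distinct ones give
a `TwinTriple`. Everything but a piece is excluded. -/
theorem Stubborn.int_of_twins (hG : Stubborn G) {p q a b c : V} (hp : Nb G p a b c)
    (hq : Nb G q a b c) (hpq : p ≠ q) : Interior G p := by
  by_cases hab : G.Adj a b
  · exact hG.int_of_twins_adj hp hq hpq hab
  by_cases hbc : G.Adj b c
  · exact hG.int_of_twins_adj hp.rot hq.rot hpq hbc
  by_cases hca : G.Adj c a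
  · exact hG.int_of_twins_adj hp.rot.rot hq.rot.rot hpq hca
  obtain ⟨u, hu⟩ := hG.cubic.nb₂ hp.adj₁.symm hq.adj₁.symm hpq
  obtain ⟨v, hv⟩ := hG.cubic.nb₂ hp.adj₂.symm hq.adj₂.symm hpq
  obtain ⟨w, hw⟩ := hG.cubic.nb₂ hp.adj₃.symm hq.adj₃.symm hpq
  have au : u ≠ a ∧ u ≠ b ∧ u ≠ c := ⟨hu.adj₃.ne', fun e => hab (e ▸ hu.adj₃),
    fun e => hca (e ▸ hu.adj₃.symm)⟩
  have av : v ≠ a ∧ v ≠ b ∧ v ≠ c := ⟨fun e => hab (e ▸ hv.adj₃.symm), hv.adj₃.ne',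
    fun e => hbc (e ▸ hv.adj₃)⟩
  have aw : w ≠ a ∧ w ≠ b ∧ w ≠ c := ⟨fun e => hca (e ▸ hw.adj₃), fun e => hbc (e ▸ hw.adj₃.symm),
    hw.adj₃.ne'⟩
  by_cases e1 : u = v
  · subst e1
    by_cases e2 : u = w
    · subst e2
      obtain ⟨d, hd⟩ := hG.cubic.nb₂ hu.adj₃.symm hv.adj₃.symm hp.1
      have : c = d := by
        rcases hd.mem hw.adj₃.symm with e | e | e
        exacts [absurd e.symm hp.2.1, absurd e.symm hp.2.2.1, e]
      subst this
      rcases hG.no_K33 p q u a b c hp hq hd with e | e | e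
      exacts [absurd e hpq, absurd e hu.2.1, absurd e hu.2.2.1]
    · exact hG.int_of_twins_pair hp.rot.rot hq.rot.rot hw hu hv (Ne.symm e2) au.2.2
  · by_cases e2 : v = w
    · subst e2
      exact hG.int_of_twins_pair hp hq hu hv hw e1 av.1
    · by_cases e3 : u = w
      · subst e3
        exact hG.int_of_twins_pair hp.rot hq.rot hv hw hu (Ne.symm e1) au.2.1
      · refine absurd (twoDist_of_twinTriple hG.conn hG.cubic (t := ![a, b, c]) (u := ![u, v, w])
          ⟨⟨?_, ?_, ?_⟩, p, q, hpq, ?_, ?_, ?_, ?_⟩) hG.not_dist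
        · have := hp.1
          have := hp.2.1
          have := hp.2.2.1
          intro i j
          fin_cases i <;> fin_cases j <;> simp_all [eq_comm]
        · intro i j
          fin_cases i <;> fin_cases j <;> simp_all [eq_comm]
        · intro i j
          fin_cases i <;> fin_cases j <;> simp [Ne.symm, *]
        · intro x; simp [hp.2.2.2, Fin.exists_fin_succ]
        · intro x; simp [hq.2.2.2, Fin.exists_fin_succ]
        · intro i
          fin_cases i
          exacts [⟨hu.2.1.symm, hu.2.2.1.symm⟩, ⟨hv.2.1.symm, hv.2.2.1.symm⟩,
            ⟨hw.2.1.symm, hw.2.2.1.symm⟩]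
        · intro i x
          fin_cases i
          exacts [hu.2.2.2 x, hv.2.2.2 x, hw.2.2.2 x]

theorem Stubborn.int_of_triangle (hG : Stubborn G) {p q r : V} (h1 : G.Adj p q) (h2 : G.Adj p r)
    (h3 : G.Adj q r) : Interior G p := by
  obtain ⟨a, ha⟩ := hG.cubic.nb₂ h1 h2 h3.ne
  obtain ⟨b, hb⟩ := hG.cubic.nb₂ h1.symm h3 h2.ne
  obtain ⟨c, hc⟩ := hG.cubic.nb₂ h2.symm h3.symm h1.ne
  by_cases e1 : a = b
  · subst e1
    obtain ⟨l, o, h⟩ := hG.adj_twins ha hb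
    exact h.int_b
  by_cases e2 : a = c
  · subst e2
    obtain ⟨l, o, h⟩ := hG.adj_twins ha.comm hc
    exact h.int_b
  by_cases e3 : b = c
  · subst e3
    obtain ⟨l, o, h⟩ := hG.adj_twins hb.comm hc.comm
    exact h.int_e₁
  refine absurd (twoDist_of_triangleTriple hG.conn hG.cubic (t := ![p, q, r]) (u := ![a, b, c])
    ⟨⟨?_, ?_, ?_⟩, ?_⟩) hG.not_dist
  · have := h1.ne
    have := h2.ne
    have := h3.ne
    intro i j
    fin_cases i <;> fin_cases j <;> simp_all [eq_comm]
  · intro i j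
    fin_cases i <;> fin_cases j <;> simp_all [eq_comm]
  · intro i j
    have := ha.2.1
    have := ha.2.2.1
    have := ha.adj₃.ne
    have := hb.2.1
    have := hb.2.2.1
    have := hb.adj₃.ne
    have := hc.2.1
    have := hc.2.2.1
    have := hc.adj₃.ne
    fin_cases i <;> fin_cases j <;> simpa
  · intro i x
    fin_cases i
    · simp [ha.2.2.2, Fin.exists_fin_succ, or_assoc]
    · simp [hb.2.2.2, Fin.exists_fin_succ, or_assoc]
    · simp [hc.2.2.2, Fin.exists_fin_succ, or_assoc]

/-! ### Uniqueness of roots, outer neighbors and kinds of pieces -/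

/-- `p` lies on a triangle. -/
def OnTriangle (G : SimpleGraph V) (p : V) : Prop := ∃ q r, G.Adj p q ∧ G.Adj p r ∧ G.Adj q r

theorem Nb.not_onTriangle {p a b c : V} (h : Nb G p a b c) (h1 : ¬ G.Adj a b) (h2 : ¬ G.Adj a c)
    (h3 : ¬ G.Adj b c) : ¬ OnTriangle G p := by
  rintro ⟨q, r, hq, hr, hqr⟩
  rcases h.mem hq with rfl | rfl | rfl <;> rcases h.mem hr with rfl | rfl | rfl
  exacts [hqr.ne rfl, h1 hqr, h2 hqr, h1 hqr.symm, hqr.ne rfl, h3 hqr, h2 hqr.symm, h3 hqr.symm,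
    hqr.ne rfl]

section
variable {l o e₁ e₂ b c x w z y : V}

theorem Leaf2.onTriangle_e₁ (h : Leaf2 G l o e₁ e₂ b c) : OnTriangle G e₁ :=
  ⟨b, c, h.n₁.adj₂, h.n₁.adj₃, h.nb.adj₁⟩

theorem Leaf2.onTriangle_b (h : Leaf2 G l o e₁ e₂ b c) : OnTriangle G b :=
  ⟨c, e₁, h.nb.adj₁, h.nb.adj₂, h.nc.adj₂⟩

theorem Leaf2.not_adj_l (h : Leaf2 G l o e₁ e₂ b c) : ¬ G.Adj b l := fun hh => by
  rcases h.nb.mem hh with e | e | e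
  exacts [h.n₁.2.1 e, h.n₁.adj₁.ne' e, h.n₂.adj₁.ne' e]

theorem Leaf2.not_adj_e (h : Leaf2 G l o e₁ e₂ b c) : ¬ G.Adj e₁ e₂ := fun hh => by
  rcases h.n₁.mem hh with e | e | e
  exacts [h.nl.adj₃.ne' e, h.nb.adj₃.ne' e, h.nc.adj₃.ne' e]

theorem Leaf2.not_adj_o (h : Leaf2 G l o e₁ e₂ b c) : ¬ G.Adj o e₁ := fun hh => by
  rcases h.n₁.mem hh.symm with rfl | rfl | rfl
  exacts [h.nl.adj₁.ne rfl, h.not_adj_l h.nl.adj₁.symm, h.symm_b.not_adj_l h.nl.adj₁.symm]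

theorem Leaf2.not_onTriangle (h : Leaf2 G l o e₁ e₂ b c) : ¬ OnTriangle G l :=
  h.nl.not_onTriangle h.not_adj_o h.symm_e.not_adj_o h.not_adj_e

theorem Leaf2.not_adj_ob (h : Leaf2 G l o e₁ e₂ b c) : ¬ G.Adj o b := fun hh => by
  rcases h.nb.mem hh.symm with rfl | rfl | rfl
  exacts [h.symm_b.not_adj_l h.nl.adj₁.symm, h.nl.1 rfl, h.nl.2.1 rfl]

theorem Leaf3.not_adj_l (h : Leaf3 G l o e₁ e₂ x w z y) : ¬ G.Adj x l := fun hh => by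
  rcases h.nx.mem hh with e | e | e
  exacts [h.n₁.adj₁.ne' e, h.n₂.1 e, h.n₂.2.1 e]

theorem Leaf3.not_adj_e (h : Leaf3 G l o e₁ e₂ x w z y) : ¬ G.Adj e₁ e₂ := fun hh => by
  rcases h.n₁.mem hh with e | e | e
  exacts [h.nl.adj₃.ne' e, h.not_adj_l (e ▸ h.n₂.adj₁), h.symm_x.not_adj_l (e ▸ h.n₂.adj₁)]

theorem Leaf3.not_adj_o (h : Leaf3 G l o e₁ e₂ x w z y) : ¬ G.Adj o e₁ := fun hh => by
  rcases h.n₁.mem hh.symm with rfl | rfl | rfl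
  exacts [h.nl.adj₁.ne rfl, h.not_adj_l h.nl.adj₁.symm, h.symm_x.not_adj_l h.nl.adj₁.symm]

theorem Leaf3.not_onTriangle (h : Leaf3 G l o e₁ e₂ x w z y) : ¬ OnTriangle G l :=
  h.nl.not_onTriangle h.not_adj_o h.symm_e.not_adj_o h.not_adj_e

theorem Leaf3.not_adj_xw (h : Leaf3 G l o e₁ e₂ x w z y) : ¬ G.Adj x w := fun hh => by
  rcases h.nx.mem hh with rfl | rfl | rfl
  exacts [h.n₁.adj₃.ne rfl, h.nw.adj₂.ne rfl, h.nw.adj₃.ne rfl]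

theorem Leaf3.not_adj_ez (h : Leaf3 G l o e₁ e₂ x w z y) : ¬ G.Adj e₁ z := fun hh => by
  rcases h.nz.mem hh.symm with rfl | rfl | rfl
  exacts [h.nl.2.2.1 rfl, h.n₁.adj₂.ne rfl, h.n₁.adj₃.ne rfl]

theorem Leaf3.not_onTriangle_e₁ (h : Leaf3 G l o e₁ e₂ x w z y) : ¬ OnTriangle G e₁ :=
  h.n₁.not_onTriangle (fun hh => h.not_adj_l hh.symm) (fun hh => h.symm_x.not_adj_l hh.symm)
    h.not_adj_xw

theorem Leaf3.not_onTriangle_x (h : Leaf3 G l o e₁ e₂ x w z y) : ¬ OnTriangle G x :=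
  h.nx.not_onTriangle h.not_adj_ez h.symm_e.symm_x.symm_e.not_adj_ez h.symm_e.not_adj_xw

theorem Leaf3.not_adj_of_ne (h : Leaf3 G l o e₁ e₂ x w z y) {t : V} (ht : G.Adj l t)
    (hne : t ≠ e₁) : ¬ G.Adj t x := fun hh => by
  have : t ≠ z ∧ t ≠ y := ⟨fun e => h.symm_e.not_adj_l (e ▸ ht.symm),
    fun e => h.symm_e.symm_x.not_adj_l (e ▸ ht.symm)⟩
  rcases h.nx.mem hh.symm with e | e | e
  exacts [hne e, this.1 e, this.2 e]

theorem Leaf3.outer_unique_aux {o' e₁' e₂' x' w' z' y' : V} (h : Leaf3 G l o e₁ e₂ x w z y)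
    (h' : Leaf3 G l o' e₁' e₂' x' w' z' y') (ho : o = e₁') (he : e₁ = e₂') : False := by
  have hx : G.Adj x x' := by
    rcases h'.n₂.mem (he ▸ h.n₁.adj₂) with e | e | e
    exacts [absurd e h.n₁.1.symm, e ▸ h'.nz.adj₂, e ▸ h'.ny.adj₂]
  have hxo : G.Adj o x' := ho ▸ h'.n₁.adj₂
  rcases h.nx.mem hx with e | e | e
  · exact h'.not_adj_e (by rw [← ho, ← he, ← e]; exact hxo)
  · exact h.symm_e.not_adj_of_ne h.nl.adj₁ h.nl.2.1 (e ▸ hxo)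
  · exact h.symm_e.symm_x.not_adj_of_ne h.nl.adj₁ h.nl.2.1 (e ▸ hxo)

end

theorem Leaf.not_onTriangle {k : Bool} {l o : V} (h : Leaf G k l o) : ¬ OnTriangle G l := by
  cases k
  · obtain ⟨e₁, e₂, b, c, h⟩ := h
    exact h.not_onTriangle
  · obtain ⟨e₁, e₂, x, w, z, y, h⟩ := h
    exact h.not_onTriangle

/-- Two distinct neighbors of the root of a piece with the same neighborhood: the piece is
diamond-like and they are on a triangle. -/
theorem Leaf.twin_nbrs {k : Bool} {l o s t : V} (h : Leaf G k l o) (hs : G.Adj l s)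
    (ht : G.Adj l t) (hst : s ≠ t) (htw : ∀ m, G.Adj s m ↔ G.Adj t m) :
    OnTriangle G s ∧ OnTriangle G t ∧ s ≠ o ∧ t ≠ o := by
  cases k
  · obtain ⟨e₁, e₂, b, c, h⟩ := h
    have key : ∀ s t, G.Adj l s → G.Adj l t → s ≠ t → (∀ m, G.Adj s m ↔ G.Adj t m) →
        OnTriangle G s ∧ s ≠ o := by
      intro s t hs ht hst htw
      rcases h.nl.mem hs with rfl | rfl | rfl
      · refine absurd ((htw b).2 ?_) h.not_adj_ob
        rcases h.nl.mem ht with rfl | rfl | rfl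
        exacts [absurd rfl hst, h.n₁.adj₂, h.n₂.adj₂]
      · exact ⟨h.onTriangle_e₁, h.nl.1.symm⟩
      · exact ⟨h.symm_e.onTriangle_e₁, h.nl.2.1.symm⟩
    have h1 := key s t hs ht hst htw
    have h2 := key t s ht hs hst.symm fun m => (htw m).symm
    exact ⟨h1.1, h2.1, h1.2, h2.2⟩
  · obtain ⟨e₁, e₂, x, w, z, y, h⟩ := h
    exfalso
    have key : ∀ s t, G.Adj l s → G.Adj l t → s ≠ t → (∀ m, G.Adj s m ↔ G.Adj t m) → s = o := by
      intro s t hs ht hst htw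
      rcases h.nl.mem hs with rfl | rfl | rfl
      · rfl
      · exact absurd ((htw _).1 h.n₁.adj₂) (h.not_adj_of_ne ht hst.symm)
      · exact absurd ((htw _).1 h.n₂.adj₂) (h.symm_e.not_adj_of_ne ht hst.symm)
    exact hst ((key s t hs ht hst htw).trans (key t s ht hs hst.symm fun m => (htw m).symm).symm)

/-- A root is on no triangle, which rules out the interior of a diamond piece. In a piece of the
other kind an interior vertex has twin neighbors on no triangle, whereas by `Leaf.twin_nbrs` twin
neighbors of a root are on triangles. -/
theorem Leaf.not_interior {k : Bool} {l o : V} (h : Leaf G k l o) : ¬ Interior G l := by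
  rintro (⟨l', o', e₁, e₂, b, c, h', rfl | rfl⟩ | ⟨l', o', e₁, e₂, x, w, z, y, h', rfl | rfl⟩)
  · exact h.not_onTriangle h'.onTriangle_e₁
  · exact h.not_onTriangle h'.onTriangle_b
  · exact h'.not_onTriangle_x (h.twin_nbrs h'.n₁.adj₂ h'.n₁.adj₃ h'.n₁.2.2.1 fun m => by
      rw [h'.nx.2.2.2, h'.nw.2.2.2]).1
  · exact h'.symm_e.not_onTriangle_x (h.twin_nbrs h'.nx.adj₂ h'.nx.adj₃ h'.nx.2.2.1 fun m => by
      rw [h'.nz.2.2.2, h'.ny.2.2.2]).1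

theorem Leaf.outer_unique {k : Bool} {l o o' : V} (h : Leaf G k l o) (h' : Leaf G k l o') :
    o = o' := by
  cases k
  · have h0 := h
    obtain ⟨e₁, e₂, b, c, h⟩ := h
    obtain ⟨e₁', e₂', b', c', h'⟩ := h'
    obtain ⟨-, -, h1, h2⟩ := h0.twin_nbrs h'.nl.adj₂ h'.nl.adj₃ h'.nl.2.2.1 fun m => by
      rw [h'.n₁.2.2.2, h'.n₂.2.2.2]
    rcases h'.nl.mem h.nl.adj₁ with e | e | e
    exacts [e, absurd e.symm h1, absurd e.symm h2]
  · obtain ⟨e₁, e₂, x, w, z, y, h⟩ := h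
    obtain ⟨e₁', e₂', x', w', z', y', h'⟩ := h'
    rcases h'.nl.mem h.nl.adj₁ with e | e | e
    · exact e
    · exfalso
      rcases h.nl.mem h'.nl.adj₃ with e' | e' | e'
      exacts [h'.nl.2.2.1 (e.symm.trans e'.symm), h.outer_unique_aux h' e e'.symm,
        h.symm_e.outer_unique_aux h' e e'.symm]
    · exfalso
      rcases h.nl.mem h'.nl.adj₂ with e' | e' | e'
      exacts [h'.nl.2.2.1 (e'.trans e), h.outer_unique_aux h'.symm_e e e'.symm,
        h.symm_e.outer_unique_aux h'.symm_e e e'.symm]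

theorem Leaf.kind_unique {k k' : Bool} {l o o' : V} (h : Leaf G k l o) (h' : Leaf G k' l o') :
    k = k' := by
  have key : ∀ {o o' : V}, Leaf G false l o → ¬ Leaf G true l o' := by
    rintro o o' ⟨e₁, e₂, b, c, h⟩ h'
    obtain ⟨h1, h2, h3, h4⟩ := h'.twin_nbrs h.nl.adj₂ h.nl.adj₃ h.nl.2.2.1 fun m => by
      rw [h.n₁.2.2.2, h.n₂.2.2.2]
    obtain ⟨e₁', e₂', x, w, z, y, h'⟩ := h'
    rcases h'.nl.mem h.nl.adj₂ with e | e | e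
    exacts [h3 e, h'.not_onTriangle_e₁ (e ▸ h1), h'.symm_e.not_onTriangle_e₁ (e ▸ h1)]
  cases k <;> cases k'
  exacts [rfl, (key h h').elim, (key h' h).elim, rfl]

/-! ### Branches and centers -/

/-- The dart from `o` to `p` leads to a complete binary tree of height `h` rooted at `p` whose
leaves are the roots of pieces of kind `k`. -/
def Branch (G : SimpleGraph V) (k : Bool) : ℕ → V → V → Prop
  | 0, p, o => Leaf G k p o
  | h + 1, p, o => ∃ p₁ p₂, Nb G p o p₁ p₂ ∧ Branch G k h p₁ p ∧ Branch G k h p₂ p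

theorem Branch.map {k : Bool} {h : ℕ} {p o : V} (hb : Branch G k h p o) (φ : G ≃g G) :
    Branch G k h (φ p) (φ o) := by
  induction h generalizing p o with
  | zero => exact Leaf.map hb φ
  | succ h ih =>
    obtain ⟨p₁, p₂, h1, h2, h3⟩ := hb
    exact ⟨_, _, h1.map φ, ih h2, ih h3⟩

theorem Branch.adj {k : Bool} {h : ℕ} {p o : V} (hb : Branch G k h p o) : G.Adj p o := by
  cases h with
  | zero =>
    obtain ⟨_, _, h1, -, -⟩ := Leaf.exists_nb hb
    exact h1.adj₁
  | succ h =>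
    obtain ⟨_, _, h1, -, -⟩ := hb
    exact h1.adj₁

theorem Branch.not_interior {k : Bool} {h : ℕ} {p o : V} (hb : Branch G k h p o) :
    ¬ Interior G p := by
  induction h generalizing p o with
  | zero => exact Leaf.not_interior hb
  | succ h ih =>
    obtain ⟨p₁, p₂, h1, h2, h3⟩ := hb
    intro hp
    obtain ⟨x, y, hxy, hx, hy, hix, hiy⟩ := hp.int_two
    have key : ∀ z, G.Adj p z → Interior G z → z = o := by
      intro z hz hiz
      rcases h1.mem hz with e | e | e
      exacts [e, absurd (e ▸ hiz) (ih h2), absurd (e ▸ hiz) (ih h3)]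
    exact hxy ((key x hx hix).trans (key y hy hiy).symm)

theorem Leaf.not_branch_succ {k k' : Bool} {h : ℕ} {p o o' : V} (hl : Leaf G k p o)
    (hb : Branch G k' (h + 1) p o') : False := by
  obtain ⟨p₁, p₂, h1, h2, h3⟩ := hb
  have e1 : p₁ = o := by
    by_contra e
    exact h2.not_interior (hl.int_nbr h1.adj₂ e)
  have e2 : p₂ = o := by
    by_contra e
    exact h3.not_interior (hl.int_nbr h1.adj₃ e)
  exact h1.2.2.1 (e1.trans e2.symm)

/-- The outer neighbors may differ, but two pairs of children among three neighbors of `p` share a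
vertex, to which induction applies. Height `0` is recognized by the interior neighbors of a root. -/
theorem Branch.height_unique {k k' : Bool} {h h' : ℕ} {p o o' : V} (hb : Branch G k h p o)
    (hb' : Branch G k' h' p o') : k = k' ∧ h = h' := by
  induction h generalizing p o h' o' with
  | zero =>
    cases h' with
    | zero => exact ⟨Leaf.kind_unique hb hb', rfl⟩
    | succ h' => exact (Leaf.not_branch_succ hb hb').elim
  | succ h ih =>
    cases h' with
    | zero => exact (Leaf.not_branch_succ hb' hb).elim
    | succ h' =>
      obtain ⟨p₁, p₂, h1, h2, h3⟩ := hb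
      obtain ⟨q₁, q₂, k1, k2, k3⟩ := hb'
      have : ∃ q, Branch G k h q p ∧ Branch G k' h' q p := by
        rcases k1.mem h1.adj₂ with e | e | e
        · rcases k1.mem h1.adj₃ with e' | e' | e'
          exacts [absurd (e.trans e'.symm) h1.2.2.1, ⟨p₂, h3, e' ▸ k2⟩, ⟨p₂, h3, e' ▸ k3⟩]
        · exact ⟨p₁, h2, e ▸ k2⟩
        · exact ⟨p₁, h2, e ▸ k3⟩
      obtain ⟨q, hq, hq'⟩ := this
      obtain ⟨e1, e2⟩ := ih hq hq'
      exact ⟨e1, congrArg _ e2⟩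

/-- All three neighbors of `o` are roots of branches of height `h`. -/
def Center (G : SimpleGraph V) (k : Bool) (h : ℕ) (o : V) : Prop :=
  ∀ x, G.Adj o x → Branch G k h x o

/-- Each neighbor of `p` differs from `o` or from `o'`, so it is a child for one of the two branch
structures, and these have the same height. -/
theorem Branch.center {k : Bool} {h : ℕ} {p o o' : V} (hb : Branch G k h p o)
    (hb' : Branch G k h p o') (hne : o ≠ o') : ∃ h', Center G k h' p := by
  cases h with
  | zero => exact absurd (Leaf.outer_unique hb hb') hne
  | succ h =>
    refine ⟨h, fun x hx => ?_⟩
    obtain ⟨p₁, p₂, h1, h2, h3⟩ := hb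
    obtain ⟨q₁, q₂, k1, k2, k3⟩ := hb'
    rcases h1.mem hx with rfl | rfl | rfl
    · rcases k1.mem hx with rfl | rfl | rfl
      exacts [absurd rfl hne, k2, k3]
    · exact h2
    · exact h3


/-! ### Trails and their rims -/

/-- A vertex `v` with neighbors `a`, `b`, `c` such that the stabilizer of the dart `vb` fixes all
neighbors of `v`, and which is not close to the interior of a piece. -/
structure Start (G : SimpleGraph V) (v a b c : V) : Prop where
  stub : Stubborn G
  nb : Nb G v a b c
  fix : ∀ φ : G ≃g G, φ v = v → φ b = b → ∀ x, G.Adj v x → φ x = x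
  move : ∀ φ : G ≃g G, φ v = v → φ b = b ∨ φ b = c ∨ φ c = b
  not_int : ¬ Interior G v
  not_leaf : ∀ k o, ¬ Leaf G k v o

/-- A path `p 0, …, p m` with first edge `vb` such that, at every inner vertex, the stabilizer of
the initial part interchanges the two possible continuations. -/
structure Trail (G : SimpleGraph V) (v b : V) (p : ℕ → V) (m : ℕ) : Prop where
  zero : p 0 = v
  one : p 1 = b
  swap : ∀ i, i + 1 < m → ∃ s, Nb G (p (i + 1)) (p i) (p (i + 2)) s ∧
    ∃ σ : G ≃g G, (∀ j ≤ i + 1, σ (p j) = p j) ∧ σ (p (i + 2)) = s ∧ σ s = p (i + 2)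

/-- The trail cannot be extended: the stabilizer of its vertices fixes the neighbors of the last
one. -/
def TrailStops (G : SimpleGraph V) (p : ℕ → V) (m : ℕ) : Prop :=
  ∀ φ : G ≃g G, (∀ j ≤ m, φ (p j) = p j) → ∀ x, G.Adj (p m) x → φ x = x

theorem Trail.congr {v b : V} {p q : ℕ → V} {m : ℕ} (hT : Trail G v b p m) (hm : 1 ≤ m)
    (h : ∀ j ≤ m, q j = p j) : Trail G v b q m := by
  refine ⟨(h 0 (by omega)).trans hT.zero, (h 1 hm).trans hT.one, fun i hi => ?_⟩
  obtain ⟨s, h1, σ, h2, h3, h4⟩ := hT.swap i hi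
  rw [h i (by omega), h (i + 1) (by omega), h (i + 2) (by omega)]
  exact ⟨s, h1, σ, fun j hj => by rw [h j (by omega)]; exact h2 j hj, h3, h4⟩

theorem Trail.mono {v b : V} {p : ℕ → V} {m n : ℕ} (hT : Trail G v b p m) (hn : n ≤ m) :
    Trail G v b p n :=
  ⟨hT.zero, hT.one, fun i hi => hT.swap i (by omega)⟩

theorem Trail.adj {v b : V} {p : ℕ → V} {m : ℕ} (hT : Trail G v b p m) (hvb : G.Adj v b)
    {i : ℕ} (hi : i < m) : G.Adj (p i) (p (i + 1)) := by
  cases i with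
  | zero => rwa [hT.zero, hT.one]
  | succ i =>
    obtain ⟨s, h, -⟩ := hT.swap i hi
    exact h.adj₂

theorem Trail.extend (hc : Cubic G) {v b : V} {p : ℕ → V} {m : ℕ} (hT : Trail G v b p (m + 1))
    (hvb : G.Adj v b) (hs : ¬ TrailStops G p (m + 1)) :
    ∃ q : ℕ → V, (∀ j ≤ m + 1, q j = p j) ∧ Trail G v b q (m + 2) := by
  unfold TrailStops at hs
  push Not at hs
  obtain ⟨φ, h1, x, h2, h3⟩ := hs
  have hx : p m ≠ x := fun e => h3 (by rw [← e]; exact h1 m (by omega))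
  obtain ⟨s, hn⟩ := hc.nb₂ (hT.adj hvb (i := m) (by omega)).symm h2 hx
  have hn' := hn.map φ
  rw [h1 (m + 1) le_rfl, h1 m (by omega)] at hn'
  have e1 : φ x = s ∧ φ s = x := by
    rcases hn.rot.pair (hn'.rot) with ⟨e, -⟩ | e
    · exact absurd e h3
    · exact e
  refine ⟨Function.update p (m + 2) x, fun j hj => Function.update_of_ne (by omega) _ _, ?_⟩
  have hq : ∀ j ≤ m + 1, Function.update p (m + 2) x j = p j :=
    fun j hj => Function.update_of_ne (by omega) _ _
  have hT' := hT.congr (by omega) hq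
  refine ⟨hT'.zero, hT'.one, fun i hi => ?_⟩
  by_cases him : i + 1 < m + 1
  · exact hT'.swap i him
  · obtain rfl : i = m := by omega
    rw [hq i (by omega), hq (i + 1) (by omega), Function.update_self]
    exact ⟨s, hn, φ, fun j hj => by rw [hq j hj]; exact h1 j hj, e1⟩

theorem exists_trail (hc : Cubic G) {v b : V} (hvb : G.Adj v b) :
    (∃ p m, Trail G v b p (m + 1) ∧ TrailStops G p (m + 1)) ∨ ∃ p, ∀ m, Trail G v b p m := by
  by_contra! hcon
  obtain ⟨h1, h2⟩ := hcon
  let T := fun n : ℕ => {p : ℕ → V // Trail G v b p (n + 1)}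
  have hstep : ∀ n (t : T n), ∃ q : T (n + 1), ∀ j ≤ n + 1, q.1 j = t.1 j := by
    intro n t
    obtain ⟨q, hq, hq'⟩ := t.2.extend hc hvb (h1 t.1 n t.2)
    exact ⟨⟨q, hq'⟩, hq⟩
  choose f hf using hstep
  let t0 : T 0 := ⟨fun i => if i = 0 then v else b, by simp, by simp, fun i hi => by omega⟩
  let P : ∀ n, T n := fun n => Nat.rec t0 (fun n t => f n t) n
  have hP : ∀ n, ∀ j ≤ n + 1, (P (n + 1)).1 j = (P n).1 j := fun n => hf n (P n)
  have hag : ∀ d j, (P (j + d)).1 j = (P j).1 j := by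
    intro d j
    induction d with
    | zero => rfl
    | succ d ih => exact (hP (j + d) j (by omega)).trans ih
  obtain ⟨m, hm⟩ := h2 fun i => (P i).1 i
  refine hm (((P m).2.congr (by omega) ?_).mono (Nat.le_succ m))
  intro j hj
  rcases Nat.lt_or_ge j (m + 1) with h | h
  · obtain ⟨d, rfl⟩ := Nat.exists_eq_add_of_le (Nat.lt_succ_iff.1 h)
    exact (hag d j).symm
  · obtain rfl : j = m + 1 := by omega
    exact hP m _ le_rfl

section
variable {v a b c : V} {p : ℕ → V} {m : ℕ}

/-- At `p 0` this is the rigidity of `Start`. At a later vertex of the trail two neighbors lie on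
the fixed part, so the third is fixed as well. -/
theorem Trail.fix (hT : Trail G v b p m) (hS : Start G v a b c) {i : ℕ} (hi : i + 1 ≤ m)
    {φ : G ≃g G} (hφ : ∀ j ≤ i + 1, φ (p j) = p j) {j : ℕ} (hj : j ≤ i) {x : V}
    (hx : G.Adj (p j) x) : φ x = x := by
  cases j with
  | zero =>
    refine hS.fix φ ?_ ?_ x (hT.zero ▸ hx)
    · have := hφ 0 (by omega)
      rwa [hT.zero] at this
    · have := hφ 1 (by omega)
      rwa [hT.one] at this
  | succ j =>
    obtain ⟨s, h1, -⟩ := hT.swap j (by omega)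
    have h2 := h1.map φ
    rw [hφ _ (show j + 1 ≤ i + 1 by omega), hφ _ (show j ≤ i + 1 by omega),
      hφ _ (show j + 2 ≤ i + 1 by omega)] at h2
    have h3 := h1.third h2
    rcases h1.mem hx with rfl | rfl | rfl
    exacts [hφ _ (by omega), hφ _ (by omega), h3]

/-- The interchange `σ` at `p (i + 1)` moves `z`, while by `Trail.fix` it fixes all vertices of the
earlier path and their neighbors. This makes the trail an induced path. -/
theorem Trail.far (hT : Trail G v b p m) (hS : Start G v a b c) {i j : ℕ} (hi : i + 1 < m)
    (hj : j ≤ i) {z : V} (hz : G.Adj (p (i + 1)) z) (hne : z ≠ p i) :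
    ¬ G.Adj (p j) z ∧ z ≠ p j := by
  obtain ⟨s, h1, σ, h2, h3, h4⟩ := hT.swap i hi
  have hmove : σ z ≠ z := by
    rcases h1.mem hz with rfl | rfl | rfl
    · exact absurd rfl hne
    · rw [h3]; exact h1.2.2.1.symm
    · rw [h4]; exact h1.2.2.1
  refine ⟨fun h => hmove (hT.fix hS (by omega) h2 hj h), ?_⟩
  rintro rfl
  exact hmove (h2 j (by omega))

theorem Trail.adj_iff (hT : Trail G v b p m) (hS : Start G v a b c) {i j : ℕ} (hij : i < j)
    (hj : j ≤ m) : p i ≠ p j ∧ (G.Adj (p i) (p j) → j = i + 1) := by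
  by_cases h : j = i + 1
  · subst h
    exact ⟨(hT.adj hS.nb.adj₂ (by omega)).ne, fun _ => rfl⟩
  · obtain ⟨d, rfl⟩ := Nat.exists_eq_add_of_le (show i + 2 ≤ j by omega)
    obtain ⟨s, h1, -⟩ := hT.swap (i + d) (by omega)
    have := hT.far hS (i := i + d) (j := i) (by omega) (by omega) h1.adj₂ h1.1.symm
    rw [show i + 2 + d = i + d + 2 by omega]
    exact ⟨this.2.symm, fun h => absurd h this.1⟩

theorem Trail.injOn (hT : Trail G v b p m) (hS : Start G v a b c) {i j : ℕ} (hi : i ≤ m)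
    (hj : j ≤ m) (h : p i = p j) : i = j := by
  rcases lt_trichotomy i j with hlt | e | hlt
  exacts [absurd h (hT.adj_iff hS hlt hj).1, e, absurd h.symm (hT.adj_iff hS hlt hi).1]

/-- Going backwards, the interchange at each vertex copies the branch behind the next vertex to the
other continuation, so the height grows by one at each step. -/
theorem Trail.branch (hT : Trail G v b p m) {k : Bool} {i : ℕ} (hi : i < m)
    (h : Leaf G k (p (i + 1)) (p i)) : ∃ h, Branch G k h b v := by
  have key : ∀ i, i < m → ∀ h, Branch G k h (p (i + 1)) (p i) → ∃ h, Branch G k h (p 1) (p 0) := by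
    intro i
    induction i with
    | zero => exact fun _ h hb => ⟨h, hb⟩
    | succ i ih =>
      intro hi h hb
      obtain ⟨s, h1, σ, h2, h3, h4⟩ := hT.swap i hi
      have hb' := hb.map σ
      rw [h3, h2 _ le_rfl] at hb'
      exact ih (by omega) (h + 1) ⟨_, _, h1, hb, hb'⟩
  rw [← hT.zero, ← hT.one]
  exact key i hi 0 h

/-- The trail does not meet the root of a piece from outside. -/
def Trail.Clear (G : SimpleGraph V) (p : ℕ → V) (m : ℕ) : Prop :=
  ∀ i < m, ∀ k, ¬ Leaf G k (p (i + 1)) (p i)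

theorem Trail.not_leaf (hT : Trail G v b p m) (hS : Start G v a b c) (hC : Trail.Clear G p m)
    {i : ℕ} (hi : i < m) (k : Bool) (o : V) : ¬ Leaf G k (p i) o := by
  intro hl
  cases i with
  | zero => exact hS.not_leaf k o (hT.zero ▸ hl)
  | succ i =>
    obtain ⟨_, _, hn, -⟩ := hl.exists_nb
    obtain ⟨s, h1, σ, h2, h3, h4⟩ := hT.swap i hi
    have hl' := hl.map σ
    rw [h2 _ le_rfl] at hl'
    have e := hl.outer_unique hl'
    rcases h1.mem hn.adj₁ with rfl | rfl | rfl
    · exact hC i (by omega) k hl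
    · exact h1.2.2.1 (e.trans h3)
    · exact h1.2.2.1 (e.trans h4).symm

theorem Trail.not_int (hT : Trail G v b p m) (hS : Start G v a b c) (hC : Trail.Clear G p m)
    {i : ℕ} (hi : i ≤ m) : ¬ Interior G (p i) := by
  induction i with
  | zero => rw [hT.zero]; exact hS.not_int
  | succ i ih =>
    intro h
    rcases h.nbr (hT.adj hS.nb.adj₂ hi).symm with h | ⟨k, o, h, -⟩
    exacts [ih (by omega) h, hT.not_leaf hS hC hi k o h]

theorem Trail.not_int_nbr (hT : Trail G v b p m) (hS : Start G v a b c) (hC : Trail.Clear G p m)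
    {i : ℕ} (hi : i < m) {x : V} (hx : G.Adj (p i) x) : ¬ Interior G x := by
  intro h
  rcases h.nbr hx.symm with h | ⟨k, o, h, -⟩
  exacts [hT.not_int hS hC hi.le h, hT.not_leaf hS hC hi k o h]

/-- `z` is adjacent to `p j` with `j < m` and does not lie on the path `p 0, …, p (m - 1)`. -/
def Trail.Rim (G : SimpleGraph V) (p : ℕ → V) (m j : ℕ) (z : V) : Prop :=
  j < m ∧ G.Adj (p j) z ∧ ∀ i < m, z ≠ p i

theorem Trail.Rim.not_adj {j : ℕ} {z : V} (hz : Trail.Rim G p m j z) (hT : Trail G v b p m)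
    (hS : Start G v a b c) {i : ℕ} (hi : i < j) : ¬ G.Adj (p i) z := by
  obtain ⟨h1, h2, h3⟩ := hz
  obtain ⟨j, rfl⟩ : ∃ j', j = j' + 1 := ⟨j - 1, by omega⟩
  exact (hT.far hS h1 (Nat.lt_succ_iff.1 hi) h2 (h3 j (by omega))).1

theorem Trail.Rim.eq {j : ℕ} {z : V} (hz : Trail.Rim G p m j z) (hT : Trail G v b p m)
    (hS : Start G v a b c) {i : ℕ} (hi : i < m) (h : G.Adj (p i) z) : i = j := by
  rcases lt_trichotomy i j with hlt | e | hlt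
  · exact absurd h (hz.not_adj hT hS hlt)
  · exact e
  · exact absurd hz.2.1 (Trail.Rim.not_adj (j := i) ⟨hi, h, hz.2.2⟩ hT hS hlt)

/-- The interchange at the later vertex fixes `x`, so an edge `xy` makes `x` adjacent to both
continuations, and the trail has just one more vertex. If `i` immediately precedes the later index,
`x` is a twin of a trail vertex. Otherwise the preceding interchange preserves the neighbors of `x`
and carries the trail vertex to a twin. Either way a trail vertex would be interior. -/
theorem Trail.Rim.not_adj_rim_of_lt (hT : Trail G v b p m) (hS : Start G v a b c)
    (hC : Trail.Clear G p m) {i j : ℕ} {x y : V} (hx : Trail.Rim G p m i x)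
    (hy : Trail.Rim G p m j y) (hij : i < j) : ¬ G.Adj x y := by
  intro hxy
  obtain ⟨j, rfl⟩ : ∃ j', j = j' + 1 := ⟨j - 1, by omega⟩
  obtain ⟨s, h1, σ, h2, h3, h4⟩ := hT.swap j hy.1
  have hσx : σ x = x := hT.fix hS (by have := hy.1; omega) h2 (by omega) hx.2.1
  have hboth : G.Adj x (p (j + 2)) ∧ G.Adj x s := by
    have := σ.map_adj_iff.2 hxy
    rw [hσx] at this
    rcases h1.mem hy.2.1 with e | e | e
    · exact absurd e (hy.2.2 j (by have := hy.1; omega))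
    · exact ⟨e ▸ hxy, by rwa [e, h3] at this⟩
    · exact ⟨by rwa [e, h4] at this, e ▸ hxy⟩
  have hm : m = j + 2 := by
    by_contra hne
    have hlt : j + 2 < m := by have := hy.1; omega
    have := hx.eq hT hS hlt hboth.1.symm
    omega
  have hxn : Nb G x (p i) (p (j + 2)) s := by
    obtain ⟨t, ht⟩ := hS.stub.cubic.nb₂ hboth.1 hboth.2 h1.2.2.1
    rcases ht.mem hx.2.1.symm with e | e | e
    · exact absurd e (hT.adj_iff hS (by omega) hm.ge).1
    · exact absurd e.symm (hT.far hS (i := j) (j := i) hy.1 (by omega) h1.adj₃ h1.2.1.symm).2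
    · exact (e ▸ ht).rot.rot
  have hint := hT.not_int hS hC hy.1.le
  by_cases hi : i = j
  · subst hi
    exact hint (hS.stub.int_of_twins h1 hxn (hx.2.2 _ hy.1).symm)
  · obtain ⟨j, rfl⟩ : ∃ j', j = j' + 1 := ⟨j - 1, by omega⟩
    obtain ⟨s', k1, τ, k2, k3, k4⟩ := hT.swap j (by omega)
    have hτx : τ x = x := hT.fix hS (by omega) k2 (by omega) hx.2.1
    have hxn' := hxn.map τ
    rw [hτx, k2 i (by omega)] at hxn'
    have h1' := h1.map τ
    rw [show j + 1 + 1 = j + 2 by omega] at *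
    rw [k3, k2 _ le_rfl] at h1'
    refine hint (hS.stub.int_of_twins h1 (q := s') ?_ k1.2.2.1)
    rcases hxn.rot.pair hxn'.rot with ⟨e1, e2⟩ | ⟨e1, e2⟩
    · rwa [e1, e2] at h1'
    · rw [e1, e2] at h1'
      exact h1'.swap

theorem Trail.Rim.not_adj_rim (hT : Trail G v b p m) (hS : Start G v a b c)
    (hC : Trail.Clear G p m) {i j : ℕ} {x y : V} (hx : Trail.Rim G p m i x)
    (hy : Trail.Rim G p m j y) : ¬ G.Adj x y := by
  rcases lt_trichotomy i j with h | rfl | h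
  · exact not_adj_rim_of_lt hT hS hC hx hy h
  · exact fun hxy => hT.not_int hS hC hx.1.le (hS.stub.int_of_triangle hx.2.1 hy.2.1 hxy)
  · exact fun hxy => not_adj_rim_of_lt hT hS hC hy hx h hxy.symm

end

/-! ### Markers along a trail -/

/-- The vertices of the closed neighborhood of `Y`. -/
def closedNbhd (G : SimpleGraph V) (Y : Set V) : Set V := {x | x ∈ Y ∨ ∃ y ∈ Y, G.Adj y x}

/-- By `Traced.core` all neighbors of `w` lie in the marker. A rim vertex has at most one neighbor
in `Y`, at most one in `E` and none in the rim, so it cannot have three. If `w` owes its color to a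
twin, it is interior and has two interior neighbors, both of which would have to lie in `E`. -/
theorem Stubborn.core_subset (hG : Stubborn G) {Y E Q₀ Q : Set V} (hE : E.Subsingleton)
    (hQ₀ : Q₀ = closedNbhd G Y ∪ E) (hT : Traced G Q₀ Q)
    (hint : ∀ x ∈ closedNbhd G Y, ¬ Interior G x)
    (hone : ∀ x ∉ Y, ∀ y ∈ Y, ∀ y' ∈ Y, G.Adj y x → G.Adj y' x → y = y')
    (hrim : ∀ x ∈ closedNbhd G Y, ∀ y ∈ closedNbhd G Y, x ∉ Y → y ∉ Y → ¬ G.Adj x y)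
    {w : V} (hw : w ∈ Q) (hN : ∀ x, G.Adj w x → x ∈ Q) : w ∈ Y ∨ w ∈ E := by
  obtain ⟨x, y, z, hn⟩ := hG.cubic w
  obtain ⟨h1, h2⟩ := hT.core hG.cubic hn hw (hN _ hn.adj₁) (hN _ hn.adj₂) (hN _ hn.adj₃)
  have hall : ∀ t, G.Adj w t → t ∈ Q₀ := by
    intro t ht
    rcases hn.mem ht with rfl | rfl | rfl
    exacts [h1.1, h1.2.1, h1.2.2]
  subst hQ₀
  rcases h2 with (hw' | hw') | ⟨w', hne, hw'⟩
  · by_contra! hcon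
    have hcase : ∀ t, G.Adj w t → t ∈ Y ∨ t ∈ E := by
      intro t ht
      rcases hall t ht with h | h
      · by_contra! hh
        exact hrim w hw' t h hcon.1 hh.1 ht
      · exact Or.inr h
    have hYY : ∀ s t, G.Adj w s → G.Adj w t → s ∈ Y → t ∈ Y → s = t := fun s t hs ht h h' =>
      hone w hcon.1 s h t h' hs.symm ht.symm
    rcases hcase x hn.adj₁ with h | h <;> rcases hcase y hn.adj₂ with h' | h' <;>
      rcases hcase z hn.adj₃ with h'' | h''
    · exact hn.1 (hYY _ _ hn.adj₁ hn.adj₂ h h')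
    · exact hn.1 (hYY _ _ hn.adj₁ hn.adj₂ h h')
    · exact hn.2.1 (hYY _ _ hn.adj₁ hn.adj₃ h h'')
    · exact hn.2.2.1 (hE h' h'')
    · exact hn.2.2.1 (hYY _ _ hn.adj₂ hn.adj₃ h' h'')
    · exact hn.2.1 (hE h h'')
    · exact hn.1 (hE h h')
    · exact hn.1 (hE h h')
  · exact Or.inr hw'
  · exfalso
    obtain ⟨s, t, hst, hs, ht, his, hit⟩ := (hG.int_of_twins hn hw' hne.symm).int_two
    have key : ∀ s, G.Adj w s → Interior G s → s ∈ E := fun s hs hi =>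
      (hall s hs).resolve_left fun h => hint s h hi
    exact hst (hE (key s hs his) (key t ht hit))


section
variable {v a b c : V} {p : ℕ → V} {m : ℕ}

theorem Trail.nbr_cases (hT : Trail G v b p m) (hS : Start G v a b c) {i j : ℕ} (hi : i ≤ m)
    (hj : j ≤ m) (h : G.Adj (p i) (p j)) : j = i + 1 ∨ i = j + 1 := by
  rcases lt_trichotomy i j with hlt | rfl | hlt
  · exact Or.inl ((hT.adj_iff hS hlt hj).2 h)
  · exact absurd rfl h.ne
  · exact Or.inr ((hT.adj_iff hS hlt hi).2 h.symm)

/-- An automorphism fixing the first vertex of an induced path and mapping the path into an induced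
path extending it fixes the path pointwise. -/
theorem fix_path {I : ℕ → Prop} {φ : G ≃g G} (h0 : φ (p 0) = p 0)
    (hφ : ∀ i, I i → ∃ j, I j ∧ φ (p i) = p j)
    (hadj : ∀ i j, I i → I j → G.Adj (p i) (p j) → j = i + 1 ∨ i = j + 1)
    (hstep : ∀ i, I (i + 1) → I i ∧ G.Adj (p i) (p (i + 1)))
    (hinj : ∀ i j, I i → I j → p i = p j → i = j) : ∀ i, I i → φ (p i) = p i := by
  intro i
  induction i using Nat.strong_induction_on with
  | _ i ih =>
    intro hi
    cases i with
    | zero => exact h0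
    | succ i =>
      obtain ⟨hIi, hai⟩ := hstep i hi
      obtain ⟨j, hj, e⟩ := hφ _ hi
      have h1 := φ.map_adj_iff.2 hai
      rw [ih i (by omega) hIi, e] at h1
      rcases hadj _ _ hIi hj h1 with rfl | rfl
      · exact e
      · rw [← ih j (by omega) hj] at e
        have := hinj _ _ hi hj (φ.injective e)
        omega

/-- An automorphism preserving an induced path sends its first vertex to an end. -/
theorem map_zero_cases {I : ℕ → Prop} {φ : G ≃g G} (hI0 : I 0)
    (hφ : ∀ i, I i → ∃ j, I j ∧ φ (p i) = p j) (hφ' : ∀ i, I i → ∃ j, I j ∧ φ.symm (p i) = p j)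
    (hadj : ∀ i j, I i → I j → G.Adj (p i) (p j) → j = i + 1 ∨ i = j + 1)
    (hstep : ∀ i, I (i + 1) → I i ∧ G.Adj (p i) (p (i + 1)))
    (hinj : ∀ i j, I i → I j → p i = p j → i = j) :
    φ (p 0) = p 0 ∨ ∃ i, I (i + 1) ∧ ¬ I (i + 2) ∧ φ (p 0) = p (i + 1) := by
  obtain ⟨i, hi, e⟩ := hφ 0 hI0
  cases i with
  | zero => exact Or.inl e
  | succ i =>
    refine Or.inr ⟨i, hi, fun hi2 => ?_, e⟩
    have key : ∀ j, I j → G.Adj (p (i + 1)) (p j) → φ.symm (p j) = p 1 := by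
      intro j hj hadj'
      obtain ⟨l, hl, e'⟩ := hφ' j hj
      rw [← e] at hadj'
      have := φ.symm.map_adj_iff.2 hadj'
      rw [RelIso.symm_apply_apply, e'] at this
      rcases hadj _ _ hI0 hl this with h | h
      · rw [e', h]
      · omega
    have h1 := key i (hstep i hi).1 (hstep i hi).2.symm
    have h2 := key (i + 2) hi2 (hstep (i + 1) hi2).2
    have := hinj _ _ (hstep i hi).1 hi2 (φ.symm.injective (h1.trans h2.symm))
    omega

theorem exists_mem_closedNbhd {Y : Set V} {u : V} (hu : u ∈ closedNbhd G Y)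
    (hY : ∀ y ∈ Y, ∃ w, G.Adj y w) : ∃ w ∈ closedNbhd G Y, G.Adj u w := by
  rcases hu with hu | ⟨y, hy, h⟩
  · obtain ⟨w, hw⟩ := hY u hu
    exact ⟨w, Or.inr ⟨u, hu, hw⟩, hw⟩
  · exact ⟨y, Or.inl hy, h.symm⟩

/-- The vertices of the ray are recognizable as black vertices with only black neighbors. A ray has
a single end vertex, so preserving it means fixing it pointwise. -/
theorem Start.false_of_infinite (hS : Start G v a b c) (hT : ∀ m, Trail G v b p m)
    (hC : ∀ m, Trail.Clear G p m) : False := by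
  set Y : Set V := Set.range p with hY
  have hin : ∀ i j, p i = p j → i = j := fun i j h =>
    (hT (max i j)).injOn hS (le_max_left _ _) (le_max_right _ _) h
  have hadj : ∀ i, G.Adj (p i) (p (i + 1)) := fun i =>
    (hT (i + 1)).adj hS.nb.adj₂ (Nat.lt_succ_self i)
  have hcases : ∀ i j, G.Adj (p i) (p j) → j = i + 1 ∨ i = j + 1 := fun i j h =>
    (hT (max i j)).nbr_cases hS (le_max_left _ _) (le_max_right _ _) h
  have hYrim : ∀ x ∉ Y, ∀ m i, i < m → G.Adj (p i) x → Trail.Rim G p m i x :=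
    fun x hx m i hi h => ⟨hi, h, fun j _ e => hx ⟨j, e.symm⟩⟩
  refine hS.stub.not_dist (TwoDist.of_marker hS.stub.conn hS.stub.cubic (closedNbhd G Y)
    (closedNbhd G Y) ⟨p 0, Or.inl ⟨0, rfl⟩⟩ subset_rfl
    (fun u hu => exists_mem_closedNbhd hu (by rintro _ ⟨i, rfl⟩; exact ⟨_, hadj i⟩)) ?_)
  intro Q hQ hTr φ₀ hφ₀
  have hcore : ∀ w ∈ Q, (∀ x, G.Adj w x → x ∈ Q) → w ∈ Y := by
    intro w hw hN
    refine (hS.stub.core_subset (Y := Y) (E := ∅) Set.subsingleton_empty (by simp) hTr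
      ?_ ?_ ?_ hw hN).resolve_right (Set.notMem_empty _)
    · rintro x (⟨i, rfl⟩ | ⟨_, ⟨i, rfl⟩, h⟩)
      · exact (hT i).not_int hS (hC i) le_rfl
      · exact (hT (i + 1)).not_int_nbr hS (hC _) (Nat.lt_succ_self i) h
    · rintro x hx _ ⟨i, rfl⟩ _ ⟨j, rfl⟩ h h'
      have hr := hYrim x hx (max i j + 1) i (by omega) h
      rw [hr.eq (hT _) hS (by omega) h']
    · rintro x (hx | ⟨_, ⟨i, rfl⟩, h⟩) y (hy | ⟨_, ⟨j, rfl⟩, h'⟩) hx' hy'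
      · exact absurd hx hx'
      · exact absurd hx hx'
      · exact absurd hy hy'
      · exact (hYrim x hx' (max i j + 1) i (by omega) h).not_adj_rim (hT _) hS (hC _)
          (hYrim y hy' (max i j + 1) j (by omega) h')
  have hpres : ∀ φ : G ≃g G, (∀ z, φ z ∈ Q ↔ z ∈ Q) → ∀ i, ∃ j, φ (p i) = p j := by
    intro φ hφ i
    have : φ (p i) ∈ Y := by
      refine hcore _ ((hφ _).2 ((hQ _ (Or.inl ⟨i, rfl⟩)).2 (Or.inl ⟨i, rfl⟩))) fun x hx => ?_
      obtain ⟨y, rfl⟩ := φ.surjective x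
      have hy : y ∈ closedNbhd G Y := Or.inr ⟨_, ⟨i, rfl⟩, φ.map_adj_iff.1 hx⟩
      exact (hφ _).2 ((hQ _ hy).2 hy)
    obtain ⟨j, e⟩ := this
    exact ⟨j, e.symm⟩
  have hφ' : ∀ z, φ₀.symm z ∈ Q ↔ z ∈ Q := fun z => by
    rw [← hφ₀ (φ₀.symm z), RelIso.apply_symm_apply]
  have h0 := map_zero_cases (G := G) (p := p) (I := fun _ => True) trivial
    (fun i _ => by simpa using hpres φ₀ hφ₀ i) (fun i _ => by simpa using hpres φ₀.symm hφ' i)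
    (fun i j _ _ => hcases i j) (fun i _ => ⟨trivial, hadj i⟩) (fun i j _ _ => hin i j)
  have hfix := fix_path (G := G) (p := p) (I := fun _ => True) (φ := φ₀) (by simpa using h0)
    (fun i _ => by simpa using hpres φ₀ hφ₀ i) (fun i j _ _ => hcases i j)
    (fun i _ => ⟨trivial, hadj i⟩) (fun i j _ _ => hin i j)
  rintro z (⟨i, rfl⟩ | ⟨_, ⟨i, rfl⟩, h⟩)
  · exact hfix i trivial
  · exact (hT (i + 1)).fix hS le_rfl (fun j _ => hfix j trivial) le_rfl h

theorem Trail.exists_side (hT : Trail G v b p (m + 1)) (hS : Start G v a b c) :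
    ∃ s, s ≠ p (m + 1) ∧ Trail.Rim G p (m + 1) m s ∧ ∀ φ : G ≃g G, (∀ i ≤ m, φ (p i) = p i) →
      φ (p (m + 1)) = p (m + 1) ∨ φ (p (m + 1)) = s ∨ φ s = p (m + 1) := by
  cases m with
  | zero =>
    rw [zero_add, hT.one]
    refine ⟨c, hS.nb.2.2.1.symm, ⟨zero_lt_one, hT.zero ▸ hS.nb.adj₃, fun i hi => ?_⟩,
      fun φ h => hS.move φ (by have := h 0 le_rfl; rwa [hT.zero] at this)⟩
    rw [Nat.lt_one_iff.1 hi, hT.zero]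
    exact hS.nb.adj₃.ne'
  | succ m =>
    obtain ⟨s, h1, -⟩ := hT.swap m (Nat.lt_succ_self _)
    refine ⟨s, h1.2.2.1.symm, ⟨Nat.lt_succ_self _, h1.adj₃, fun i hi => ?_⟩, fun φ hφ => ?_⟩
    · rcases Nat.lt_or_ge i (m + 1) with hlt | hge
      · exact (hT.far hS (Nat.lt_succ_self _) (Nat.lt_succ_iff.1 hlt) h1.adj₃ h1.2.1.symm).2
      · obtain rfl : i = m + 1 := by omega
        exact h1.adj₃.ne'
    · have h2 := h1.map φ
      rw [hφ _ le_rfl, hφ m (by omega)] at h2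
      rcases h1.mem h2.adj₂ with e | e | e
      exacts [absurd e.symm h2.1, Or.inl e, Or.inr (Or.inl e)]

/-- The end vertex `p (m + 1)` counts as a rim vertex, and `Y` is the path up to `p m`. Unlike a
ray, this path could be reversed, and its last step could be turned to the side `s`; the extra black
vertex `r` next to `s` prevents the latter. -/
theorem Start.false_of_finite (hS : Start G v a b c) (hT : Trail G v b p (m + 1))
    (hend : TrailStops G p (m + 1)) (hC : Trail.Clear G p (m + 1)) : False := by
  obtain ⟨s, hsne, hsr, hs⟩ := hT.exists_side hS
  set Y : Set V := {x | ∃ i ≤ m, x = p i} with hY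
  have hpY : ∀ i ≤ m, p i ∈ Y := fun i hi => ⟨i, hi, rfl⟩
  have hadj : ∀ i ≤ m, G.Adj (p i) (p (i + 1)) := fun i hi => hT.adj hS.nb.adj₂ (by omega)
  have hYrim : ∀ x ∉ Y, ∀ i ≤ m, G.Adj (p i) x → Trail.Rim G p (m + 1) i x :=
    fun x hx i hi h => ⟨by omega, h, fun j hj e => hx ⟨j, by omega, e⟩⟩
  have hlast : Trail.Rim G p (m + 1) m (p (m + 1)) := ⟨by omega, hadj m le_rfl, fun i hi e => by
    have := hT.injOn hS le_rfl hi.le e; omega⟩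
  have hout : ∀ {z t}, Trail.Rim G p (m + 1) m z → G.Adj z t → t ≠ p m →
      t ∉ closedNbhd G Y := by
    rintro z t hz hzt hne ht
    by_cases htY : t ∈ Y
    · obtain ⟨i, hi, rfl⟩ := htY
      exact hne (congrArg p (hz.eq hT hS (by omega) hzt.symm))
    · obtain ⟨_, ⟨i, hi, rfl⟩, h⟩ := ht.resolve_left htY
      exact hz.not_adj_rim hT hS hC (hYrim t htY i hi h) hzt
  -- If both remaining neighbors of `s` were adjacent to `p (m + 1)`, then `s` and `p (m + 1)` would
  -- be twins, and `p (m + 1)` would be interior.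
  obtain ⟨r, r', hr, hrl⟩ : ∃ r r', Nb G s (p m) r r' ∧ ¬ G.Adj (p (m + 1)) r := by
    obtain ⟨x, y, h⟩ := hS.stub.cubic.nb₁ hsr.2.1.symm
    by_cases hx : G.Adj (p (m + 1)) x
    · refine ⟨y, x, h.swap, fun hy => ?_⟩
      obtain ⟨t, ht⟩ := hS.stub.cubic.nb₂ hx hy h.2.2.1
      rcases ht.mem hlast.2.1.symm with e | e | e
      · exact h.1 e
      · exact h.2.1 e
      · subst e
        exact hT.not_int hS hC le_rfl (hS.stub.int_of_twins ht.rot.rot h hsne.symm)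
    · exact ⟨x, y, h, hx⟩
  have hrY : r ∉ closedNbhd G Y := hout hsr hr.adj₂ hr.1.symm
  have hrY' : r' ∉ closedNbhd G Y := hout hsr hr.adj₃ hr.2.1.symm
  set F₀ : Set V := closedNbhd G Y ∪ ({x | G.Adj (p (m + 1)) x} ∪ {x | G.Adj s x}) with hF₀
  have hlastF : p (m + 1) ∈ closedNbhd G Y := Or.inr ⟨p m, hpY m le_rfl, hadj m le_rfl⟩
  have hsF : s ∈ closedNbhd G Y := Or.inr ⟨p m, hpY m le_rfl, hsr.2.1⟩
  refine hS.stub.not_dist (TwoDist.of_marker hS.stub.conn hS.stub.cubic F₀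
    (closedNbhd G Y ∪ {r}) ⟨s, Or.inl hsF⟩ ?_ ?_ ?_)
  · exact Set.union_subset_union subset_rfl
      (Set.singleton_subset_iff.2 (Or.inr hr.adj₂))
  · rintro u (hu | hu | hu)
    · obtain ⟨w, hw, h⟩ := exists_mem_closedNbhd hu (by rintro _ ⟨i, hi, rfl⟩; exact ⟨_, hadj i hi⟩)
      exact ⟨w, Or.inl hw, h⟩
    · exact ⟨_, Or.inl hlastF, hu.symm⟩
    · exact ⟨_, Or.inl hsF, hu.symm⟩
  intro Q hQ hTr φ hφ
  have hclQ : ∀ x ∈ closedNbhd G Y, x ∈ Q := fun x hx => (hQ x (Or.inl hx)).2 (Or.inl hx)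
  have hrQ : r ∈ Q := (hQ r (Or.inr (Or.inr hr.adj₂))).2 (Or.inr rfl)
  have hcore : ∀ w ∈ Q, (∀ x, G.Adj w x → x ∈ Q) → w ∈ Y ∨ w = r := by
    intro w hw hN
    refine hS.stub.core_subset (Y := Y) (E := {r}) Set.subsingleton_singleton rfl hTr
      ?_ ?_ ?_ hw hN
    · rintro x (⟨i, hi, rfl⟩ | ⟨_, ⟨i, hi, rfl⟩, h⟩)
      · exact hT.not_int hS hC (by omega)
      · exact hT.not_int_nbr hS hC (by omega) h
    · rintro x hx _ ⟨i, hi, rfl⟩ _ ⟨j, hj, rfl⟩ h h'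
      rw [(hYrim x hx i hi h).eq hT hS (by omega) h']
    · rintro x (hx | ⟨_, ⟨i, hi, rfl⟩, h⟩) y (hy | ⟨_, ⟨j, hj, rfl⟩, h'⟩) hx' hy'
      · exact absurd hx hx'
      · exact absurd hx hx'
      · exact absurd hy hy'
      · exact (hYrim x hx' i hi h).not_adj_rim hT hS hC (hYrim y hy' j hj h')
  have hcore' : ∀ φ : G ≃g G, (∀ z, φ z ∈ Q ↔ z ∈ Q) → ∀ i ≤ m,
      φ (p i) ∈ Q ∧ ∀ x, G.Adj (φ (p i)) x → x ∈ Q := by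
    intro φ hφ i hi
    refine ⟨(hφ _).2 (hclQ _ (Or.inl (hpY i hi))), fun x hx => ?_⟩
    obtain ⟨y, rfl⟩ := φ.surjective x
    exact (hφ _).2 (hclQ _ (Or.inr ⟨_, hpY i hi, φ.map_adj_iff.1 hx⟩))
  have hpres : ∀ φ : G ≃g G, (∀ z, φ z ∈ Q ↔ z ∈ Q) → ∀ i ≤ m, ∃ j ≤ m, φ (p i) = p j := by
    intro φ hφ i hi
    obtain ⟨hi1, hi2⟩ := hcore' φ hφ i hi
    -- If `φ (p i) = r`, then `p i` has no neighbor in `Y`, since `r` has none. So `m = 0`, and the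
    -- three neighbors of `r` would have to be among `a` and `c`; the vertex `b` is excluded by
    -- `hrl`.
    refine (hcore _ hi1 hi2).resolve_right fun e => ?_
    have hnb : ∀ j ≤ m, ¬ G.Adj (p i) (p j) := by
      intro j hj h
      have h1 := φ.map_adj_iff.2 h
      obtain ⟨hj1, hj2⟩ := hcore' φ hφ j hj
      rcases hcore _ hj1 hj2 with hjY | hjr
      · exact hrY (Or.inr ⟨_, hjY, e ▸ h1.symm⟩)
      · exact h1.ne (e.trans hjr.symm)
    have hm : m = 0 := by
      by_contra hm
      rcases Nat.lt_or_ge i m with h | h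
      · exact hnb (i + 1) h (hadj i hi)
      · obtain ⟨d, rfl⟩ : ∃ d, i = d + 1 := ⟨i - 1, by omega⟩
        exact hnb d (by omega) (hadj d (by omega)).symm
    subst hm
    obtain rfl : i = 0 := by omega
    rw [e] at hi1 hi2
    obtain ⟨x, y, z, hn⟩ := hS.stub.cubic r
    obtain ⟨⟨h1, h2, h3⟩, -⟩ := hTr.core hS.stub.cubic hn hi1 (hi2 _ hn.adj₁) (hi2 _ hn.adj₂)
      (hi2 _ hn.adj₃)
    have key : ∀ t, G.Adj r t → t ∈ closedNbhd G Y ∪ {r} → t = a ∨ t = c := by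
      rintro t hrt ((ht | ⟨_, ⟨j, hj, rfl⟩, ht⟩) | rfl)
      · exact absurd (Or.inr ⟨t, ht, hrt.symm⟩) hrY
      · obtain rfl : j = 0 := by omega
        rw [hT.zero] at ht
        rcases hS.nb.mem ht with rfl | rfl | rfl
        · exact Or.inl rfl
        · refine absurd hrt.symm ?_
          rwa [zero_add, hT.one] at hrl
        · exact Or.inr rfl
      · exact absurd rfl hrt.ne
    have := hn.1
    have := hn.2.1
    have := hn.2.2.1
    have k1 := key _ hn.adj₁ h1
    have k2 := key _ hn.adj₂ h2
    have k3 := key _ hn.adj₃ h3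
    grind
  have hφ' : ∀ z, φ.symm z ∈ Q ↔ z ∈ Q := fun z => by
    rw [← hφ (φ.symm z), RelIso.apply_symm_apply]
  have h0 : φ (p 0) = p 0 := by
    rcases map_zero_cases (G := G) (p := p) (I := fun i => i ≤ m) (Nat.zero_le _)
      (hpres φ hφ) (hpres φ.symm hφ') (fun i j hi hj => hT.nbr_cases hS (by omega) (by omega))
      (fun i hi => ⟨by omega, hadj i (by omega)⟩)
      (fun i j hi hj => hT.injOn hS (by omega) (by omega)) with e | ⟨i, hi, hi', e⟩
    · exact e
    -- Reversal is impossible: conjugating the interchange at `p m` by `φ` gives an automorphism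
    -- fixing `v` and `b` that moves a neighbor of `v`.
    · exfalso
      obtain rfl : m = i + 1 := by omega
      obtain ⟨j, hj, e1⟩ := hpres φ hφ 1 (by omega)
      have h1 := φ.map_adj_iff.2 (hadj 0 (by omega))
      rw [e, e1] at h1
      obtain rfl : j = i := by
        have := hT.nbr_cases hS (by omega) (by omega) h1
        omega
      obtain ⟨s', k1, σ, k2, k3, k4⟩ := hT.swap j (by omega)
      have hm := hS.fix ((φ.trans σ).trans φ.symm)
        (by
          rw [← hT.zero]
          change φ.symm (σ (φ (p 0))) = p 0
          rw [e, k2 _ le_rfl, ← e, RelIso.symm_apply_apply])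
        (by
          rw [← hT.one]
          change φ.symm (σ (φ (p 1))) = p 1
          rw [e1, k2 _ (by omega), ← e1, RelIso.symm_apply_apply])
        (φ.symm (p (j + 2)))
        (by
          rw [← hT.zero, ← φ.map_adj_iff, RelIso.apply_symm_apply, e]
          exact k1.adj₂)
      change φ.symm (σ (φ (φ.symm (p (j + 2))))) = φ.symm (p (j + 2)) at hm
      rw [RelIso.apply_symm_apply] at hm
      exact k1.2.2.1 (k3.symm.trans (φ.symm.injective hm)).symm
  have hfix : ∀ i ≤ m, φ (p i) = p i := fix_path (G := G) (p := p) (I := fun i => i ≤ m) h0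
    (hpres φ hφ) (fun i j hi hj => hT.nbr_cases hS (by omega) (by omega))
    (fun i hi => ⟨by omega, hadj i (by omega)⟩)
    (fun i j hi hj => hT.injOn hS (by omega) (by omega))
  have hblack : ∀ φ : G ≃g G, (∀ z, φ z ∈ Q ↔ z ∈ Q) → φ (p m) = p m → φ s ≠ p (m + 1) := by
    intro φ hφ hm e
    have h1 := φ.map_adj_iff.2 hr.adj₂
    rw [e] at h1
    have h2 : φ r ≠ p m := fun e' => hr.1 (φ.injective (hm.trans e'.symm))
    rcases (hQ (φ r) (Or.inr (Or.inl h1))).1 ((hφ r).2 hrQ) with h3 | h3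
    · exact hout hlast h1 h2 h3
    · rw [h3] at h1
      exact hrl h1
  have hlast' : φ (p (m + 1)) = p (m + 1) := by
    rcases hs φ hfix with e | e | e
    · exact e
    · refine absurd ?_ (hblack φ.symm hφ' ?_)
      · rw [← e, RelIso.symm_apply_apply]
      · rw [RelIso.symm_apply_eq, hfix m le_rfl]
    · exact absurd e (hblack φ hφ (hfix m le_rfl))
  have hfix' : ∀ i ≤ m + 1, φ (p i) = p i := by
    intro i hi
    rcases Nat.lt_or_ge i (m + 1) with h | h
    · exact hfix i (by omega)
    · obtain rfl : i = m + 1 := by omega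
      exact hlast'
  have hs' : φ s = s := hT.fix hS le_rfl hfix' le_rfl hsr.2.1
  rintro z ((⟨i, hi, rfl⟩ | ⟨_, ⟨i, hi, rfl⟩, h⟩) | h | h)
  · exact hfix i hi
  · exact hT.fix hS le_rfl hfix' hi h
  · exact hend φ hfix' z h
  · have hr1 := hr.map φ
    rw [hs', hfix m le_rfl] at hr1
    have hr'Q : r' ∉ Q := by
      rw [hQ r' (Or.inr (Or.inr hr.adj₃))]
      rintro (h | h)
      exacts [hrY' h, hr.2.2.1 h.symm]
    have e : φ r = r := by
      rcases hr.mem hr1.adj₂ with e | e | e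
      · exact absurd e.symm hr1.1
      · exact e
      · exact absurd (e ▸ (hφ r).2 hrQ) hr'Q
    rw [e] at hr1
    rcases hr.mem h with rfl | rfl | rfl
    exacts [hfix m le_rfl, e, hr.third hr1]

theorem Start.exists_branch (hS : Start G v a b c) : ∃ k h, Branch G k h b v := by
  by_contra! hcon
  have hC : ∀ p m, Trail G v b p m → Trail.Clear G p m := by
    intro p m hT i hi k hl
    obtain ⟨h, hb⟩ := hT.branch hi hl
    exact hcon k h hb
  rcases exists_trail hS.stub.cubic hS.nb.adj₂ with ⟨p, m, hT, hend⟩ | ⟨p, hT⟩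
  · exact hS.false_of_finite hT hend (hC p _ hT)
  · exact hS.false_of_infinite hT fun m => hC p m (hT m)

end


/-! ### Enlarging branches until a center appears -/

/-- `v` is in the interior of the piece with root `l`. -/
def InPiece (G : SimpleGraph V) : Bool → V → V → V → Prop
  | false, l, o, v => ∃ e₁ e₂ b c, Leaf2 G l o e₁ e₂ b c ∧ (v = e₁ ∨ v = b)
  | true, l, o, v => ∃ e₁ e₂ x w z y, Leaf3 G l o e₁ e₂ x w z y ∧ (v = e₁ ∨ v = x)

theorem InPiece.interior {k : Bool} {l o v : V} (h : InPiece G k l o v) : Interior G v := by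
  cases k
  · obtain ⟨e₁, e₂, b, c, h⟩ := h
    exact Or.inl ⟨_, _, _, _, _, _, h⟩
  · obtain ⟨e₁, e₂, x, w, z, y, h⟩ := h
    exact Or.inr ⟨_, _, _, _, _, _, _, _, h⟩

theorem InPiece.nbr {k : Bool} {l o v u : V} (h : InPiece G k l o v) (hu : G.Adj v u) :
    InPiece G k l o u ∨ u = l := by
  cases k
  · obtain ⟨e₁, e₂, b, c, h, rfl | rfl⟩ := h
    · rcases h.n₁.mem hu with rfl | rfl | rfl
      exacts [Or.inr rfl, Or.inl ⟨_, _, _, _, h, Or.inr rfl⟩,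
        Or.inl ⟨_, _, _, _, h.symm_b, Or.inr rfl⟩]
    · rcases h.nb.mem hu with rfl | rfl | rfl
      exacts [Or.inl ⟨_, _, _, _, h.symm_b, Or.inr rfl⟩, Or.inl ⟨_, _, _, _, h, Or.inl rfl⟩,
        Or.inl ⟨_, _, _, _, h.symm_e, Or.inl rfl⟩]
  · obtain ⟨e₁, e₂, x, w, z, y, h, rfl | rfl⟩ := h
    · rcases h.n₁.mem hu with rfl | rfl | rfl
      exacts [Or.inr rfl, Or.inl ⟨_, _, _, _, _, _, h, Or.inr rfl⟩,
        Or.inl ⟨_, _, _, _, _, _, h.symm_x, Or.inr rfl⟩]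
    · rcases h.nx.mem hu with rfl | rfl | rfl
      exacts [Or.inl ⟨_, _, _, _, _, _, h, Or.inl rfl⟩,
        Or.inl ⟨_, _, _, _, _, _, h.symm_e, Or.inr rfl⟩,
        Or.inl ⟨_, _, _, _, _, _, h.symm_e.symm_x, Or.inr rfl⟩]

theorem Leaf.inPiece {k : Bool} {l o x : V} (h : Leaf G k l o) (hx : G.Adj l x) (hne : x ≠ o) :
    InPiece G k l o x := by
  cases k
  · obtain ⟨e₁, e₂, b, c, h⟩ := h
    rcases h.nl.mem hx with rfl | rfl | rfl
    exacts [absurd rfl hne, ⟨_, _, _, _, h, Or.inl rfl⟩, ⟨_, _, _, _, h.symm_e, Or.inl rfl⟩]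
  · obtain ⟨e₁, e₂, x, w, z, y, h⟩ := h
    rcases h.nl.mem hx with rfl | rfl | rfl
    exacts [absurd rfl hne, ⟨_, _, _, _, _, _, h, Or.inl rfl⟩,
      ⟨_, _, _, _, _, _, h.symm_e, Or.inl rfl⟩]

/-- `x` belongs to the branch of height `h` with root `p` and outer neighbor `o`. -/
def Desc (G : SimpleGraph V) (k : Bool) : ℕ → V → V → V → Prop
  | 0, p, o, x => x = p ∨ InPiece G k p o x
  | h + 1, p, o, x => x = p ∨ ∃ q, q ≠ o ∧ G.Adj p q ∧ Branch G k h q p ∧ Desc G k h q p x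

theorem Desc.root {k : Bool} {h : ℕ} {p o : V} : Desc G k h p o p := by
  cases h <;> exact Or.inl rfl

theorem Desc.nbr {k : Bool} {h : ℕ} {p o x u : V} (hb : Branch G k h p o)
    (hx : Desc G k h p o x) (hu : G.Adj x u) : Desc G k h p o u ∨ u = o := by
  -- The induction has to record that one leaves a branch only through its root; leaving a child
  -- branch then means arriving at `p`.
  have key : Desc G k h p o u ∨ (x = p ∧ u = o) := by
    induction h generalizing p o with
    | zero =>
      rcases hx with rfl | hx
      · by_cases e : u = o
        · exact Or.inr ⟨rfl, e⟩
        · exact Or.inl (Or.inr (Leaf.inPiece hb hu e))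
      · rcases hx.nbr hu with h | h
        exacts [Or.inl (Or.inr h), Or.inl (Or.inl h)]
    | succ h ih =>
      rcases hx with rfl | ⟨q, hq, hpq, hbq, hx⟩
      · by_cases e : u = o
        · exact Or.inr ⟨rfl, e⟩
        · obtain ⟨p₁, p₂, h1, h2, h3⟩ := hb
          have : Branch G k h u x := by
            rcases h1.mem hu with rfl | rfl | rfl
            exacts [absurd rfl e, h2, h3]
          exact Or.inl (Or.inr ⟨u, e, hu, this, Desc.root⟩)
      · rcases ih hbq hx with h | ⟨-, h⟩
        exacts [Or.inl (Or.inr ⟨q, hq, hpq, hbq, h⟩), Or.inl (Or.inl h)]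
  exact key.imp_right And.right

theorem Branch.exists_leaf {k : Bool} {h : ℕ} {p o : V} (hb : Branch G k h p o) :
    ∃ l o, Leaf G k l o := by
  induction h generalizing p o with
  | zero => exact ⟨_, _, hb⟩
  | succ h ih =>
    obtain ⟨p₁, p₂, -, h1, -⟩ := hb
    exact ih h1

theorem Branch.outer_unique {k k' : Bool} {h h' : ℕ} {p o o' : V}
    (hno : ∀ k h o, ¬ Center G k h o) (hb : Branch G k h p o) (hb' : Branch G k' h' p o') :
    o = o' := by
  obtain ⟨rfl, rfl⟩ := hb.height_unique hb'
  by_contra hne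
  obtain ⟨h', hc⟩ := hb.center hb' hne
  exact hno _ _ _ hc

/-- Without centers, each vertex has at most one upward direction, so the chain from `u 0` inside
the branch must reach its root after `h` steps. -/
theorem Desc.climb (hno : ∀ k h o, ¬ Center G k h o) {k : Bool} {u : ℕ → V}
    (hu : ∀ i, Branch G k i (u i) (u (i + 1))) {h : ℕ} {p o : V} (hb : Branch G k h p o)
    (hd : Desc G k h p o (u 0)) : u h = p ∧ u (h + 1) = o := by
  have main : u h = p := by
    induction h generalizing p o with
    | zero =>
      rcases hd with e | hd
      · exact e
      · exact absurd hd.interior (hu 0).not_interior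
    | succ h ih =>
      rcases hd with e | ⟨q, hq, hpq, hbq, hd⟩
      · have := ((hu 0).height_unique (e ▸ hb)).2
        omega
      · have e := ih hbq hd
        exact (hu h).outer_unique hno (e ▸ hbq)
  exact ⟨main, (main ▸ hu h).outer_unique hno hb⟩

theorem Desc.two_way (hno : ∀ k h o, ¬ Center G k h o) {k k₁ k₂ : Bool} {h h₁ h₂ : ℕ}
    {p o x y : V} (hb : Branch G k h p o) (hd : Desc G k h p o x) (hxy : Branch G k₁ h₁ x y)
    (hyx : Branch G k₂ h₂ y x) : x = p ∧ y = o := by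
  have main : x = p := by
    induction h generalizing p o with
    | zero =>
      rcases hd with e | hd
      · exact e
      · exact absurd hd.interior hxy.not_interior
    | succ h ih =>
      rcases hd with e | ⟨q, hq, hpq, hbq, hd⟩
      · exact e
      · have e := ih hbq hd
        subst e
        have e := hxy.outer_unique hno hbq
        subst e
        exact absurd (hyx.outer_unique hno hb) hq
  subst main
  exact ⟨rfl, hxy.outer_unique hno hb⟩

/-- Color the ray white and the siblings `w i` black. By connectedness `φ (v 0)` lies below some `v
n`, and climbing from there shows that `φ` fixes the ray from `v n` on. Going down, the colors
distinguish each `v i` from its sibling `w i`. -/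
theorem Stubborn.false_of_ray (hG : Stubborn G) (hno : ∀ k h o, ¬ Center G k h o) {k : Bool}
    {v : ℕ → V} (hv : ∀ i, Branch G k i (v i) (v (i + 1))) : False := by
  have hw : ∀ i, ∃ w, Nb G (v (i + 1)) (v (i + 2)) (v i) w ∧ Branch G k i w (v (i + 1)) := by
    intro i
    obtain ⟨p₁, p₂, h1, h2, h3⟩ := hv (i + 1)
    rcases h1.mem (hv i).adj.symm with e | e | e
    · refine absurd ?_ (hno k i (v (i + 1)))
      intro x hx
      rcases h1.mem hx with rfl | rfl | rfl
      exacts [by rw [show i + 1 + 1 = i + 2 from rfl, ← e]; exact hv i, h2, h3]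
    · exact ⟨p₂, e ▸ h1, h3⟩
    · exact ⟨p₁, (e ▸ h1).swap, h2⟩
  choose w hn hw using hw
  have hne : ∀ i j, v i ≠ w j := by
    intro i j e
    obtain rfl := ((hv i).height_unique (e ▸ hw j)).2
    exact (hn i).2.2.1 e
  refine hG.not_dist (TwoDist.of_marker hG.conn hG.cubic (Set.range v ∪ Set.range w) (Set.range w)
    ⟨v 0, Or.inl ⟨0, rfl⟩⟩ Set.subset_union_right ?_ ?_)
  · rintro _ (⟨i, rfl⟩ | ⟨i, rfl⟩)
    · exact ⟨_, Or.inl ⟨i + 1, rfl⟩, (hv i).adj⟩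
    · exact ⟨_, Or.inl ⟨i + 1, rfl⟩, (hw i).adj⟩
  · intro Q hQ _ φ hφ
    have hwQ : ∀ i, w i ∈ Q := fun i => (hQ _ (Or.inr ⟨i, rfl⟩)).2 ⟨i, rfl⟩
    have hvQ : ∀ i, v i ∉ Q := fun i h => by
      obtain ⟨j, e⟩ := (hQ _ (Or.inl ⟨i, rfl⟩)).1 h
      exact hne i j e.symm
    obtain ⟨n, hn0⟩ := hG.conn.induct_adj (p := fun x => ∃ n, Desc G k n (v n) (v (n + 1)) x)
      (v := v 0) ⟨0, Desc.root⟩ (by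
        rintro x y ⟨n, hd⟩ hxy
        rcases hd.nbr (hv n) hxy with h | rfl
        exacts [⟨n, h⟩, ⟨n + 1, Desc.root⟩]) (φ (v 0))
    obtain ⟨e1, e2⟩ := hn0.climb hno (u := fun i => φ (v i)) (fun i => (hv i).map φ) (hv n)
    have hdown : ∀ i, φ (v (i + 1)) = v (i + 1) → φ (v (i + 2)) = v (i + 2) →
        φ (v i) = v i ∧ φ (w i) = w i := by
      intro i h1 h2
      have h3 := (hn i).map φ
      rw [h1, h2] at h3
      rcases (hn i).rot.pair h3.rot with h | h
      · exact h
      · exact absurd ((hφ _).2 (hwQ i)) (h.2 ▸ hvQ i)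
    have hup : ∀ i, φ (v (n + i)) = v (n + i) := by
      intro i
      induction i with
      | zero => exact e1
      | succ i ih =>
        have := (hv (n + i)).map φ
        rw [ih] at this
        exact this.outer_unique hno (hv (n + i))
    have hall : ∀ i, φ (v i) = v i := by
      have : ∀ d i, n ≤ i + d → φ (v i) = v i := by
        intro d
        induction d with
        | zero =>
          intro i hi
          obtain ⟨j, rfl⟩ := Nat.exists_eq_add_of_le hi
          exact hup j
        | succ d ih => exact fun i hi => (hdown i (ih _ (by omega)) (ih _ (by omega))).1
      exact fun i => this n i (by omega)
    rintro _ (⟨i, rfl⟩ | ⟨i, rfl⟩)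
    exacts [hall i, (hdown i (hall _) (hall _)).2]

/-- The two facing branches exhaust the graph, and their edge is the only one with branches in both
directions. So it is preserved, and coloring its ends differently suffices. -/
theorem Stubborn.false_of_two_way (hG : Stubborn G) (hno : ∀ k h o, ¬ Center G k h o)
    {k k' : Bool} {h h' : ℕ} {p a : V} (hb : Branch G k h p a) (hb' : Branch G k' h' a p) :
    False := by
  refine hG.not_dist (TwoDist.of_marker hG.conn hG.cubic {p, a} {p} ⟨p, by simp⟩ (by simp) ?_ ?_)
  · rintro _ (rfl | rfl)
    · exact ⟨a, by simp, hb.adj⟩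
    · exact ⟨p, by simp, hb'.adj⟩
  · intro Q hQ _ φ hφ
    have hp : p ∈ Q := (hQ p (by simp)).2 rfl
    have ha : a ∉ Q := fun h => hb'.adj.ne ((hQ a (by simp)).1 h)
    have hall := hG.conn.induct_adj (p := fun x => Desc G k h p a x ∨ Desc G k' h' a p x)
      (v := p) (Or.inl Desc.root) (by
        rintro x y (hd | hd) hxy
        · rcases hd.nbr hb hxy with h | rfl
          exacts [Or.inl h, Or.inr Desc.root]
        · rcases hd.nbr hb' hxy with h | rfl
          exacts [Or.inr h, Or.inl Desc.root]) (φ p)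
    rcases hall with hd | hd
    · have := hd.two_way hno hb (hb.map φ) (hb'.map φ)
      rintro _ (rfl | rfl)
      exacts [this.1, this.2]
    · have := hd.two_way hno hb' (hb.map φ) (hb'.map φ)
      exact absurd (this.1 ▸ (hφ p).2 hp) ha

/-- The marker is `a` with its neighbors, all black. Since `a` is not interior and not a root,
`Stubborn.core_subset` recognizes it. -/
theorem Stubborn.false_of_rigid (hG : Stubborn G) {a : V} (hint : ¬ Interior G a)
    (hleaf : ∀ k o, ¬ Leaf G k a o)
    (hfix : ∀ φ : G ≃g G, φ a = a → ∀ x, G.Adj a x → φ x = x) : False := by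
  obtain ⟨x, hx⟩ : ∃ x, G.Adj a x := by
    obtain ⟨x, y, z, h⟩ := hG.cubic a
    exact ⟨x, h.adj₁⟩
  have hm : ∀ {z}, z ∈ closedNbhd G {a} ↔ z = a ∨ G.Adj a z := by simp [closedNbhd]
  refine hG.not_dist (TwoDist.of_marker hG.conn hG.cubic (closedNbhd G {a}) (closedNbhd G {a})
    ⟨a, Or.inl rfl⟩ subset_rfl
    (fun u hu => exists_mem_closedNbhd hu (by rintro _ rfl; exact ⟨x, hx⟩)) ?_)
  intro Q hQ hTr φ hφ
  have hcl : ∀ z, z = a ∨ G.Adj a z → z ∈ Q := fun z hz => (hQ z (hm.2 hz)).2 (hm.2 hz)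
  have ha : φ a = a := by
    refine (hG.core_subset (Y := {a}) (E := ∅) Set.subsingleton_empty (by simp) hTr ?_ ?_ ?_
      ((hφ a).2 (hcl a (Or.inl rfl))) ?_).resolve_right (Set.notMem_empty _)
    · intro z hz hzi
      rcases hm.1 hz with rfl | hz
      · exact hint hzi
      · rcases hzi.nbr hz.symm with h | ⟨k, o, h, -⟩
        exacts [hint h, hleaf k o h]
    · rintro _ _ _ rfl _ rfl _ _
      rfl
    · intro y hy z hz hya hza hyz
      have hy' := (hm.1 hy).resolve_left hya
      have hz' := (hm.1 hz).resolve_left hza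
      exact hint (hG.int_of_triangle hy' hz' hyz)
    · intro z hz
      obtain ⟨y, rfl⟩ := φ.surjective z
      exact (hφ y).2 (hcl y (Or.inr (φ.map_adj_iff.1 hz)))
  intro z hz
  rcases hm.1 hz with rfl | hz
  exacts [ha, hfix φ ha z hz]

theorem Stubborn.exists_center (hG : Stubborn G) {k : Bool} {l o : V} (hl : Leaf G k l o) :
    ∃ k h o, Center G k h o := by
  by_contra! hno
  by_cases hcont : ∀ h p o, Branch G k h p o → ∃ o', Branch G k (h + 1) o o'
  · let T := fun n : ℕ => {q : V × V // Branch G k n q.1 q.2}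
    have hstep : ∀ n (t : T n), ∃ q : T (n + 1), q.1.1 = t.1.2 := by
      rintro n ⟨⟨p, o⟩, t⟩
      obtain ⟨o', h⟩ := hcont n p o t
      exact ⟨⟨(o, o'), h⟩, rfl⟩
    choose f hf using hstep
    let P : ∀ n, T n := fun n => Nat.rec ⟨(l, o), hl⟩ (fun n t => f n t) n
    refine hG.false_of_ray hno (k := k) (v := fun n => (P n).1.1) fun i => ?_
    have : (P (i + 1)).1.1 = (P i).1.2 := hf i (P i)
    rw [this]
    exact (P i).2
  push Not at hcont
  obtain ⟨h, p, a, hb, htop⟩ := hcont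
  have hback : ∀ k' h', ¬ Branch G k' h' a p := fun k' h' hb' => hG.false_of_two_way hno hb hb'
  obtain ⟨y, z, hn⟩ := hG.cubic.nb₁ hb.adj.symm
  have hfixp : ∀ φ : G ≃g G, φ a = a → φ p = p := by
    intro φ ha
    have hb' := hb.map φ
    rw [ha] at hb'
    rcases hn.mem hb'.adj.symm with e | e | e
    · exact e
    · exact absurd ⟨p, y, hn.rot.rot, hb, e ▸ hb'⟩ (htop z)
    · exact absurd ⟨p, z, hn.rot.swap, hb, e ▸ hb'⟩ (htop y)
  have hint : ¬ Interior G a := by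
    intro hi
    rcases hi.nbr hb.adj.symm with h | ⟨k'', o, h, hne⟩
    · exact hb.not_interior h
    · exact hne (hb.outer_unique hno (h' := 0) h)
  have hleaf : ∀ k o, ¬ Leaf G k a o := by
    intro k' o hl
    by_cases e : p = o
    · exact hback k' 0 (e ▸ hl)
    · exact hb.not_interior (hl.int_nbr hb.adj.symm e)
  have hcases : ∀ φ : G ≃g G, φ a = a → (φ y = y ∧ φ z = z) ∨ (φ y = z ∧ φ z = y) := by
    intro φ ha
    have h1 := hn.map φ
    rw [ha, hfixp φ ha] at h1
    exact hn.rot.pair h1.rot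
  by_cases hrig : ∀ φ : G ≃g G, φ a = a → φ y = y ∧ φ z = z
  · refine hG.false_of_rigid hint hleaf fun φ ha x hx => ?_
    rcases hn.mem hx with rfl | rfl | rfl
    exacts [hfixp φ ha, (hrig φ ha).1, (hrig φ ha).2]
  · push Not at hrig
    obtain ⟨τ, hτa, hτ⟩ := hrig
    have hτ' : τ y = z := by
      rcases hcases τ hτa with e | e
      exacts [absurd e.2 (hτ e.1), e.1]
    -- The stabilizer of `a` fixes `p` and interchanges `y` and `z`, so a trail from `a` through `y`
    -- gives equal branches at `y` and `z`. Together they form a branch at `a` facing the one at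
    -- `p`.
    have hS : Start G a p y z := by
      refine ⟨hG, hn, ?_, fun φ ha => ?_, hint, hleaf⟩
      · intro φ ha hy x hx
        have hz : φ z = z := by
          rcases hcases φ ha with e | e
          exacts [e.2, absurd (hy.symm.trans e.1) hn.2.2.1]
        rcases hn.mem hx with rfl | rfl | rfl
        exacts [hfixp φ ha, hy, hz]
      · rcases hcases φ ha with e | e
        exacts [Or.inl e.1, Or.inr (Or.inl e.1)]
    obtain ⟨k', h', hy⟩ := hS.exists_branch
    have hz := hy.map τ
    rw [hτ', hτa] at hz
    exact hback k' (h' + 1) ⟨y, z, hn, hy, hz⟩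


/-! ### Neighborhoods in the graphs of the two families -/

namespace TreeNode

/-- The parent of a vertex (the root is its own parent). -/
def parent : TreeNode → TreeNode
  | root => root
  | node _ [] => root
  | node i (_ :: l) => node i l

theorem isChild_iff {s t : TreeNode} : IsChild s t ↔ t ≠ root ∧ s = t.parent := by
  constructor
  · rintro (_ | _)
    · exact ⟨by simp, rfl⟩
    · exact ⟨by simp, rfl⟩
  · rintro ⟨h1, rfl⟩
    rcases t with _ | ⟨i, _ | ⟨b, l⟩⟩
    exacts [absurd rfl h1, .root i, .node i l b]

theorem eq_parent_iff {i : Fin 3} {l : List Bool} {t : TreeNode} :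
    (t ≠ root ∧ node i l = t.parent) ↔ t = node i (false :: l) ∨ t = node i (true :: l) := by
  rcases t with _ | ⟨j, _ | ⟨b, l'⟩⟩
  · simp
  · simp [parent]
  · cases b <;> simp [parent, eq_comm]

theorem root_eq_parent_iff {t : TreeNode} :
    (t ≠ root ∧ root = t.parent) ↔ t = node 0 [] ∨ t = node 1 [] ∨ t = node 2 [] := by
  rcases t with _ | ⟨j, _ | ⟨b, l'⟩⟩
  · simp
  · fin_cases j <;> simp [parent]
  · simp [parent]

theorem ne_parent {t : TreeNode} (h : t ≠ root) : t ≠ t.parent := by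
  rcases t with _ | ⟨i, _ | ⟨b, l⟩⟩
  · exact absurd rfl h
  · simp [parent]
  · simp [parent]

theorem depth_parent_le (t : TreeNode) : t.parent.depth ≤ t.depth := by
  rcases t with _ | ⟨i, _ | ⟨b, l⟩⟩ <;> simp [parent, depth]

end TreeNode

section Gadgets

variable {n : ℕ} {I : Type} {H : SimpleGraph I} {Nu Nv : Set I}

theorem addGadgets_adj_inl {s t : TVertex n} :
    (addGadgets n H Nu Nv).Adj (.inl s) (.inl t) ↔
      (t.1 ≠ .root ∧ s.1 = t.1.parent) ∨ (s.1 ≠ .root ∧ t.1 = s.1.parent) := by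
  have key : (treeT n).Adj s t ↔
      (t.1 ≠ .root ∧ s.1 = t.1.parent) ∨ (s.1 ≠ .root ∧ t.1 = s.1.parent) := by
    simp only [treeT, SimpleGraph.fromRel_adj, TreeNode.isChild_iff]
    constructor
    · exact fun h => h.2
    · refine fun h => ⟨?_, h⟩
      rintro rfl
      rcases h with h | h <;> exact TreeNode.ne_parent h.1 h.2
  simp only [addGadgets, SimpleGraph.fromRel_adj, ← key, (treeT n).adj_comm t s, or_self, ne_eq,
    Sum.inl.injEq, and_iff_right_iff_imp]
  exact fun h => h.ne

theorem addGadgets_adj_inl_inr {s : TVertex n} {q : LeafPair n} {a : I} :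
    (addGadgets n H Nu Nv).Adj (.inl s) (.inr (q, a)) ↔
      (s = q.u ∧ a ∈ Nu) ∨ (s = q.v ∧ a ∈ Nv) := by
  simp [addGadgets, SimpleGraph.fromRel_adj]

theorem addGadgets_adj_inr_inl {s : TVertex n} {q : LeafPair n} {a : I} :
    (addGadgets n H Nu Nv).Adj (.inr (q, a)) (.inl s) ↔
      (s = q.u ∧ a ∈ Nu) ∨ (s = q.v ∧ a ∈ Nv) := by
  rw [SimpleGraph.adj_comm, addGadgets_adj_inl_inr]

theorem addGadgets_adj_inr {q q' : LeafPair n} {a b : I} :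
    (addGadgets n H Nu Nv).Adj (.inr (q, a)) (.inr (q', b)) ↔ q = q' ∧ H.Adj a b := by
  simp only [addGadgets, SimpleGraph.fromRel_adj, H.adj_comm b a, eq_comm (a := q'), or_self, ne_eq,
    Sum.inr.injEq, Prod.mk.injEq, not_and, and_iff_right_iff_imp]
  exact fun h _ => h.2.ne

theorem LeafPair.u_val (q : LeafPair n) : q.u.1 = .node q.1 (false :: q.2.1) := rfl

theorem LeafPair.v_val (q : LeafPair n) : q.v.1 = .node q.1 (true :: q.2.1) := rfl

theorem LeafPair.u_inj {q q' : LeafPair n} : q.u = q'.u ↔ q = q' := by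
  obtain ⟨i, l, h⟩ := q
  obtain ⟨i', l', h'⟩ := q'
  simp [Subtype.ext_iff, LeafPair.u_val]

theorem LeafPair.v_inj {q q' : LeafPair n} : q.v = q'.v ↔ q = q' := by
  obtain ⟨i, l, h⟩ := q
  obtain ⟨i', l', h'⟩ := q'
  simp [Subtype.ext_iff, LeafPair.v_val]

theorem LeafPair.u_ne_v {q q' : LeafPair n} : q.u ≠ q'.v := by
  simp [Subtype.ext_iff, LeafPair.u_val, LeafPair.v_val]

/-- The parent of the leaves of a sibling pair. -/
def LeafPair.base (q : LeafPair n) : TVertex n :=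
  ⟨.node q.1 q.2.1, by have := q.2.2; simp [TreeNode.depth]; omega⟩

end Gadgets

theorem nb_root {h : ℕ} {I : Type} {H : SimpleGraph I} {Nu Nv : Set I} :
    Nb (addGadgets (h + 2) H Nu Nv) (.inl ⟨.root, Nat.zero_le _⟩)
      (.inl ⟨.node 0 [], by simp [TreeNode.depth]⟩) (.inl ⟨.node 1 [], by simp [TreeNode.depth]⟩)
      (.inl ⟨.node 2 [], by simp [TreeNode.depth]⟩) := by
  refine ⟨by simp, by simp, by simp, ?_⟩
  rintro (⟨t, ht⟩ | ⟨q, a⟩)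
  · simp only [addGadgets_adj_inl, TreeNode.root_eq_parent_iff]
    simp
  · simp [addGadgets_adj_inl_inr, Subtype.ext_iff, LeafPair.u_val, LeafPair.v_val]

theorem nb_node {h : ℕ} {I : Type} {H : SimpleGraph I} {Nu Nv : Set I} {i : Fin 3} {l : List Bool}
    (hl : l.length ≤ h) :
    Nb (addGadgets (h + 2) H Nu Nv) (.inl ⟨.node i l, by simp [TreeNode.depth]; omega⟩)
      (.inl ⟨(TreeNode.node i l).parent,
        (TreeNode.depth_parent_le _).trans (by simp [TreeNode.depth]; omega)⟩)
      (.inl ⟨.node i (false :: l), by simp [TreeNode.depth]; omega⟩)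
      (.inl ⟨.node i (true :: l), by simp [TreeNode.depth]; omega⟩) := by
  have hp : ∀ b, (TreeNode.node i l).parent ≠ .node i (b :: l) := by
    intro b e
    have := TreeNode.depth_parent_le (.node i l)
    rw [e] at this
    simp [TreeNode.depth] at this
  refine ⟨by simpa using hp false, by simpa using hp true, by simp, ?_⟩
  rintro (⟨t, ht⟩ | ⟨q, a⟩)
  · simp only [addGadgets_adj_inl, TreeNode.eq_parent_iff]
    simp only [ne_eq, reduceCtorEq, not_false_eq_true, true_and, Sum.inl.injEq, Subtype.mk.injEq]
    tauto
  · have h1 : ∀ b, l ≠ b :: q.2.1 := by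
      rintro b rfl
      have := q.2.2
      simp at hl
      omega
    simp [addGadgets_adj_inl_inr, Subtype.ext_iff, LeafPair.u_val, LeafPair.v_val, h1]

theorem nb_u {n : ℕ} {I : Type} {H : SimpleGraph I} {Nv : Set I} {a₁ a₂ : I}
    (hne : a₁ ≠ a₂) (q : LeafPair n) :
    Nb (addGadgets n H {a₁, a₂} Nv) (.inl q.u) (.inl q.base) (.inr (q, a₁)) (.inr (q, a₂)) := by
  refine ⟨by simp, by simp, by simp [hne], ?_⟩
  rintro (⟨t, ht⟩ | ⟨q', a⟩)
  · simp only [addGadgets_adj_inl, LeafPair.u_val, TreeNode.eq_parent_iff]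
    have h1 : ∀ b, t ≠ .node q.1 (b :: false :: q.2.1) := by
      rintro b rfl
      have := q.2.2
      simp [TreeNode.depth] at ht
      omega
    simp [h1, LeafPair.base, TreeNode.parent]
  · simp only [addGadgets_adj_inl_inr, LeafPair.u_inj, LeafPair.u_ne_v]
    simp
    grind

theorem nb_v {n : ℕ} {I : Type} {H : SimpleGraph I} {Nu : Set I} {a₁ a₂ : I}
    (hne : a₁ ≠ a₂) (q : LeafPair n) :
    Nb (addGadgets n H Nu {a₁, a₂}) (.inl q.v) (.inl q.base) (.inr (q, a₁)) (.inr (q, a₂)) := by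
  refine ⟨by simp, by simp, by simp [hne], ?_⟩
  rintro (⟨t, ht⟩ | ⟨q', a⟩)
  · simp only [addGadgets_adj_inl, LeafPair.v_val, TreeNode.eq_parent_iff]
    have h1 : ∀ b, t ≠ .node q.1 (b :: true :: q.2.1) := by
      rintro b rfl
      have := q.2.2
      simp [TreeNode.depth] at ht
      omega
    simp [h1, LeafPair.base, TreeNode.parent]
  · simp only [addGadgets_adj_inl_inr, LeafPair.v_inj, LeafPair.u_ne_v.symm]
    simp
    grind

/-! ### Unfolding a graph from a center -/

/-- A map between cubic graphs that is bijective on neighborhoods is an isomorphism if one of its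
fibers is a singleton. -/
theorem exists_iso_of_covering {W : Type*} {M : SimpleGraph W} (hconn : G.Connected) (f : W → V)
    (r : W) (hM : ∀ P : W → Prop, P r → (∀ s t, P s → M.Adj s t → P t) → ∀ s, P s)
    (hN : ∀ s, ∃ t₁ t₂ t₃, Nb M s t₁ t₂ t₃ ∧ Nb G (f s) (f t₁) (f t₂) (f t₃))
    (hr : ∀ t, f t = f r → t = r) : ∃ Ψ : M ≃g G, ∀ s, Ψ s = f s := by
  have hom : ∀ {s t}, M.Adj s t → G.Adj (f s) (f t) := by
    intro s t h
    obtain ⟨t₁, t₂, t₃, h1, h2⟩ := hN s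
    rcases h1.mem h with rfl | rfl | rfl
    exacts [h2.adj₁, h2.adj₂, h2.adj₃]
  have hinj : ∀ {s t t'}, M.Adj s t → M.Adj s t' → f t = f t' → t = t' := by
    intro s t t' h h' e
    obtain ⟨t₁, t₂, t₃, h1, h2⟩ := hN s
    rcases h1.mem h with rfl | rfl | rfl <;> rcases h1.mem h' with rfl | rfl | rfl
    exacts [rfl, absurd e h2.1, absurd e h2.2.1, absurd e.symm h2.1, rfl, absurd e h2.2.2.1,
      absurd e.symm h2.2.1, absurd e.symm h2.2.2.1, rfl]
  have hsurj : ∀ {s y}, G.Adj (f s) y → ∃ t, M.Adj s t ∧ f t = y := by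
    intro s y h
    obtain ⟨t₁, t₂, t₃, h1, h2⟩ := hN s
    rcases h2.mem h with rfl | rfl | rfl
    exacts [⟨_, h1.adj₁, rfl⟩, ⟨_, h1.adj₂, rfl⟩, ⟨_, h1.adj₃, rfl⟩]
  -- Having a singleton fiber passes along edges: another point over `f s'` would have a neighbor
  -- over `f s`, which must be `s`, and local injectivity at `s` applies.
  have inj : Function.Injective f := by
    have := hM (fun s => ∀ t, f t = f s → t = s) hr (by
      intro s s' hs hss t ht
      have h1 : G.Adj (f t) (f s) := ht ▸ (hom hss).symm
      obtain ⟨t', h2, h3⟩ := hsurj h1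
      rw [hs t' h3] at h2
      exact hinj h2.symm hss ht)
    exact fun s t e => this t s e
  have surj : Function.Surjective f := by
    refine hconn.induct_adj (p := fun y => ∃ s, f s = y) (v := f r) ⟨r, rfl⟩ ?_
    rintro _ y ⟨s, rfl⟩ h
    obtain ⟨t, -, h⟩ := hsurj h
    exact ⟨t, h⟩
  refine ⟨⟨Equiv.ofBijective f ⟨inj, surj⟩, ?_⟩, fun s => rfl⟩
  intro s t
  refine ⟨fun h => ?_, hom⟩
  obtain ⟨t', h1, h2⟩ := hsurj (s := s) h
  exact inj h2 ▸ h1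

theorem addGadgets_induction {n : ℕ} {I : Type} {H : SimpleGraph I} {Nu Nv : Set I}
    (hI : ∀ a, a ∈ Nu ∨ a ∈ Nv) {P : TVertex n ⊕ (LeafPair n × I) → Prop}
    (h0 : P (.inl ⟨.root, Nat.zero_le _⟩))
    (hP : ∀ s t, P s → (addGadgets n H Nu Nv).Adj s t → P t) (s) : P s := by
  have hT : ∀ t : TVertex n, P (.inl t) := by
    rintro ⟨t, ht⟩
    cases t with
    | root => exact h0
    | node i l =>
      induction l with
      | nil => exact hP _ _ h0 (addGadgets_adj_inl.2 (Or.inl ⟨by simp, rfl⟩))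
      | cons b l ih =>
        refine hP (.inl ⟨.node i l, ?_⟩) _ (ih _) (addGadgets_adj_inl.2 (Or.inl ⟨by simp, rfl⟩))
        simp [TreeNode.depth] at ht ⊢
        omega
  rcases s with t | ⟨q, a⟩
  · exact hT t
  · rcases hI a with h | h
    · exact hP _ _ (hT q.u) (addGadgets_adj_inl_inr.2 (Or.inl ⟨rfl, h⟩))
    · exact hP _ _ (hT q.v) (addGadgets_adj_inl_inr.2 (Or.inr ⟨rfl, h⟩))


theorem exists_iso_of_tree {h : ℕ} {I : Type} {H : SimpleGraph I} {a₁ a₂ a₃ a₄ : I}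
    (hconn : G.Connected) (h₁ : a₁ ≠ a₂) (h₂ : a₃ ≠ a₄)
    (hI : ∀ a, a ∈ ({a₁, a₂} : Set I) ∨ a ∈ ({a₃, a₄} : Set I))
    (f : TVertex (h + 2) ⊕ (LeafPair (h + 2) × I) → V) (val : TreeNode → V)
    (hval : ∀ t, f (.inl t) = val t.1)
    (hroot : Nb G (val .root) (val (.node 0 [])) (val (.node 1 [])) (val (.node 2 [])))
    (hnode : ∀ i l, l.length ≤ h → Nb G (val (.node i l)) (val (TreeNode.node i l).parent)
      (val (.node i (false :: l))) (val (.node i (true :: l))))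
    (hu : ∀ q : LeafPair (h + 2), Nb G (val q.u.1) (val q.base.1) (f (.inr (q, a₁)))
      (f (.inr (q, a₂))))
    (hv : ∀ q : LeafPair (h + 2), Nb G (val q.v.1) (val q.base.1) (f (.inr (q, a₃)))
      (f (.inr (q, a₄))))
    (hg : ∀ q a, ∃ t₁ t₂ t₃, Nb (addGadgets (h + 2) H {a₁, a₂} {a₃, a₄}) (.inr (q, a)) t₁ t₂ t₃ ∧
      Nb G (f (.inr (q, a))) (f t₁) (f t₂) (f t₃))
    (hfib : ∀ t, f t = val .root → t = .inl ⟨.root, Nat.zero_le _⟩) :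
    ∃ Ψ : addGadgets (h + 2) H {a₁, a₂} {a₃, a₄} ≃g G, ∀ s, Ψ s = f s := by
  refine exists_iso_of_covering hconn f (.inl ⟨.root, Nat.zero_le _⟩)
    (fun P => addGadgets_induction hI) ?_ (by rwa [hval])
  rintro (⟨t, ht⟩ | ⟨q, a⟩)
  · rcases t with _ | ⟨i, l⟩
    · exact ⟨_, _, _, nb_root, by simpa only [hval] using hroot⟩
    · by_cases hl : l.length ≤ h
      · exact ⟨_, _, _, nb_node hl, by simpa only [hval] using hnode i l hl⟩
      · rcases l with _ | ⟨b, l⟩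
        · simp at hl
        · have hl' : l.length + 2 = h + 2 := by
            simp [TreeNode.depth] at ht hl
            omega
          cases b
          · exact ⟨_, _, _, nb_u h₁ (i, ⟨l, hl'⟩), by
              simp only [hval]; exact hu (i, ⟨l, hl'⟩)⟩
          · exact ⟨_, _, _, nb_v h₂ (i, ⟨l, hl'⟩), by
              simp only [hval]; exact hv (i, ⟨l, hl'⟩)⟩
  · exact hg q a

/-- The vertex reached from `x`, coming from `o`, by the choices in `l` (the last choice first),
and its predecessor. -/
def follow (ch : V → V → Bool → V) (o x : V) : List Bool → V × V
  | [] => (x, o)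
  | b :: l => (ch (follow ch o x l).1 (follow ch o x l).2 b, (follow ch o x l).1)

/-- The image of the tree under a choice of children. -/
def treeMap (ch : V → V → Bool → V) (o : V) (p : Fin 3 → V) : TreeNode → V
  | .root => o
  | .node i l => (follow ch o (p i) l).1

theorem follow_snd (ch : V → V → Bool → V) (o : V) (p : Fin 3 → V) (i : Fin 3) (l : List Bool) :
    (follow ch o (p i) l).2 = treeMap ch o p (TreeNode.node i l).parent := by
  cases l <;> rfl

theorem Cubic.exists_children (hc : Cubic G) :
    ∃ ch : V → V → Bool → V, ∀ x y, G.Adj x y → Nb G x y (ch x y false) (ch x y true) := by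
  have : ∀ x y, ∃ c : Bool → V, G.Adj x y → Nb G x y (c false) (c true) := by
    intro x y
    by_cases h : G.Adj x y
    · obtain ⟨b, c, hn⟩ := hc.nb₁ h
      exact ⟨fun e => cond e c b, fun _ => hn⟩
    · exact ⟨fun _ => x, fun h' => absurd h' h⟩
  choose ch hch using this
  exact ⟨ch, hch⟩

section

variable {ch : V → V → Bool → V} {k : Bool} {h : ℕ} {o : V} {p : Fin 3 → V}

theorem Branch.children (hch : ∀ x y, G.Adj x y → Nb G x y (ch x y false) (ch x y true))
    {x y : V} (hb : Branch G k (h + 1) x y) (b : Bool) : Branch G k h (ch x y b) x := by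
  have hn := hch x y hb.adj
  obtain ⟨p₁, p₂, h1, h2, h3⟩ := hb
  have hmem : ∀ z, G.Adj x z → z ≠ y → Branch G k h z x := by
    intro z hz hne
    rcases h1.mem hz with rfl | rfl | rfl
    exacts [absurd rfl hne, h2, h3]
  cases b
  exacts [hmem _ hn.adj₂ hn.1.symm, hmem _ hn.adj₃ hn.2.1.symm]

theorem branch_treeMap (hch : ∀ x y, G.Adj x y → Nb G x y (ch x y false) (ch x y true))
    (hC : Center G k h o) (hp : ∀ i, G.Adj o (p i)) (i : Fin 3) {l : List Bool} {j : ℕ}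
    (hl : l.length + j = h) :
    Branch G k j (treeMap ch o p (.node i l)) (treeMap ch o p (TreeNode.node i l).parent) := by
  rw [← follow_snd]
  induction l generalizing j with
  | nil =>
    obtain rfl : j = h := by simpa using hl
    exact hC _ (hp i)
  | cons b l ih => exact (ih (j := j + 1) (by simp at hl; omega)).children hch b

theorem nb_treeMap (hch : ∀ x y, G.Adj x y → Nb G x y (ch x y false) (ch x y true))
    (hC : Center G k h o) (hp : ∀ i, G.Adj o (p i)) (i : Fin 3) {l : List Bool}
    (hl : l.length ≤ h) :
    Nb G (treeMap ch o p (.node i l)) (treeMap ch o p (TreeNode.node i l).parent)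
      (treeMap ch o p (.node i (false :: l))) (treeMap ch o p (.node i (true :: l))) := by
  obtain ⟨j, hj⟩ := Nat.exists_eq_add_of_le hl
  have hb := branch_treeMap hch hC hp i hj.symm
  have := hch _ _ hb.adj
  rw [← follow_snd] at this ⊢
  exact this

theorem Center.branch_succ (hC : Center G k h o) {a b c : V} (hn : Nb G o a b c) :
    Branch G k (h + 1) o a := ⟨b, c, hn, hC _ hn.adj₂, hC _ hn.adj₃⟩

/-- Heights separate `o` from the rest: `o` itself has height `h + 1`, nodes of depth `1` to `h + 1`
have height at most `h`, and the images of the leaves and of the gadget vertices are interior. -/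
theorem Center.fiber (hch : ∀ x y, G.Adj x y → Nb G x y (ch x y false) (ch x y true))
    (hC : Center G k h o) (hn : Nb G o (p 0) (p 1) (p 2)) {I : Type}
    (f : TVertex (h + 2) ⊕ (LeafPair (h + 2) × I) → V)
    (hval : ∀ t, f (.inl t) = treeMap ch o p t.1)
    (hu : ∀ q : LeafPair (h + 2), Interior G (treeMap ch o p q.u.1))
    (hv : ∀ q : LeafPair (h + 2), Interior G (treeMap ch o p q.v.1))
    (hg : ∀ q a, Interior G (f (.inr (q, a)))) (t) (ht : f t = o) :
    t = .inl ⟨.root, Nat.zero_le _⟩ := by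
  have hp : ∀ i, G.Adj o (p i) := by
    intro i
    fin_cases i
    exacts [hn.adj₁, hn.adj₂, hn.adj₃]
  have hb := hC.branch_succ hn
  rcases t with ⟨t, h'⟩ | ⟨q, a⟩
  · rcases t with _ | ⟨i, l⟩
    · rfl
    · exfalso
      rw [hval] at ht
      by_cases hl : l.length ≤ h
      · obtain ⟨j, hj⟩ := Nat.exists_eq_add_of_le hl
        have hb' := branch_treeMap hch hC hp i hj.symm
        rw [ht] at hb'
        have := (hb.height_unique hb').2
        omega
      · rcases l with _ | ⟨b, l⟩
        · simp at hl
        · have hl' : l.length + 2 = h + 2 := by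
            simp [TreeNode.depth] at h' hl
            omega
          cases b
          · exact hb.not_interior (ht ▸ hu (i, ⟨l, hl'⟩))
          · exact hb.not_interior (ht ▸ hv (i, ⟨l, hl'⟩))
  · exact absurd (ht ▸ hg q a) hb.not_interior

end

theorem Leaf2.of_nb {l o e₁ e₂ : V} (h : Leaf G false l o) (hn : Nb G l o e₁ e₂) :
    ∃ b c, Leaf2 G l o e₁ e₂ b c := by
  obtain ⟨f₁, f₂, b, c, h⟩ := h
  rcases hn.rot.pair h.nl.rot with ⟨rfl, rfl⟩ | ⟨rfl, rfl⟩
  exacts [⟨b, c, h⟩, ⟨b, c, h.symm_e⟩]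

theorem Leaf3.of_nb {l o e₁ e₂ : V} (h : Leaf G true l o) (hn : Nb G l o e₁ e₂) :
    ∃ x w z y, Leaf3 G l o e₁ e₂ x w z y := by
  obtain ⟨f₁, f₂, x, w, z, y, h⟩ := h
  rcases hn.rot.pair h.nl.rot with ⟨rfl, rfl⟩ | ⟨rfl, rfl⟩
  exacts [⟨x, w, z, y, h⟩, ⟨z, y, x, w, h.symm_e⟩]

/-- Roots of pieces sit at depth `h + 1`, and their interior neighbors are the leaves of `T_n`,
whence `n = h + 2`. Prescribing the images of the children of the root allows two such isomorphisms
to be compared in `Center.exists_swap`. -/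
theorem Center.exists_iso_two (hconn : G.Connected) (hc : Cubic G) {h : ℕ} {o : V}
    (hC : Center G false h o) {p : Fin 3 → V} (hn : Nb G o (p 0) (p 1) (p 2)) :
    ∃ Ψ : graphRTwo (h + 2) ≃g G, Ψ (.inl ⟨.root, Nat.zero_le _⟩) = o ∧
      ∀ i, Ψ (.inl ⟨.node i [], by simp [TreeNode.depth]⟩) = p i := by
  obtain ⟨ch, hch⟩ := hc.exists_children
  have hp : ∀ i, G.Adj o (p i) := by
    intro i
    fin_cases i
    exacts [hn.adj₁, hn.adj₂, hn.adj₃]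
  have hL : ∀ q : LeafPair (h + 2), ∃ b c, Leaf2 G (treeMap ch o p q.base.1)
      (treeMap ch o p q.base.1.parent) (treeMap ch o p q.u.1) (treeMap ch o p q.v.1) b c := by
    rintro ⟨i, l, hl⟩
    have hl' : l.length = h := by omega
    exact Leaf2.of_nb (branch_treeMap hch hC hp i (j := 0) hl')
      (nb_treeMap hch hC hp i hl'.le)
  choose b c hL using hL
  let g : LeafPair (h + 2) → GadgetTwo → V := fun q a => match a with
    | .x => b q
    | .y => c q
  obtain ⟨Ψ, hΨ⟩ := exists_iso_of_tree (H := SimpleGraph.fromEdgeSet {s(GadgetTwo.x, .y)})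
    hconn (a₁ := .x) (a₂ := .y) (a₃ := .x) (a₄ := .y) (by simp) (by simp)
    (by rintro (_ | _) <;> simp) (Sum.elim (fun t => treeMap ch o p t.1) fun q => g q.1 q.2)
    (treeMap ch o p) (fun _ => rfl) hn (fun i l hl => nb_treeMap hch hC hp i hl)
    (fun q => (hL q).n₁) (fun q => (hL q).n₂) (by
      rintro q (_ | _)
      · refine ⟨.inr (q, .y), .inl q.u, .inl q.v, ⟨by simp, by simp, ?_, ?_⟩, (hL q).nb⟩
        · simp [LeafPair.u_ne_v]
        · rintro (t | ⟨q', _ | _⟩) <;>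
            simp [addGadgets_adj_inr_inl, addGadgets_adj_inr, eq_comm]
      · refine ⟨.inr (q, .x), .inl q.u, .inl q.v, ⟨by simp, by simp, ?_, ?_⟩, (hL q).nc⟩
        · simp [LeafPair.u_ne_v]
        · rintro (t | ⟨q', _ | _⟩) <;>
            simp [addGadgets_adj_inr_inl, addGadgets_adj_inr, eq_comm])
    (hC.fiber hch hn _ (fun _ => rfl) (fun q => (hL q).int_e₁) (fun q => (hL q).int_e₂) (by
      rintro q (_ | _)
      exacts [(hL q).int_b, (hL q).int_c]))
  exact ⟨Ψ, hΨ _, fun i => hΨ _⟩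

theorem Center.exists_iso_three (hconn : G.Connected) (hc : Cubic G) {h : ℕ} {o : V}
    (hC : Center G true h o) {p : Fin 3 → V} (hn : Nb G o (p 0) (p 1) (p 2)) :
    ∃ Ψ : graphRThree (h + 2) ≃g G, Ψ (.inl ⟨.root, Nat.zero_le _⟩) = o ∧
      ∀ i, Ψ (.inl ⟨.node i [], by simp [TreeNode.depth]⟩) = p i := by
  obtain ⟨ch, hch⟩ := hc.exists_children
  have hp : ∀ i, G.Adj o (p i) := by
    intro i
    fin_cases i
    exacts [hn.adj₁, hn.adj₂, hn.adj₃]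
  have hL : ∀ q : LeafPair (h + 2), ∃ x w z y, Leaf3 G (treeMap ch o p q.base.1)
      (treeMap ch o p q.base.1.parent) (treeMap ch o p q.u.1) (treeMap ch o p q.v.1) x w z y := by
    rintro ⟨i, l, hl⟩
    have hl' : l.length = h := by omega
    exact Leaf3.of_nb (branch_treeMap hch hC hp i (j := 0) hl')
      (nb_treeMap hch hC hp i hl'.le)
  choose x w z y hL using hL
  let g : LeafPair (h + 2) → GadgetThree → V := fun q a => match a with
    | .x => x q
    | .y => y q
    | .z => z q
    | .w => w q
  obtain ⟨Ψ, hΨ⟩ := exists_iso_of_tree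
    (H := SimpleGraph.fromEdgeSet {s(GadgetThree.x, .z), s(.y, .w), s(.x, .y), s(.z, .w)})
    hconn (a₁ := .x) (a₂ := .w) (a₃ := .z) (a₄ := .y) (by simp) (by simp)
    (by rintro (_ | _) <;> simp) (Sum.elim (fun t => treeMap ch o p t.1) fun q => g q.1 q.2)
    (treeMap ch o p) (fun _ => rfl) hn (fun i l hl => nb_treeMap hch hC hp i hl)
    (fun q => (hL q).n₁) (fun q => (hL q).n₂) (by
      rintro q (_ | _)
      · refine ⟨.inl q.u, .inr (q, .z), .inr (q, .y), ⟨by simp, by simp, by simp, ?_⟩, (hL q).nx⟩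
        rintro (t | ⟨q', _ | _⟩) <;> simp [addGadgets_adj_inr_inl, addGadgets_adj_inr, eq_comm]
      · refine ⟨.inl q.v, .inr (q, .x), .inr (q, .w), ⟨by simp, by simp, by simp, ?_⟩, (hL q).ny⟩
        rintro (t | ⟨q', _ | _⟩) <;> simp [addGadgets_adj_inr_inl, addGadgets_adj_inr, eq_comm]
      · refine ⟨.inl q.v, .inr (q, .x), .inr (q, .w), ⟨by simp, by simp, by simp, ?_⟩, (hL q).nz⟩
        rintro (t | ⟨q', _ | _⟩) <;> simp [addGadgets_adj_inr_inl, addGadgets_adj_inr, eq_comm]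
      · refine ⟨.inl q.u, .inr (q, .z), .inr (q, .y), ⟨by simp, by simp, by simp, ?_⟩, (hL q).nw⟩
        rintro (t | ⟨q', _ | _⟩) <;> simp [addGadgets_adj_inr_inl, addGadgets_adj_inr, eq_comm])
    (hC.fiber hch hn _ (fun _ => rfl) (fun q => (hL q).int_e₁) (fun q => (hL q).int_e₂) (by
      rintro q (_ | _)
      exacts [(hL q).int_x, (hL q).int_y, (hL q).int_z, (hL q).int_w]))
  exact ⟨Ψ, hΨ _, fun i => hΨ _⟩

theorem Center.exists_iso (hconn : G.Connected) (hc : Cubic G) {k : Bool} {h : ℕ} {o : V}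
    (hC : Center G k h o) :
    (∃ n : ℕ, 2 ≤ n ∧ Nonempty (G ≃g graphRTwo n)) ∨
      ∃ n : ℕ, 2 ≤ n ∧ Nonempty (G ≃g graphRThree n) := by
  obtain ⟨a, b, c, hn⟩ := hc o
  cases k
  · obtain ⟨Ψ, -⟩ := hC.exists_iso_two hconn hc (p := ![a, b, c]) hn
    exact Or.inl ⟨_, Nat.le_add_left _ _, ⟨Ψ.symm⟩⟩
  · obtain ⟨Ψ, -⟩ := hC.exists_iso_three hconn hc (p := ![a, b, c]) hn
    exact Or.inr ⟨_, Nat.le_add_left _ _, ⟨Ψ.symm⟩⟩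

/-- The branches at a center can be interchanged. -/
theorem Center.exists_swap (hconn : G.Connected) (hc : Cubic G) {k : Bool} {h : ℕ} {o a b c : V}
    (hC : Center G k h o) (hn : Nb G o a b c) :
    ∃ φ : G ≃g G, φ o = o ∧ φ a = b ∧ φ b = a ∧ φ c = c := by
  have key : ∀ {W : Type} {M : SimpleGraph W} (Ψ Φ : M ≃g G) {s x y}, Ψ s = x → Φ s = y →
      (Ψ.symm.trans Φ) x = y := by
    rintro W M Ψ Φ s _ _ rfl rfl
    exact congrArg Φ (Ψ.symm_apply_apply s)
  cases k
  · obtain ⟨Ψ, h1, h2⟩ := hC.exists_iso_two hconn hc (p := ![a, b, c]) hn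
    obtain ⟨Φ, h3, h4⟩ := hC.exists_iso_two hconn hc (p := ![b, a, c]) hn.comm
    exact ⟨Ψ.symm.trans Φ, key Ψ Φ h1 h3, key Ψ Φ (h2 0) (h4 0), key Ψ Φ (h2 1) (h4 1),
      key Ψ Φ (h2 2) (h4 2)⟩
  · obtain ⟨Ψ, h1, h2⟩ := hC.exists_iso_three hconn hc (p := ![a, b, c]) hn
    obtain ⟨Φ, h3, h4⟩ := hC.exists_iso_three hconn hc (p := ![b, a, c]) hn.comm
    exact ⟨Ψ.symm.trans Φ, key Ψ Φ h1 h3, key Ψ Φ (h2 0) (h4 0), key Ψ Φ (h2 1) (h4 1),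
      key Ψ Φ (h2 2) (h4 2)⟩


/-! ### Vertices of type 2 and type 3 -/

theorem cubic_of_isRegularOfDegree [G.LocallyFinite] (h : G.IsRegularOfDegree 3) : Cubic G := by
  classical
  intro p
  obtain ⟨a, b, c, h1, h2, h3, h4⟩ := Finset.card_eq_three.1 (h p)
  refine ⟨a, b, c, h1, h2, h3, fun x => ?_⟩
  rw [← SimpleGraph.mem_neighborFinset, h4]
  simp

theorem exists_mem_localAction {v : V} {φ : G ≃g G} (hφ : φ v = v) :
    ∃ σ ∈ localAction G v, ∀ a : G.neighborSet v, (σ a : V) = φ a := by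
  refine ⟨φ.toEquiv.subtypeEquiv fun a => ?_, ⟨φ, hφ, fun a => rfl⟩, fun a => rfl⟩
  change G.Adj v a ↔ G.Adj v (φ a)
  rw [← φ.map_adj_iff, hφ]

theorem IsTypeTwo.exists_nb (hc : Cubic G) {v : V} (h : IsTypeTwo G v) :
    ∃ a b c, Nb G v a b c ∧ (∀ φ : G ≃g G, φ v = v → φ a = a) ∧
      ∃ φ : G ≃g G, φ v = v ∧ φ b = c ∧ φ c = b := by
  obtain ⟨-, a, b, c, hab, hac, hbc, hfix, σ, ⟨φ, hφ, hσφ⟩, h1, h2⟩ := h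
  obtain ⟨d, hd⟩ := hc.nb₂ a.2 b.2 (Subtype.coe_injective.ne hab)
  have hcd : (c : V) = d := by
    rcases hd.mem c.2 with e | e | e
    exacts [absurd (Subtype.ext e).symm hac, absurd (Subtype.ext e).symm hbc, e]
  refine ⟨a, b, c, hcd ▸ hd, fun ψ hψ => ?_, φ, hφ, ?_, ?_⟩
  · obtain ⟨τ, hτ, hτψ⟩ := exists_mem_localAction hψ
    rw [← hτψ, hfix τ hτ]
  · rw [← hσφ, h1]
  · rw [← hσφ, h2]

/-- A group of permutations of three points that has no fixed point and contains a nontrivial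
element with a fixed point is the full symmetric group. -/
theorem eq_top_of_swap {α : Type*} [DecidableEq α] [Finite α] {a b c : α}
    (hall : ∀ x, x = a ∨ x = b ∨ x = c) (K : Subgroup (Equiv.Perm α))
    (hK : ∀ x, ∃ σ ∈ K, σ x ≠ x) (hb : Equiv.swap a c ∈ K) (hab : a ≠ b) (hac : a ≠ c)
    (hbc : b ≠ c) : K = ⊤ := by
  -- `T z` says that the transposition fixing `z` lies in `K`. Conjugation transports it along
  -- orbits, and `swap a c` together with an element moving `b` makes the orbit of `b` everything.
  let T : α → Prop := fun z => ∀ x y, x ≠ z → y ≠ z → Equiv.swap x y ∈ K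
  have hT : ∀ σ ∈ K, ∀ z, T z → T (σ z) := by
    intro σ hσ z hz x y hx hy
    have h1 := K.mul_mem (K.mul_mem hσ (hz (σ⁻¹ x) (σ⁻¹ y) (fun e => hx (by simp [← e]))
      fun e => hy (by simp [← e]))) (K.inv_mem hσ)
    rw [← Equiv.swap_apply_apply] at h1
    simpa using h1
  have hTb : T b := by
    intro x y hx hy
    rcases hall x with rfl | rfl | rfl <;> rcases hall y with rfl | rfl | rfl
    all_goals first
      | exact absurd rfl hx
      | exact absurd rfl hy
      | exact hb
      | (rw [Equiv.swap_comm]; exact hb)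
      | (rw [Equiv.swap_self]; exact K.one_mem)
  obtain ⟨σ, hσ, hσb⟩ := hK b
  have h1 := hT σ hσ b hTb
  have h2 : T (Equiv.swap a c (σ b)) := hT _ hb _ h1
  have hT' : ∀ z, T z := by
    rcases hall (σ b) with e | e | e
    · rw [e] at h1 h2
      rw [Equiv.swap_apply_left] at h2
      intro z
      rcases hall z with rfl | rfl | rfl
      exacts [h1, hTb, h2]
    · exact absurd e hσb
    · rw [e] at h1 h2
      rw [Equiv.swap_apply_right] at h2
      intro z
      rcases hall z with rfl | rfl | rfl
      exacts [h2, hTb, h1]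
  rw [eq_top_iff, ← Equiv.Perm.closure_isSwap, Subgroup.closure_le]
  rintro _ ⟨x, y, hxy, rfl⟩
  by_cases h : a ≠ x ∧ a ≠ y
  · exact hT' a x y h.1.symm h.2.symm
  · by_cases h' : b ≠ x ∧ b ≠ y
    · exact hT' b x y h'.1.symm h'.2.symm
    · refine hT' c x y ?_ ?_ <;> clear hT hT' hTb h1 h2 hK <;> grind

/-- If an element of the stabilizer fixed one neighbor and moved another, it would induce a
transposition. Together with the absence of fixed neighbors this would give the full symmetric
group. -/
theorem IsTypeThree.exists_nb (hc : Cubic G) {v : V} (h : IsTypeThree G v) :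
    (∀ x, G.Adj v x → ∃ φ : G ≃g G, φ v = v ∧ φ x ≠ x) ∧
      ∀ φ : G ≃g G, φ v = v → ∀ x, G.Adj v x → φ x = x → ∀ y, G.Adj v y → φ y = y := by
  classical
  obtain ⟨-, h1, h2⟩ := h
  push Not at h1
  constructor
  · intro x hx
    obtain ⟨σ, ⟨φ, hφ, hσφ⟩, hne⟩ := h1 ⟨x, hx⟩
    exact ⟨φ, hφ, fun e => hne (Subtype.ext ((hσφ _).trans e))⟩
  · intro φ hφ b hb hφb
    by_contra! hcon
    obtain ⟨a, ha, hφa⟩ := hcon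
    have hab : a ≠ b := fun e => hφa (e ▸ hφb)
    obtain ⟨c, hn⟩ := hc.nb₂ ha hb hab
    have hn' := hn.map φ
    rw [hφ, hφb] at hn'
    have hφac : φ a = c ∧ φ c = a := by
      rcases hn.swap.pair (a' := φ a) (b' := φ c) hn'.swap with e | e
      exacts [absurd e.1 hφa, e]
    obtain ⟨σ, hσ, hσφ⟩ := exists_mem_localAction hφ
    have hall : ∀ x : G.neighborSet v, x = ⟨a, ha⟩ ∨ x = ⟨b, hb⟩ ∨ x = ⟨c, hn.adj₃⟩ := by
      rintro ⟨x, hx⟩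
      rcases hn.mem hx with rfl | rfl | rfl
      exacts [Or.inl rfl, Or.inr (Or.inl rfl), Or.inr (Or.inr rfl)]
    have n1 : (⟨a, ha⟩ : G.neighborSet v) ≠ ⟨b, hb⟩ := fun e => hn.1 (congrArg Subtype.val e)
    have n2 : (⟨a, ha⟩ : G.neighborSet v) ≠ ⟨c, hn.adj₃⟩ :=
      fun e => hn.2.1 (congrArg Subtype.val e)
    have n3 : (⟨b, hb⟩ : G.neighborSet v) ≠ ⟨c, hn.adj₃⟩ :=
      fun e => hn.2.2.1 (congrArg Subtype.val e)
    have : Finite (G.neighborSet v) := by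
      refine Set.Finite.subset (Set.toFinite {a, b, c}) fun x hx => ?_
      simpa using hn.mem hx
    refine h2 (eq_top_of_swap hall _ h1 ?_ n1 n2 n3)
    convert hσ
    ext x
    rw [hσφ]
    rcases hall x with rfl | rfl | rfl
    · rw [Equiv.swap_apply_left]
      exact hφac.1.symm
    · rw [Equiv.swap_apply_of_ne_of_ne n1.symm n3]
      exact hφb.symm
    · rw [Equiv.swap_apply_right]
      exact hφac.2.symm

theorem TwoDist.distinguishingNumber_eq (hd : TwoDist G) {φ : G ≃g G} {v : V} (hφ : φ v ≠ v) :
    distinguishingNumber G = 2 := by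
  classical
  refine le_antisymm ?_ ?_
  · obtain ⟨Q, hQ⟩ := hd
    refine iInf₂_le_of_le 2 ⟨fun v => if v ∈ Q then 1 else 0, fun ψ hψ => hQ ψ fun v => ?_⟩ le_rfl
    have := hψ v
    by_cases h1 : ψ v ∈ Q <;> by_cases h2 : v ∈ Q <;> simp [h1, h2] at this ⊢
  · refine le_iInf₂ fun k hk => ?_
    obtain ⟨c, hc⟩ := hk
    by_contra hlt
    have hk2 : k < 2 := by
      rw [not_le] at hlt
      exact_mod_cast hlt
    have : Subsingleton (Fin k) := Fin.subsingleton_iff_le_one.2 (by omega)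
    exact hφ (hc φ (fun _ => Subsingleton.elim _ _) v)

theorem IsTypeTwo.twoDist_or (hconn : G.Connected) (hc : Cubic G) {v : V} (h : IsTypeTwo G v) :
    TwoDist G ∨ ∃ k h o, Center G k h o := by
  by_contra! hcon
  obtain ⟨hd, hno⟩ := hcon
  obtain ⟨a, b, c, hn, hfix, -⟩ := h.exists_nb hc
  have hG : Stubborn G := .of_rigid hconn hc hd hn fun φ h _ => hfix φ h
  have hl : ∀ k l o, ¬ Leaf G k l o := by
    intro k l o hl
    obtain ⟨k, h, o, hC⟩ := hG.exists_center hl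
    exact hno k h o hC
  have hS : Start G v a b c := by
    refine ⟨hG, hn, ?_, ?_, ?_, fun k o => hl k v o⟩
    · intro φ h1 h2 x hx
      have h3 := hn.map φ
      rw [h1, h2, hfix φ h1] at h3
      rcases hn.mem hx with rfl | rfl | rfl
      exacts [hfix φ h1, h2, hn.third h3]
    · intro φ h1
      have h3 := hn.map φ
      rw [h1, hfix φ h1] at h3
      rcases hn.mem h3.adj₂ with e | e | e
      exacts [absurd e.symm h3.1, Or.inl e, Or.inr (Or.inl e)]
    · rintro (⟨l, o, e₁, e₂, b, c, h, -⟩ | ⟨l, o, e₁, e₂, x, w, z, y, h, -⟩)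
      exacts [hl false l o ⟨_, _, _, _, h⟩, hl true l o ⟨_, _, _, _, _, _, h⟩]
  obtain ⟨k, h, hb⟩ := hS.exists_branch
  obtain ⟨l, o, hl'⟩ := hb.exists_leaf
  exact hl k l o hl'

theorem IsTypeThree.twoDist (hconn : G.Connected) (hc : Cubic G) {v : V} (h : IsTypeThree G v) :
    TwoDist G := by
  by_contra hd
  obtain ⟨hmove, hrig⟩ := h.exists_nb hc
  obtain ⟨a, b, c, hn⟩ := hc v
  have hG : Stubborn G := .of_rigid hconn hc hd hn fun φ h1 h2 => hrig φ h1 b hn.adj₂ h2 a hn.adj₁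
  have hS : Start G v a b c := by
    refine ⟨hG, hn, fun φ h1 h2 => hrig φ h1 b hn.adj₂ h2, ?_, ?_, ?_⟩
    · intro φ h1
      have h3 := hn.map φ
      rw [h1] at h3
      rcases hn.mem h3.adj₂ with e | e | e
      · rcases hn.mem h3.adj₃ with e' | e' | e'
        · exact absurd (e.trans e'.symm) h3.2.2.1
        · exact Or.inr (Or.inr e')
        · exact Or.inl (hrig φ h1 c hn.adj₃ e' b hn.adj₂)
      · exact Or.inl e
      · exact Or.inr (Or.inl e)
    · intro hi
      obtain ⟨x, y, z, hn', φ, h1, h2, h3, -⟩ := hi.swap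
      have := hrig φ h1 x hn'.adj₁ h2 y hn'.adj₂
      exact hn'.2.2.1 (this.symm.trans h3)
    · intro k o hl
      obtain ⟨_, _, hn', -⟩ := hl.exists_nb
      obtain ⟨φ, h1, h2⟩ := hmove o hn'.adj₁
      have := hl.map φ
      rw [h1] at this
      exact h2 (this.outer_unique hl)
  obtain ⟨k, h, hb⟩ := hS.exists_branch
  obtain ⟨φ, h1, h2⟩ := hmove b hn.adj₂
  have hb1 := hb.map φ
  have hb2 := hb1.map φ
  rw [h1] at hb1 hb2
  rw [h1] at hb2
  obtain ⟨d, hd'⟩ := hc.nb₂ hb.adj.symm hb1.adj.symm (Ne.symm h2)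
  -- If `φ` exchanged `b` and `φ b`, it would fix the third neighbor and hence, by rigidity, all of
  -- them. So `φ` rotates the neighbors and carries the branch at `b` to each of them.
  have hd2 : φ (φ b) = d := by
    rcases hd'.mem hb2.adj.symm with e | e | e
    · exfalso
      have h3 := hd'.map φ
      rw [h1, e] at h3
      exact h2 (hrig φ h1 d hd'.adj₃ (hd'.third h3.comm) b hn.adj₂)
    · exact absurd (φ.injective e) h2
    · exact e
  have hC : Center G k h v := by
    intro x hx
    rcases hd'.mem hx with rfl | rfl | rfl
    exacts [hb, hb1, hd2 ▸ hb2]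
  obtain ⟨ψ, k1, k2, k3, k4⟩ := hC.exists_swap hconn hc hn
  exact hn.1 ((hrig ψ k1 c hn.adj₃ k4 a hn.adj₁).symm.trans k2)


end CubicGraph

theorem theorem5p6 {V : Type u} (G : SimpleGraph V) [G.LocallyFinite]
    (hconn : G.Connected) (hcubic : G.IsRegularOfDegree 3) :
    ((∃ v, CubicGraph.IsTypeTwo G v) →
      CubicGraph.distinguishingNumber G = 2 ∨
      (∃ n : ℕ, 2 ≤ n ∧ Nonempty (G ≃g CubicGraph.graphRTwo n)) ∨
      (∃ n : ℕ, 2 ≤ n ∧ Nonempty (G ≃g CubicGraph.graphRThree n))) ∧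
    ((∃ v, CubicGraph.IsTypeThree G v) → CubicGraph.distinguishingNumber G = 2) := by
  have hc := CubicGraph.cubic_of_isRegularOfDegree hcubic
  constructor
  · rintro ⟨v, hv⟩
    rcases hv.twoDist_or hconn hc with hd | ⟨k, h, o, hC⟩
    · obtain ⟨a, b, c, hn, -, φ, -, hφ, -⟩ := hv.exists_nb hc
      exact Or.inl (hd.distinguishingNumber_eq (φ := φ) (v := b) (hφ ▸ hn.2.2.1.symm))
    · exact Or.inr (hC.exists_iso hconn hc)
  · rintro ⟨v, hv⟩
    obtain ⟨a, b, c, hn⟩ := hc v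
    obtain ⟨φ, -, hφ⟩ := (hv.exists_nb hc).1 a hn.adj₁
    exact (hv.twoDist hconn hc).distinguishingNumber_eq hφ
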